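/- Work over $\mathbb{C}$; varieties are reduced, not necessarily irreducible. For a topological space $X$ and an open subset $U\subset X$, a \emph{boundary divisor} of $X$ with respect to $U$ is an irreducible closed subset of $X$ of codimension one contained in $X\setminus U$. Let $G$ be a complex reductive linear algebraic group, let $W\subset\mathbb{P}(E)$ be a $G$-stable closed subvariety, where $E$ is a finite-dimensional rational representation of $G$, and let $\mathbb{C}[\hat W]$ be its homogeneous coordinate ring. Let $W_{ss}$ be the semistable locus (the open set of points at which some homogeneous $G$-invariant of positive degree in $\mathbb{C}[\hat W]$ does not vanish), $W/\!\!/G=\operatorname{Proj}(\mathbb{C}[\hat W]^G)$ the GIT quotient, and $q\colon W_{ss}\to W/\!\!/G$ the quotient map. Let $V\subset W$ be a $G$-stable, dense, affine open subset with $V\subset W_{ss}$ (so $W$ is a compactification of the affine $G$-variety $V$ to which the $G$-action extends), and let $V/\!\!/G=\operatorname{Spec}(\mathbb{C}[V]^G)$. Give the closed subvariety $W\setminus V\subset\mathbb{P}(E)$ the restricted linearization, and let $(W\setminus V)/\!\!/G$ be its GIT quotient, i.e. $\operatorname{Proj}$ of the ring of $G$-invariants in the homogeneous coordinate ring of $W\setminus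 V$. Assume that for each boundary divisor $D$ of $W$ with respect to $V$ the set $D\cap W_{ss}$ is saturated for $q$, that is, $D\cap W_{ss}=q^{-1}(q(D\cap W_{ss}))$. Then there is an open immersion $V/\!\!/G\to W/\!\!/G$ with dense image that is compatible with the quotient maps from $V$ and from $W_{ss}$; restriction of invariants induces an everywhere defined closed immersion $(W\setminus V)/\!\!/G\to W/\!\!/G$ with image $q((W\setminus V)\cap W_{ss})$; and, with these identifications, the boundary divisors of $W/\!\!/G$ with respect to $V/\!\!/G$ are exactly the irreducible components of $(W\setminus V)/\!\!/G$. -/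

import Mathlib

open CategoryTheory AlgebraicGeometry HomogeneousLocalization Graded

universe u

set_option linter.unusedSectionVars false

noncomputable section

namespace GIT

/-! ### Complex linear algebraic groups and their rational representations -/

section Groups

variable {n : ℕ}

/-- A subgroup of `GL_n(ℂ)` cut out by polynomial equations in the matrix entries. -/
def IsZariskiClosed (G : Subgroup (GL (Fin n) ℂ)) : Prop :=
  ∃ S : Set (MvPolynomial (Fin n × Fin n) ℂ), ∀ g : GL (Fin n) ℂ,
    g ∈ G ↔ ∀ p ∈ S, MvPolynomial.eval (fun ij ↦ g.val ij.1 ij.2) p = 0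

/-- The algebra of regular functions on a linear algebraic group `G ⊆ GL_n(ℂ)`: the functions
that are polynomial in the matrix entries and in the inverse of the determinant. -/
def regularFunctions (G : Subgroup (GL (Fin n) ℂ)) : Subalgebra ℂ (G → ℂ) :=
  Algebra.adjoin ℂ
    ({φ | ∃ i j, φ = fun g : G ↦ g.1.val i j} ∪ {φ | φ = fun g : G ↦ (g.1.val.det)⁻¹})

/-- A representation is rational if all its matrix coefficients are regular functions. -/
def IsRational {G : Subgroup (GL (Fin n) ℂ)} {E : Type*} [AddCommGroup E] [Module ℂ E]
    (ρ : Representation ℂ G E) : Prop :=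
  ∀ (v : E) (l : Module.Dual ℂ E), (fun g ↦ l (ρ g v)) ∈ regularFunctions G

/-- Complex reductive groups: linear algebraic groups over `ℂ` all of whose finite-dimensional
rational representations are completely reducible. -/
structure IsReductive (G : Subgroup (GL (Fin n) ℂ)) : Prop where
  closed : IsZariskiClosed G
  semisimple : ∀ (m : ℕ) (ρ : Representation ℂ G (Fin m → ℂ)), IsRational ρ →
    ρ.IsSemisimpleRepresentation

end Groups

/-! ### The rational map of `Proj`s induced by a graded ring homomorphism -/

section ProjMap

variable {A B : Type u} [CommRing A] [CommRing B] {σ τ : Type u} [SetLike σ A]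
  [AddSubgroupClass σ A] [SetLike τ B] [AddSubgroupClass τ B] {𝒜 : ℕ → σ} {ℬ : ℕ → τ}
  [GradedRing 𝒜] [GradedRing ℬ] (f : 𝒜 →+*ᵍ ℬ)

/-- Homogeneous elements of positive degree. -/
abbrev PosHomog (𝒜 : ℕ → σ) : Type u := Σ' (i : ℕ) (s : A), 0 < i ∧ s ∈ 𝒜 i

/-- The union of the open sets `D₊(f s)`, for `s` homogeneous of positive degree: the domain on
which `f : 𝒜 → ℬ` induces a morphism from `Proj ℬ` to `Proj 𝒜`. -/
def projMapDomain : (Proj ℬ).Opens :=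
  ⨆ s : PosHomog 𝒜, Proj.basicOpen ℬ (f s.2.1)

/-- The morphism `D₊(f s) = Spec ℬ_(f s) ⟶ Spec 𝒜_(s) = D₊(s) ⊆ Proj 𝒜`. -/
def projMapPiece (s : PosHomog 𝒜) : (Proj.basicOpen ℬ (f s.2.1)).toScheme ⟶ Proj 𝒜 :=
  Proj.basicOpenToSpec ℬ (f s.2.1) ≫ Spec.map (CommRingCat.ofHom (Away.map f s.2.1)) ≫
    Proj.awayι 𝒜 s.2.1 s.2.2.2 s.2.2.1

lemma away_map_awayMap {i j : ℕ} {s t : A} (hs : s ∈ 𝒜 i) (ht : t ∈ 𝒜 j) :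
    (Away.map f (s * t)).comp (awayMap 𝒜 ht rfl) =
      (awayMap ℬ (map_mem f ht) (map_mul f s t)).comp (Away.map f s) := by
  ext a
  obtain ⟨n, a, ha, rfl⟩ := a.mk_surjective _ hs
  simp [Away.map_mk, awayMap_mk]

lemma homOfLE_projMapPiece (s t r : PosHomog 𝒜) (h : r.2.1 = s.2.1 * t.2.1)
    (e : Proj.basicOpen ℬ (f r.2.1) ≤ Proj.basicOpen ℬ (f s.2.1)) :
    (Proj ℬ).homOfLE e ≫ projMapPiece f s = projMapPiece f r := by
  obtain ⟨i, s, hi, hs⟩ := s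
  obtain ⟨j, t, hj, ht⟩ := t
  obtain ⟨k, r, hk, hr⟩ := r
  dsimp only at h
  subst h
  dsimp only [projMapPiece]
  rw [← Proj.basicOpenToSpec_SpecMap_awayMap_assoc ℬ (map_mem f ht) (map_mul f s t),
    ← Spec.map_comp_assoc, ← CommRingCat.ofHom_comp, ← away_map_awayMap f hs ht,
    CommRingCat.ofHom_comp, Spec.map_comp_assoc, Proj.SpecMap_awayMap_awayι]
  rfl

lemma basicOpen_le_projMapDomain (s : PosHomog 𝒜) :
    Proj.basicOpen ℬ (f s.2.1) ≤ projMapDomain f :=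
  le_iSup (fun s : PosHomog 𝒜 ↦ Proj.basicOpen ℬ (f s.2.1)) s

lemma projMapPiece_compat (s t : PosHomog 𝒜)
    (hs : Proj.basicOpen ℬ (f s.2.1) ≤ projMapDomain f)
    (ht : Proj.basicOpen ℬ (f t.2.1) ≤ projMapDomain f) :
    Limits.pullback.fst ((Proj ℬ).homOfLE hs) ((Proj ℬ).homOfLE ht) ≫ projMapPiece f s =
      Limits.pullback.snd ((Proj ℬ).homOfLE hs) ((Proj ℬ).homOfLE ht) ≫ projMapPiece f t := by
  let r : PosHomog 𝒜 := ⟨s.1 + t.1, s.2.1 * t.2.1, Nat.add_pos_left s.2.2.1 _,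
    SetLike.mul_mem_graded s.2.2.2 t.2.2.2⟩
  have hr : Proj.basicOpen ℬ (f r.2.1) =
      Proj.basicOpen ℬ (f s.2.1) ⊓ Proj.basicOpen ℬ (f t.2.1) := by
    rw [← Proj.basicOpen_mul, ← map_mul]
  have P := isPullback_opens_inf_le hs ht
  rw [← cancel_epi P.isoPullback.hom, P.isoPullback_hom_fst_assoc, P.isoPullback_hom_snd_assoc,
    ← cancel_epi ((Proj ℬ).isoOfEq hr).hom, Scheme.isoOfEq_hom, Scheme.homOfLE_homOfLE_assoc,
    Scheme.homOfLE_homOfLE_assoc,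
    homOfLE_projMapPiece f s t r rfl (hr.trans_le inf_le_left),
    homOfLE_projMapPiece f t s r (mul_comm _ _) (hr.trans_le inf_le_right)]

/-- The morphism `projMapDomain f ⟶ Proj 𝒜` induced by `f : 𝒜 → ℬ`, glued from the morphisms
`D₊(f s) ⟶ D₊(s)`. -/
def projMap : (projMapDomain f).toScheme ⟶ Proj 𝒜 :=
  (Scheme.Opens.iSupOpenCover fun s : PosHomog 𝒜 ↦ Proj.basicOpen ℬ (f s.2.1)).glueMorphisms
    (projMapPiece f) fun s t ↦ projMapPiece_compat f s t
      (basicOpen_le_projMapDomain f s) (basicOpen_le_projMapDomain f t)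

lemma homOfLE_projMap (s : PosHomog 𝒜) :
    (Proj ℬ).homOfLE (basicOpen_le_projMapDomain f s) ≫ projMap f = projMapPiece f s :=
  (Scheme.Opens.iSupOpenCover fun s : PosHomog 𝒜 ↦ Proj.basicOpen ℬ (f s.2.1)).ι_glueMorphisms
    (projMapPiece f) (fun s t ↦ projMapPiece_compat f s t
      (basicOpen_le_projMapDomain f s) (basicOpen_le_projMapDomain f t)) s

end ProjMap

/-! ### Linearized group actions on projective varieties and their GIT quotients -/

lemma isInternal_of_proj {M : Type*} [AddCommGroup M] [Module ℂ M] (ℳ : ℕ → Submodule ℂ M)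
    (p : ℕ → M →ₗ[ℂ] M) (hid : ∀ i, ∀ m ∈ ℳ i, p i m = m)
    (hne : ∀ i j, i ≠ j → ∀ m ∈ ℳ i, p j m = 0) (hsup : ∀ m, m ∈ ⨆ i, ℳ i) :
    DirectSum.IsInternal ℳ := by
  have key : ∀ (x : DirectSum ℕ fun i ↦ ℳ i) j, p j (DirectSum.coeLinearMap ℳ x) = x j := by
    intro x j
    induction x using DirectSum.induction_on with
    | zero => simp
    | of i y =>
      rw [← DirectSum.lof_eq_of ℂ, DirectSum.coeLinearMap_lof, DirectSum.lof_eq_of]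
      by_cases h : i = j
      · subst h
        rw [hid _ _ y.2, DirectSum.of_eq_same]
      · rw [hne _ _ h _ y.2, DirectSum.of_eq_of_ne _ _ _ (Ne.symm h)]
        rfl
    | add x y hx hy => simp [hx, hy]
  constructor
  · rw [injective_iff_map_eq_zero]
    intro x hx
    ext j
    rw [← key x j]
    have : DirectSum.coeLinearMap ℳ x = 0 := hx
    simp [this]
  · intro m
    have := hsup m
    rw [← DirectSum.range_coeLinearMap] at this
    exact this

variable {G : Type*} [Group G] {A : Type u} [CommRing A] [Algebra ℂ A]

/-- An action of `G` on `A` by automorphisms of graded `ℂ`-algebras. -/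
structure GradedAction (G : Type*) [Group G] {A : Type u} [CommRing A] [Algebra ℂ A]
    (𝒜 : ℕ → Submodule ℂ A) where
  hom : G →* (A ≃ₐ[ℂ] A)
  mem : ∀ (g : G) {d : ℕ} {a : A}, a ∈ 𝒜 d → hom g a ∈ 𝒜 d

namespace GradedAction

variable {𝒜 : ℕ → Submodule ℂ A} (α : GradedAction G 𝒜)

/-- The representation of `G` on the degree `d` part. -/
def rep (d : ℕ) : Representation ℂ G (𝒜 d) where
  toFun g := (α.hom g).toLinearMap.restrict fun _ ↦ α.mem g
  map_one' := by ext; simp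
  map_mul' g h := by ext; simp; rfl

/-- The action of `g` as a homomorphism of graded rings. -/
def gradedHom (g : G) : 𝒜 →+*ᵍ 𝒜 where
  __ := (α.hom g : A →+* A)
  map_mem := α.mem g

lemma gradedHom_apply (g : G) (a : A) : α.gradedHom g a = α.hom g a := rfl

lemma hom_hom_inv (g : G) (a : A) : α.hom g (α.hom g⁻¹ a) = a := by
  rw [← AlgEquiv.mul_apply, ← map_mul]; simp

/-- The subalgebra `A^G` of invariants. -/
def invariants : Subalgebra ℂ A where
  carrier := {a | ∀ g, α.hom g a = a}
  mul_mem' ha hb g := by rw [map_mul, ha g, hb g]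
  add_mem' ha hb g := by rw [map_add, ha g, hb g]
  algebraMap_mem' r g := AlgEquiv.commutes _ r

/-- The grading of `A^G` by the homogeneous invariants. -/
def invGrading (d : ℕ) : Submodule ℂ α.invariants := (𝒜 d).comap α.invariants.val.toLinearMap

variable [GradedAlgebra 𝒜]

open HomogeneousIdeal in
lemma irrelevant_le_map (g : G) : irrelevant 𝒜 ≤ (irrelevant 𝒜).map (α.gradedHom g) := by
  rw [irrelevant_le]
  intro i hi a ha
  rw [← α.hom_hom_inv g a]
  exact Ideal.mem_map_of_mem _ (mem_irrelevant_of_mem _ hi (α.mem _ ha))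

/-- The automorphism of `Proj 𝒜` induced by the automorphism `α.hom g` of `𝒜`; this is the
action of `g⁻¹`. -/
def act (g : G) : Proj 𝒜 ⟶ Proj 𝒜 := Proj.map (α.gradedHom g) (α.irrelevant_le_map g)

lemma act_act (g : G) (x : Proj 𝒜) : α.act g⁻¹ (α.act g x) = x := by
  refine ProjectiveSpectrum.ext (HomogeneousIdeal.ext' fun i a _ ↦ ?_)
  change α.hom g (α.hom g⁻¹ a) ∈ x.asHomogeneousIdeal ↔ _
  rw [hom_hom_inv]

lemma hom_decompose (g : G) (a : A) (d : ℕ) :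
    α.hom g (DirectSum.decompose 𝒜 a d : A) = DirectSum.decompose 𝒜 (α.hom g a) d :=
  (α.gradedHom g).map_directSumDecompose ..

lemma decompose_mem_invariants {a : A} (ha : a ∈ α.invariants) (d : ℕ) :
    (DirectSum.decompose 𝒜 a d : A) ∈ α.invariants := fun g ↦ by rw [hom_decompose, ha g]

instance : SetLike.GradedMonoid α.invGrading where
  one_mem := SetLike.GradedOne.one_mem (A := 𝒜)
  mul_mem _ _ _ _ ha hb := SetLike.GradedMul.mul_mem (A := 𝒜) ha hb

/-- The projection of `A^G` to its degree `d` part. -/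
def invProj (d : ℕ) : α.invariants →ₗ[ℂ] α.invariants :=
  ((GradedAlgebra.proj 𝒜 d).comp α.invariants.val.toLinearMap).codRestrict
    (Subalgebra.toSubmodule α.invariants) fun a ↦ α.decompose_mem_invariants a.2 d

lemma coe_invProj (d : ℕ) (a : α.invariants) :
    (α.invProj d a : A) = DirectSum.decompose 𝒜 (a : A) d := rfl

lemma isInternal_invGrading : DirectSum.IsInternal α.invGrading := by
  refine isInternal_of_proj _ α.invProj (fun i m hm ↦ ?_) (fun i j hij m hm ↦ ?_) fun m ↦ ?_
  · have hm' : (m : A) ∈ 𝒜 i := hm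
    exact Subtype.ext (by rw [coe_invProj, DirectSum.decompose_of_mem_same 𝒜 hm'])
  · have hm' : (m : A) ∈ 𝒜 i := hm
    exact Subtype.ext (by rw [coe_invProj, DirectSum.decompose_of_mem_ne 𝒜 hm' hij]; rfl)
  · classical
    have : m = ∑ i ∈ (DirectSum.decompose 𝒜 (m : A)).support, α.invProj i m :=
      Subtype.ext (by
        rw [AddSubmonoidClass.coe_finsetSum]
        exact (DirectSum.sum_support_decompose 𝒜 (m : A)).symm)
    rw [this]
    exact sum_mem fun i _ ↦ Submodule.mem_iSup_of_mem i
      (SetLike.coe_mem (DirectSum.decompose 𝒜 (m : A) i))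

instance : GradedAlgebra α.invGrading where
  __ := α.isInternal_invGrading.chooseDecomposition

/-- The inclusion of `A^G` in `A`. -/
def invIncl : α.invGrading →+*ᵍ 𝒜 where
  __ := (α.invariants.val : α.invariants →+* A)
  map_mem := id

/-- The GIT quotient `Proj (A^G)` of `Proj A`. -/
def gitQuotient : Scheme := Proj α.invGrading

/-- The semistable locus of `Proj A`: the points at which some homogeneous invariant of positive
degree does not vanish. -/
def semistableLocus : (Proj 𝒜).Opens := projMapDomain α.invIncl

/-- The quotient map from the semistable locus to the GIT quotient. -/
def quotientMap : α.semistableLocus.toScheme ⟶ α.gitQuotient := projMap α.invIncl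

end GradedAction

/-- The graded algebra `A` with the action `α` is the homogeneous coordinate ring of a (not
necessarily irreducible) projective variety `Proj A` with a linearized algebraic action of `G`,
that is, of a `G`-stable Zariski closed subset of `ℙ(E)`, where `E`, the dual of the degree one
part of `A`, is a finite-dimensional rational representation of `G`. -/
structure IsLinearizedVariety {n : ℕ} {G : Subgroup (GL (Fin n) ℂ)} {𝒜 : ℕ → Submodule ℂ A}
    [GradedAlgebra 𝒜] (α : GradedAction G 𝒜) : Prop where
  reduced : IsReduced A
  finiteDimensional : FiniteDimensional ℂ (𝒜 1)
  generated : Algebra.adjoin ℂ (𝒜 1 : Set A) = ⊤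
  rational : IsRational (α.rep 1)

/-! ### Stable closed subvarieties -/

section Quot

variable {𝒜 : ℕ → Submodule ℂ A} [GradedAlgebra 𝒜] (J : HomogeneousIdeal 𝒜)

/-- The grading of `A ⧸ J` induced by that of `A`. -/
def quotGrading (d : ℕ) : Submodule ℂ (A ⧸ J.toIdeal) :=
  (𝒜 d).map (Ideal.Quotient.mkₐ ℂ J.toIdeal).toLinearMap

instance : SetLike.GradedMonoid (quotGrading J) where
  one_mem := ⟨1, SetLike.GradedOne.one_mem, map_one (Ideal.Quotient.mk J.toIdeal)⟩
  mul_mem := by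
    rintro i j _ _ ⟨a, ha, rfl⟩ ⟨b, hb, rfl⟩
    exact ⟨a * b, SetLike.GradedMul.mul_mem ha hb, map_mul (Ideal.Quotient.mk J.toIdeal) _ _⟩

/-- The projection of `A ⧸ J` to its degree `d` part. -/
def quotProj (d : ℕ) : (A ⧸ J.toIdeal) →ₗ[ℂ] (A ⧸ J.toIdeal) :=
  (Submodule.Quotient.restrictScalarsEquiv ℂ J.toIdeal).conj
    (Submodule.mapQ (J.toIdeal.restrictScalars ℂ) (J.toIdeal.restrictScalars ℂ)
      (GradedAlgebra.proj 𝒜 d) fun _ ha ↦ J.isHomogeneous d ha)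

lemma quotProj_mk (d : ℕ) (a : A) : quotProj J d (Ideal.Quotient.mk J.toIdeal a) =
    Ideal.Quotient.mk J.toIdeal (DirectSum.decompose 𝒜 a d) := rfl

lemma isInternal_quotGrading : DirectSum.IsInternal (quotGrading J) := by
  refine isInternal_of_proj _ (quotProj J) ?_ ?_ fun m ↦ ?_
  · rintro i _ ⟨a, ha, rfl⟩
    refine (quotProj_mk J i a).trans ?_
    rw [DirectSum.decompose_of_mem_same 𝒜 ha]; rfl
  · rintro i j hij _ ⟨a, ha, rfl⟩
    refine (quotProj_mk J j a).trans ?_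
    rw [DirectSum.decompose_of_mem_ne 𝒜 ha hij, map_zero]
  · classical
    obtain ⟨a, rfl⟩ := Ideal.Quotient.mk_surjective m
    rw [← DirectSum.sum_support_decompose 𝒜 a, map_sum]
    exact sum_mem fun i _ ↦ Submodule.mem_iSup_of_mem i ⟨_, SetLike.coe_mem _, rfl⟩

instance : GradedAlgebra (quotGrading J) where
  __ := (isInternal_quotGrading J).chooseDecomposition

variable {J}

lemma map_eq_of_stable (α : GradedAction G 𝒜) (hJ : ∀ g, ∀ a ∈ J, α.hom g a ∈ J) (g : G) :
    J.toIdeal = J.toIdeal.map (α.hom g : A →+* A) := by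
  refine le_antisymm (fun a ha ↦ ?_) (Ideal.map_le_iff_le_comap.2 fun a ha ↦ hJ g a ha)
  rw [← α.hom_hom_inv g a]
  exact Ideal.mem_map_of_mem (α.hom g : A →+* A) (hJ _ _ ha)

namespace GradedAction

/-- The action induced on the quotient by a stable homogeneous ideal. -/
def quot (α : GradedAction G 𝒜) (hJ : ∀ g, ∀ a ∈ J, α.hom g a ∈ J) :
    GradedAction G (quotGrading J) where
  hom :=
    { toFun g := Ideal.quotientEquivAlg J.toIdeal J.toIdeal (α.hom g) (map_eq_of_stable α hJ g)
      map_one' := by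
        ext x
        obtain ⟨a, rfl⟩ := Ideal.Quotient.mk_surjective x
        simp
      map_mul' g h := by
        ext x
        obtain ⟨a, rfl⟩ := Ideal.Quotient.mk_surjective x
        simp }
  mem g := by
    rintro d _ ⟨a, ha, rfl⟩
    exact ⟨α.hom g a, α.mem g ha, rfl⟩

/-- The restriction of invariants `A^G → (A ⧸ J)^G`. -/
def invRestrict (α : GradedAction G 𝒜) (hJ : ∀ g, ∀ a ∈ J, α.hom g a ∈ J) :
    α.invGrading →+*ᵍ (α.quot hJ).invGrading where
  toFun a := ⟨Ideal.Quotient.mk J.toIdeal a,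
    fun g ↦ congrArg (Ideal.Quotient.mk J.toIdeal) (a.2 g)⟩
  map_one' := rfl
  map_mul' _ _ := rfl
  map_zero' := rfl
  map_add' _ _ := rfl
  map_mem ha := ⟨_, ha, rfl⟩

end GradedAction

end Quot

/-! ### Stable open subvarieties and their complements -/

section Invariants

variable {X : Scheme.{u}} {ι : Type*} (a : ι → (X ⟶ X)) {V : X.Opens} (hV : ∀ i, V ≤ a i ⁻¹ᵁ V)

/-- The ring of the regular functions on `V` that are invariant under the endomorphisms `a i` of
`X`, all of which map `V` to itself. -/
def invariantSections : Subring Γ(X, V) where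
  carrier := {s | ∀ i, (a i).appLE V V (hV i) s = s}
  mul_mem' hs ht i := by rw [map_mul, hs i, ht i]
  add_mem' hs ht i := by rw [map_add, hs i, ht i]
  neg_mem' hs i := by rw [map_neg, hs i]
  one_mem' i := map_one _
  zero_mem' i := map_zero _

/-- The spectrum of the ring of invariant regular functions on `V`. -/
def specInvariants : Scheme := Spec (.of (invariantSections a hV))

/-- The morphism from `V` to the spectrum of its ring of invariant regular functions that is given
by the inclusion of that ring in `Γ(X, V)`. -/
def toSpecInvariants : V.toScheme ⟶ specInvariants a hV :=
  V.toSpecΓ ≫ Spec.map (CommRingCat.ofHom (invariantSections a hV).subtype)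

end Invariants

namespace GradedAction

variable {𝒜 : ℕ → Submodule ℂ A} [GradedAlgebra 𝒜] (α : GradedAction G 𝒜) {V : (Proj 𝒜).Opens}

/-- The open subset `V` is stable under the action of `G`. -/
def IsStable (V : (Proj 𝒜).Opens) : Prop := ∀ g, V ≤ α.act g ⁻¹ᵁ V

/-- The quotient `V // G = Spec Γ(V, 𝒪)^G` of a stable open subset `V`, to be used when `V` is
affine. -/
def affineQuotient (hV : α.IsStable V) : Scheme := specInvariants α.act hV

/-- The quotient map `V ⟶ V // G`. -/
def affineQuotientMap (hV : α.IsStable V) : V.toScheme ⟶ α.affineQuotient hV :=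
  toSpecInvariants α.act hV

/-- The homogeneous ideal of the closed subvariety `(Proj A) ∖ V`. -/
def boundaryIdeal (V : (Proj 𝒜).Opens) : HomogeneousIdeal 𝒜 :=
  ProjectiveSpectrum.vanishingIdeal ((V : Set (Proj 𝒜))ᶜ)

lemma boundaryIdeal_stable (hV : α.IsStable V) (g : G) (a : A) (ha : a ∈ boundaryIdeal V) :
    α.hom g a ∈ boundaryIdeal V := by
  rw [boundaryIdeal, ProjectiveSpectrum.mem_vanishingIdeal] at ha ⊢
  intro x hx
  refine ha (α.act g x) fun h ↦ hx ?_
  have h' : α.act g⁻¹ (α.act g x) ∈ V := hV g⁻¹ h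
  exact (α.act_act g x) ▸ h'

/-- The linearized action on the homogeneous coordinate ring of `(Proj A) ∖ V`. -/
def boundary (hV : α.IsStable V) : GradedAction G (quotGrading (boundaryIdeal V)) :=
  α.quot (α.boundaryIdeal_stable hV)

/-- The restriction of homogeneous invariants from `Proj A` to `(Proj A) ∖ V`. -/
def boundaryRestrict (hV : α.IsStable V) : α.invGrading →+*ᵍ (α.boundary hV).invGrading :=
  α.invRestrict (α.boundaryIdeal_stable hV)

/-- The restriction of homogeneous invariants from `Proj A` to `(Proj A) ∖ V` induces an
everywhere defined morphism of GIT quotients. -/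
def BoundaryInclusionDefined (hV : α.IsStable V) : Prop :=
  HomogeneousIdeal.irrelevant (α.boundary hV).invGrading ≤
    (HomogeneousIdeal.irrelevant α.invGrading).map (α.boundaryRestrict hV)

/-- The natural morphism `((Proj A) ∖ V) // G ⟶ (Proj A) // G`. -/
def boundaryInclusion (hV : α.IsStable V) (h : α.BoundaryInclusionDefined hV) :
    (α.boundary hV).gitQuotient ⟶ α.gitQuotient :=
  Proj.map (α.boundaryRestrict hV) h

end GradedAction

/-! ### Saturated sets and boundary divisors -/

/-- A subset `S` of `X` is saturated with respect to `q : X → Y` if `S = q⁻¹(q(S))`. -/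
def IsSaturated {X Y : Type*} (q : X → Y) (S : Set X) : Prop := S = q ⁻¹' (q '' S)

/-- The boundary divisors of `X` with respect to `U`: the irreducible closed subsets of `X` of
codimension one that are contained in the complement of `U`. -/
def boundaryDivisors {X : Type*} [TopologicalSpace X] (U : Set X) : Set (Set X) :=
  {D | ∃ Z : TopologicalSpace.IrreducibleCloseds X,
    (Z : Set X) = D ∧ Order.coheight Z = 1 ∧ D ⊆ Uᶜ}

end GIT

end

/-!
Write `W = Proj A`, `X = W // G = Proj A^G`, `q : W_ss ⟶ X` for the quotient map and `J ⊆ A` for the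
homogeneous ideal of `W ∖ V`. The proof rests on three facts.

*Purity of the complement of an affine open subset.* In a Noetherian separated scheme every
component of the complement of a dense affine open subset has codimension one
(`coheight_eq_one_of_isAffineOpen`). The local form is `eq_maximalIdeal_of_sum_mul_eq_one`: a
Noetherian local domain whose punctured spectrum is affine has dimension at most one. So the
boundary divisors for such an open subset are precisely the components of its complement
(`boundaryDivisors_eq_image`).

*Lifting of invariants.* If an equivariant linear map sends a vector of a rational representation of
a reductive group to an invariant, then some invariant in the span of the orbit of that vector has
the same image (`exists_invariant_of_isReductive`). It follows that `A^G` is Noetherian, that `A^G →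
(A ⧸ J)^G` is surjective, and that every point of `X` at which the invariants in `J` vanish is the
image under `q` of a point of `W ∖ V` (`exists_proj_lift`). Hence restriction of invariants defines
a closed immersion `(W ∖ V) // G ⟶ X` with image `q((W ∖ V) ∩ W_ss)`.

*Saturation.* Let `Y ⊆ X` be the complement of that image, that is, the union of the `D₊(h)` for the
homogeneous invariants `h ∈ J` of positive degree. Suppose that all such `h` vanish at some
`x ∈ V`. Then `q(x) = q(w)` for some semistable `w ∉ V`; by purity `w` lies on a boundary divisor
`D`, and saturation of `D ∩ W_ss` puts `x` on `D`, which is absurd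
(`exists_invariant_of_saturated`). So `V = q⁻¹(Y)`.

Since `V` is covered by the `D₊(h)` with `h ∈ J` invariant, gluing gives `Γ(Y) = Γ(V)^G`
(`sectionsMap_injective`, `exists_sectionsMap_eq`). The action of `G` on `Γ(V)` is rational
(`isRationalVector_sectionRep`): for `b ∈ Γ(V)` a power of the ideal generated by the homogeneous
elements of positive degree of `J` consists of denominators of `b`, and for such a denominator `y`
both `g • y` and `g • (y b)` are computed in the rational representation `A`. Now `1 ∈ Γ(V)` is a
finite sum of functions `b_i` such that `b_i` vanishes outside some `D₊(h_i)`; by the lifting of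
invariants the `b_i` can be chosen invariant, so they come from functions `s_i` on `Y` with sum `1`
whose nonvanishing loci are affine. Therefore `Y` is affine (`isAffineOpen_quotientOpen`), `V // G =
Spec Γ(V)^G` is isomorphic to `Y`, and purity for `Y ⊆ X` identifies the boundary divisors of `X`
with the components of `(W ∖ V) // G`. -/

noncomputable section

namespace GIT

/-! ### Local domains with affine punctured spectrum -/

section LocalAlgebra

open IsLocalRing Pointwise

lemma isArtinian_of_pow_maximalIdeal_smul_eq_bot {R Q : Type*} [CommRing R] [IsLocalRing R]
    [IsNoetherianRing R] [AddCommGroup Q] [Module R Q] [Module.Finite R Q] (k : ℕ)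
    (h : (maximalIdeal R ^ k) • (⊤ : Submodule R Q) = ⊥) : IsArtinian R Q := by
  set I := maximalIdeal R ^ k
  have hQ : Module.IsTorsionBySet R Q (I : Set R) := fun q r ↦ by
    have : (r : R) • q ∈ I • (⊤ : Submodule R Q) := Submodule.smul_mem_smul r.2 trivial
    simpa [h] using this
  let := hQ.module
  have : IsScalarTower R (R ⧸ I) Q := hQ.isScalarTower
  have : Ring.KrullDimLE 0 (R ⧸ I) := by
    refine Ring.KrullDimLE.mk₀ fun p hp ↦ ?_
    have h1 : (p.comap (Ideal.Quotient.mk I)).IsPrime := inferInstance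
    have h2 : maximalIdeal R ≤ p.comap (Ideal.Quotient.mk I) :=
      h1.le_of_pow_le (n := k) (le_trans (le_of_eq (by rw [Ideal.mk_ker])) (Ideal.ker_le_comap _))
    have h3 : (p.comap (Ideal.Quotient.mk I)).IsMaximal := by
      rw [(IsLocalRing.maximalIdeal.isMaximal R).eq_of_le h1.ne_top h2 |>.symm]
      infer_instance
    exact Ideal.map_eq_top_or_isMaximal_of_surjective (Ideal.Quotient.mk I)
      Ideal.Quotient.mk_surjective h3 |>.elim (fun h ↦ (hp.ne_top (by
        rwa [Ideal.map_comap_of_surjective _ Ideal.Quotient.mk_surjective] at h)).elim) (fun h ↦ by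
        rwa [Ideal.map_comap_of_surjective _ Ideal.Quotient.mk_surjective] at h)
  have : IsArtinianRing (R ⧸ I) := IsNoetherianRing.isArtinianRing_of_krullDimLE_zero
  have : Module.Finite (R ⧸ I) Q := Module.Finite.of_restrictScalars_finite R _ _
  exact isArtinian_of_surjective_algebraMap (R := R ⧸ I) (S := R) Ideal.Quotient.mk_surjective

/-- The finite-length submodules of a Noetherian module are all contained in a largest one, so their
lengths are bounded. -/
lemma exists_length_bound {R N : Type*} [CommRing R] [AddCommGroup N] [Module R N]
    [IsNoetherian R N] :
    ∃ c : ℕ, ∀ P : Submodule R N, IsFiniteLength R P → Module.length R P ≤ c := by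
  obtain ⟨H, hH, hmax⟩ := WellFounded.has_min
    (r := (· > · : Submodule R N → Submodule R N → Prop)) wellFounded_gt
    {P | IsFiniteLength R P} ⟨⊥, .of_subsingleton⟩
  obtain ⟨c, hc⟩ := ENat.ne_top_iff_exists.mp (Module.length_ne_top_iff.mpr hH)
  refine ⟨c, fun P hP ↦ ?_⟩
  have hsup : IsFiniteLength R ↥(H ⊔ P) := by
    replace hH := Module.length_ne_top_iff.mpr hH
    rw [← Module.length_ne_top_iff] at hP ⊢
    have : Module.length R ↥(H ⊔ P) ≤ Module.length R (H × P) :=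
      Module.length_le_of_surjective
        (LinearMap.coprod (Submodule.inclusion le_sup_left) (Submodule.inclusion le_sup_right))
        (by
          rintro ⟨x, hx⟩
          obtain ⟨y, hy, z, hz, rfl⟩ := Submodule.mem_sup.mp hx
          exact ⟨(⟨y, hy⟩, ⟨z, hz⟩), rfl⟩)
    rw [Module.length_prod] at this
    exact ne_top_of_le_ne_top (WithTop.add_ne_top.mpr ⟨hH, hP⟩) this
  have : H = H ⊔ P := by
    by_contra hne
    exact hmax _ hsup (lt_of_le_of_ne le_sup_left hne)
  rw [hc]
  exact Module.length_le_of_injective (Submodule.inclusion (this ▸ le_sup_right : P ≤ H))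
    (Submodule.inclusion_injective _)

lemma pow_smul_stable_of_length_le {R N : Type*} [CommRing R] [AddCommGroup N] [Module R N]
    (I : Ideal R) (c s : ℕ) (hcs : c < s)
    (h : Module.length R (N ⧸ (I ^ s • (⊤ : Submodule R N))) ≤ c) :
    ∃ i < s, I ^ (i + 1) • (⊤ : Submodule R N) = I ^ i • (⊤ : Submodule R N) := by
  by_contra! hne
  have key : ∀ r ≤ s, (r : ℕ∞) ≤ Module.length R (N ⧸ (I ^ r • (⊤ : Submodule R N))) := by
    intro r
    induction r with
    | zero => simp
    | succ r ih =>
      intro hr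
      have hle : I ^ (r + 1) • (⊤ : Submodule R N) ≤ I ^ r • (⊤ : Submodule R N) :=
        Submodule.smul_mono_left (Ideal.pow_le_pow_right (Nat.le_succ r))
      rw [Module.length_eq_add_of_exact (LinearMap.ker (Submodule.factor hle)).subtype
        (Submodule.factor hle) (Submodule.subtype_injective _) (Submodule.factor_surjective hle)
        (LinearMap.exact_subtype_ker_map _), add_comm (Module.length R _), Nat.cast_add]
      refine add_le_add (ih (by omega)) ?_
      have : Nontrivial (LinearMap.ker (Submodule.factor hle)) := by
        rw [Submodule.nontrivial_iff_ne_bot]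
        intro h0
        refine hne r (by omega) (le_antisymm hle fun y hy ↦ ?_)
        have : Submodule.Quotient.mk y ∈ LinearMap.ker (Submodule.factor hle) := by
          rw [LinearMap.mem_ker]
          exact (Submodule.Quotient.mk_eq_zero _).mpr hy
        rw [h0, Submodule.mem_bot] at this
        exact (Submodule.Quotient.mk_eq_zero _).mp this
      have := Module.length_pos (R := R) (M := LinearMap.ker (Submodule.factor hle))
      simpa using Order.one_le_iff_pos.mpr this
  have := (key s le_rfl).trans h
  exact absurd (by exact_mod_cast this) (not_le.mpr hcs)

lemma length_ker_eq_length_coker {R Q : Type*} [CommRing R] [AddCommGroup Q] [Module R Q]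
    (hQ : Module.length R Q ≠ ⊤) (f : Q →ₗ[R] Q) :
    Module.length R (LinearMap.ker f) = Module.length R (Q ⧸ LinearMap.range f) := by
  have h1 := Module.length_eq_add_of_exact (LinearMap.ker f).subtype f.rangeRestrict
    (Submodule.subtype_injective _) (LinearMap.surjective_rangeRestrict f) (by
      rw [LinearMap.exact_iff, LinearMap.ker_rangeRestrict, Submodule.range_subtype])
  have h2 := Module.length_eq_add_of_exact (LinearMap.range f).subtype (LinearMap.range f).mkQ
    (Submodule.subtype_injective _) (Submodule.mkQ_surjective _) (by
      rw [LinearMap.exact_iff, Submodule.ker_mkQ, Submodule.range_subtype])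
  have h3 : Module.length R (LinearMap.range f) ≠ ⊤ :=
    ne_top_of_le_ne_top hQ (by rw [h1]; exact le_add_self)
  rw [h1, add_comm] at h2
  exact ENat.add_right_injective_of_ne_top h3 h2

/-- The step from a partition of unity to a bound on `x`. With `Q = M / R`, the kernel of
multiplication by `x` on `Q` embeds into `R / x` with finite length, so its length is at most `c`.
The cokernel has the same length, and it surjects onto `N / m ^ s N` for `N = M / x M`, since
`1 ∈ m ^ s M`. As `c < s`, the filtration of `N` by the `m ^ i N` is stationary at some `i < s`, so
`m ^ i N = 0` by Nakayama's lemma. Then `1 ∈ x M`, and `m ^ k M ⊆ R` gives `m ^ k ⊆ x R`. -/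
lemma pow_maximalIdeal_le_span_of_one_mem {R K : Type*} [CommRing R] [IsLocalRing R]
    [IsNoetherianRing R] [Field K] [Algebra R K] [FaithfulSMul R K] (M : Submodule R K)
    (hfg : M.FG) (h1 : (1 : K) ∈ M) {k : ℕ} (hk : maximalIdeal R ^ k • M ≤ 1) {x : R} (hx : x ≠ 0)
    {c s : ℕ} (hc : ∀ P : Submodule R (R ⧸ Ideal.span {x}),
      IsFiniteLength R P → Module.length R P ≤ c)
    (hcs : c < s) (h1s : (1 : K) ∈ maximalIdeal R ^ s • M) :
    maximalIdeal R ^ k ≤ Ideal.span {x} := by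
  set m := maximalIdeal R
  have hinj : Function.Injective (algebraMap R K) := FaithfulSMul.algebraMap_injective R K
  have hx' : algebraMap R K x ≠ 0 := by rwa [Ne, map_eq_zero_iff _ hinj]
  have : Module.Finite R M := Module.Finite.iff_fg.mpr hfg
  let one' : Submodule R M := Submodule.span R {⟨1, h1⟩}
  have hone : ∀ (y : M) (r : R), (y : K) = algebraMap R K r → y ∈ one' := fun y r h ↦
    Submodule.mem_span_singleton.mpr ⟨r, Subtype.ext (by simp [h, Algebra.smul_def])⟩
  have hone' : ∀ y ∈ one', ∃ r : R, algebraMap R K r = y := fun y hy ↦ by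
    obtain ⟨r, rfl⟩ := Submodule.mem_span_singleton.mp hy
    exact ⟨r, by simp [Algebra.smul_def]⟩
  have hQ : m ^ k • (⊤ : Submodule R (M ⧸ one')) = ⊥ := by
    rw [eq_bot_iff, Submodule.smul_le]
    rintro a ha q -
    obtain ⟨y, rfl⟩ := Submodule.Quotient.mk_surjective _ q
    rw [Submodule.mem_bot, ← Submodule.Quotient.mk_smul, Submodule.Quotient.mk_eq_zero]
    obtain ⟨r, hr⟩ := Submodule.mem_one.mp (hk (Submodule.smul_mem_smul ha y.2))
    exact hone _ r (by simp [hr])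
  have hart : IsArtinian R (M ⧸ one') := isArtinian_of_pow_maximalIdeal_smul_eq_bot k hQ
  have hQlen : Module.length R (M ⧸ one') ≠ ⊤ := Module.length_ne_top
  let f : (M ⧸ one') →ₗ[R] (M ⧸ one') := LinearMap.lsmul R _ x
  have hker : Module.length R (LinearMap.ker f) ≤ c := by
    -- The elements `r` with `r / x ∈ M` map to `M / R` by `r ↦ r / x` and to `R / x`, with the same
    -- kernel `x R`; the image in `M / R` contains the kernel of multiplication by `x`.
    let L : Submodule R R := (x • M).comap (Algebra.linearMap R K)
    have hL : ∀ r : L, (algebraMap R K x)⁻¹ * algebraMap R K r ∈ M := fun r ↦ by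
      obtain ⟨y, hy, hyr⟩ := (Submodule.mem_smul_pointwise_iff_exists _ _ _).mp r.2
      rw [Algebra.smul_def, Algebra.linearMap_apply] at hyr
      rwa [← hyr, inv_mul_cancel_left₀ hx']
    let θ₀ : L →ₗ[R] M := LinearMap.codRestrict M
      ((LinearMap.mulLeft R (algebraMap R K x)⁻¹) ∘ₗ Algebra.linearMap R K ∘ₗ L.subtype) hL
    have hθ₀ : ∀ r : L, (θ₀ r : K) = (algebraMap R K x)⁻¹ * algebraMap R K r := fun r ↦ rfl
    let θ : L →ₗ[R] (M ⧸ one') := one'.mkQ ∘ₗ θ₀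
    let θ' : L →ₗ[R] (R ⧸ Ideal.span {x}) := (Ideal.span {x}).mkQ ∘ₗ L.subtype
    have hk : LinearMap.ker θ = LinearMap.ker θ' := by
      ext r
      simp only [θ, θ', LinearMap.mem_ker, LinearMap.comp_apply, Submodule.mkQ_apply,
        Submodule.Quotient.mk_eq_zero, Submodule.subtype_apply, Ideal.mem_span_singleton']
      constructor
      · intro h
        obtain ⟨t, ht⟩ := hone' _ h
        refine ⟨t, hinj ?_⟩
        rw [map_mul, ht, hθ₀, mul_comm, mul_inv_cancel_left₀ hx']
      · rintro ⟨t, ht⟩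
        refine hone _ t ?_
        rw [hθ₀, ← ht, map_mul, mul_comm (algebraMap R K t), inv_mul_cancel_left₀ hx']
    have e : LinearMap.range θ ≃ₗ[R] LinearMap.range θ' :=
      θ.quotKerEquivRange.symm ≪≫ₗ Submodule.quotEquivOfEq _ _ hk ≪≫ₗ θ'.quotKerEquivRange
    have hle : LinearMap.ker f ≤ LinearMap.range θ := by
      intro q hq
      obtain ⟨y, rfl⟩ := Submodule.Quotient.mk_surjective _ q
      have hq' : x • (Submodule.Quotient.mk y : M ⧸ one') = 0 := hq
      rw [← Submodule.Quotient.mk_smul, Submodule.Quotient.mk_eq_zero] at hq'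
      obtain ⟨r, hr⟩ := hone' _ hq'
      rw [Submodule.coe_smul, Algebra.smul_def] at hr
      refine ⟨⟨r, (Submodule.mem_smul_pointwise_iff_exists _ _ _).mpr ⟨y, y.2, ?_⟩⟩,
        congrArg Submodule.Quotient.mk (Subtype.ext ?_)⟩
      · rw [Algebra.smul_def, ← hr]; rfl
      · rw [hθ₀, hr, inv_mul_cancel_left₀ hx']
    refine (Module.length_le_of_injective (Submodule.inclusion hle)
      (Submodule.inclusion_injective _)).trans ?_
    rw [e.length_eq]
    refine hc _ (Module.length_ne_top_iff.mp ?_)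
    rw [← e.length_eq]
    exact Module.length_ne_top
  let xM : Submodule R M := x • ⊤
  let N := M ⧸ xM
  have hcok : Module.length R (N ⧸ (m ^ s • (⊤ : Submodule R N))) ≤ c := by
    rw [length_ker_eq_length_coker hQlen] at hker
    let π : M →ₗ[R] N ⧸ (m ^ s • (⊤ : Submodule R N)) :=
      (m ^ s • (⊤ : Submodule R N)).mkQ ∘ₗ xM.mkQ
    have hπ : one' ≤ LinearMap.ker π := by
      rw [Submodule.span_le, Set.singleton_subset_iff, SetLike.mem_coe, LinearMap.mem_ker]
      refine (Submodule.Quotient.mk_eq_zero _).mpr ?_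
      have := Submodule.mem_map_of_mem (f := xM.mkQ)
        ((Submodule.mem_smul_top_iff (m ^ s) M ⟨1, h1⟩).mpr h1s)
      rw [Submodule.map_smul''] at this
      exact Submodule.smul_mono le_rfl le_top this
    have hπ' : LinearMap.range f ≤ LinearMap.ker (one'.liftQ π hπ) := by
      rintro _ ⟨q, rfl⟩
      obtain ⟨y, rfl⟩ := Submodule.Quotient.mk_surjective _ q
      have : (Submodule.Quotient.mk (x • y) : N) = 0 :=
        (Submodule.Quotient.mk_eq_zero _).mpr (Submodule.smul_mem_pointwise_smul _ _ _ trivial)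
      change Submodule.Quotient.mk (Submodule.Quotient.mk (x • y) : N) = _
      rw [this]; rfl
    refine (Module.length_le_of_surjective (Submodule.liftQ _ _ hπ') ?_).trans hker
    intro z
    obtain ⟨z, rfl⟩ := Submodule.Quotient.mk_surjective _ z
    obtain ⟨z, rfl⟩ := Submodule.Quotient.mk_surjective _ z
    exact ⟨Submodule.Quotient.mk (Submodule.Quotient.mk z), rfl⟩
  obtain ⟨i, his, hi⟩ := pow_smul_stable_of_length_le m c s hcs hcok
  have hbot : m ^ i • (⊤ : Submodule R N) = ⊥ := by
    refine Submodule.eq_bot_of_le_smul_of_le_jacobson_bot m _ (IsNoetherian.noetherian _) ?_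
      (IsLocalRing.jacobson_eq_maximalIdeal ⊥ bot_ne_top).ge
    rw [← Submodule.mul_smul, ← pow_succ', hi]
  have h1x : (⟨1, h1⟩ : M) ∈ xM := by
    rw [← Submodule.Quotient.mk_eq_zero, ← Submodule.mem_bot R, ← hbot]
    have := Submodule.mem_map_of_mem (f := xM.mkQ)
      ((Submodule.mem_smul_top_iff (m ^ s) M ⟨1, h1⟩).mpr h1s)
    rw [Submodule.map_smul''] at this
    exact Submodule.smul_mono (Ideal.pow_le_pow_right his.le) le_top this
  obtain ⟨y, -, hy⟩ := (Submodule.mem_smul_pointwise_iff_exists _ _ _).mp h1x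
  intro a ha
  obtain ⟨r, hr⟩ := Submodule.mem_one.mp (hk (Submodule.smul_mem_smul ha y.2))
  rw [Ideal.mem_span_singleton']
  refine ⟨r, hinj ?_⟩
  have hy' : algebraMap R K x * y = 1 := by
    simpa [Algebra.smul_def] using congrArg (Subtype.val : M → K) hy
  rw [map_mul, hr, Algebra.smul_def, mul_assoc, mul_comm (y : K), hy', mul_one]

/-- A Noetherian local domain `R` with maximal ideal `m`, over which there are finitely many
elements `t i` of an extension field with `m ^ n • t i ⊆ R` and `1 ∈ ∑ m • t i`, has no prime ideals
except `0` and `m`. The `t i` exist if the punctured spectrum of `R` is affine: they are the regular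
functions on it in a partition of unity `∑ x i * t i = 1` with `x i ∈ m`. -/
theorem eq_maximalIdeal_of_sum_mul_eq_one {R K ι : Type*} [CommRing R] [IsLocalRing R]
    [IsNoetherianRing R] [Field K] [Algebra R K] [FaithfulSMul R K] [Finite ι]
    (t : ι → K) (n : ℕ) (ht : ∀ i, ∀ a ∈ maximalIdeal R ^ n, ∃ r, algebraMap R K r = a • t i)
    (h1 : (1 : K) ∈ maximalIdeal R • Submodule.span R (Set.range t))
    (p : Ideal R) [hp : p.IsPrime] (hp0 : p ≠ ⊥) : p = maximalIdeal R := by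
  set m := maximalIdeal R
  obtain ⟨x, hxp, hx⟩ := Submodule.exists_mem_ne_zero_of_ne_bot hp0
  obtain ⟨c, hc⟩ := exists_length_bound (R := R) (N := R ⧸ Ideal.span {x})
  -- The powers of the module `T` generated by `1` and the `t i` satisfy `m ^ (n * s) T ^ s ⊆ R` and
  -- `1 ∈ m ^ s T ^ s`; take `s = c + 1`, with `c` bounding the finite-length submodules of `R / x`.
  set T := Submodule.span R (Set.range t) ⊔ 1
  have hT : m ^ n • T ≤ 1 := by
    rw [Submodule.smul_sup]
    refine sup_le ?_ Submodule.smul_le_right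
    rw [Submodule.smul_le]
    intro a ha y hy
    induction hy using Submodule.span_induction with
    | mem y hy =>
      obtain ⟨i, rfl⟩ := hy
      exact Submodule.mem_one.mpr (ht i a ha)
    | zero => simp
    | add y z _ _ hy hz => rw [smul_add]; exact add_mem hy hz
    | smul r y _ hy => rw [smul_comm]; exact Submodule.smul_mem _ _ hy
  have hmul : ∀ (I : Ideal R) (M : Submodule R K),
      I • M = Submodule.map (Algebra.ofId R K).toLinearMap I * M := by
    intro I M
    refine le_antisymm (Submodule.smul_le.mpr fun a ha y hy ↦ ?_)
      (Submodule.mul_le.mpr ?_)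
    · rw [Algebra.smul_def]
      exact Submodule.mul_mem_mul (Submodule.mem_map_of_mem ha) hy
    · rintro _ ⟨a, ha, rfl⟩ y hy
      exact (Algebra.smul_def a y) ▸ Submodule.smul_mem_smul ha hy
  have hpow : ∀ (I : Ideal R) (s : ℕ), (I • T) ^ s = I ^ s • T ^ s := by
    intro I s
    rw [hmul, hmul, mul_pow, Submodule.map_pow]
  have h1T : (1 : Submodule R K) ≤ T := le_sup_right
  have h1m : (1 : Submodule R K) ≤ m • T := by
    rw [Submodule.one_le]
    exact Submodule.smul_mono le_rfl le_sup_left h1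
  have hle : m ^ (n * (c + 1)) ≤ Ideal.span {x} := by
    refine pow_maximalIdeal_le_span_of_one_mem (K := K) (T ^ (c + 1)) ?_ ?_ ?_ hx hc
      (Nat.lt_succ_self c) ?_
    · refine Submodule.FG.pow (Submodule.FG.sup (Submodule.fg_span (Set.finite_range t)) ?_) _
      exact Submodule.one_eq_span (R := R) (A := K) ▸ Submodule.fg_span_singleton 1
    · exact Submodule.one_le.mp (one_le_pow_of_one_le' h1T _)
    · rw [pow_mul, ← hpow]
      exact pow_le_one' hT _
    · rw [← hpow]
      exact Submodule.one_le.mp (one_le_pow_of_one_le' h1m _)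
  have hmp : m ≤ p := hp.le_of_pow_le
    (hle.trans ((Ideal.span_singleton_le_iff_mem _).mpr hxp))
  exact ((IsLocalRing.maximalIdeal.isMaximal R).eq_of_le hp.ne_top hmp).symm

end LocalAlgebra

/-! ### Purity of the complement of an affine open subset -/

section Purity

open TopologicalSpace

variable {X : Scheme.{u}} {U V W : X.Opens}

lemma evaluation_map (h : W ≤ V) (x : X) (hx : x ∈ W) (s : Γ(X, V)) :
    X.evaluation W x hx (X.presheaf.map (homOfLE h).op s) = X.evaluation V x (h hx) s :=
  congrArg (X.residue x) (X.presheaf.germ_res_apply (homOfLE h) x hx s)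

lemma exists_finset_span_map_eq_top (hV : IsAffineOpen V) (hW : IsAffineOpen W) (h : W ≤ V) :
    ∃ F : Finset Γ(X, V), (∀ f ∈ F, X.basicOpen f ≤ W) ∧
      Ideal.span ((X.presheaf.map (homOfLE h).op).hom '' (F : Set Γ(X, V))) = ⊤ := by
  classical
  let ρ := (X.presheaf.map (homOfLE h).op).hom
  let S : Set Γ(X, V) := {f | X.basicOpen f ≤ W}
  have hS : Ideal.span (ρ '' S) = ⊤ := by
    rw [← hW.self_le_iSup_basicOpen_iff]
    intro x hx
    obtain ⟨f, hf, hxf⟩ := hV.exists_basicOpen_le ⟨x, hx⟩ (h hx)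
    refine Opens.mem_iSup.mpr ⟨⟨ρ f, f, hf, rfl⟩, ?_⟩
    exact (X.basicOpen_res f (homOfLE h).op).ge ⟨hx, hxf⟩
  obtain ⟨T, hTS, hT⟩ := (Ideal.span_eq_top_iff_finite _).mp hS
  obtain ⟨F, hFS, rfl⟩ := Finset.subset_set_image_iff.mp hTS
  exact ⟨F, fun f hf ↦ hFS hf, by simpa using hT⟩

/-- A section `t` over `W ⊇ D(f)` times a high power of `f` takes the same values on `W` as a
section over `V`; outside `D(f)` both sides vanish. -/
lemma exists_pow_mul_eq (hV : IsAffineOpen V) (h : W ≤ V) (f : Γ(X, V)) (hf : X.basicOpen f ≤ W)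
    (t : Γ(X, W)) : ∃ n : ℕ, ∀ N ≥ n, ∃ a : Γ(X, V), ∀ (x : X) (hx : x ∈ W),
      X.evaluation V x (h hx) (f ^ N) * X.evaluation W x hx t = X.evaluation V x (h hx) a := by
  have := hV.isLocalization_basicOpen f
  obtain ⟨n, a, ha⟩ := IsLocalization.Away.surj f (X.presheaf.map (homOfLE hf).op t)
  refine ⟨n + 1, fun N hN ↦ ⟨a * f ^ (N - n), fun x hx ↦ ?_⟩⟩
  obtain ⟨k, rfl⟩ : ∃ k, N = n + (k + 1) := ⟨N - n - 1, by omega⟩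
  by_cases hxf : x ∈ X.basicOpen f
  · have h1 := congrArg (X.evaluation (X.basicOpen f) x hxf) ha
    rw [map_mul, map_pow, evaluation_map hf] at h1
    have h2 : ∀ s : Γ(X, V), X.evaluation (X.basicOpen f) x hxf
        (algebraMap Γ(X, V) Γ(X, X.basicOpen f) s) = X.evaluation V x (h hx) s := fun s ↦
      evaluation_map (X.basicOpen_le f) x hxf s
    rw [h2, h2] at h1
    rw [map_mul, ← h1, pow_add, map_mul, map_pow, show n + (k + 1) - n = k + 1 by omega]
    ring
  · have h0 := (X.evaluation_eq_zero_iff_notMem_basicOpen x (h hx) f).mpr hxf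
    simp [h0]

lemma fromSpecStalk_mem_basicOpen {z : X} (hz : z ∈ V) (f : Γ(X, V))
    (q : Spec (X.presheaf.stalk z)) :
    X.fromSpecStalk z q ∈ X.basicOpen f ↔ X.presheaf.germ V z hz f ∉ q.asIdeal := by
  change q ∈ X.fromSpecStalk z ⁻¹ᵁ X.basicOpen f ↔ _
  rw [Scheme.preimage_basicOpen, Scheme.fromSpecStalk_app hz]
  simp only [CommRingCat.comp_apply]
  rw [Scheme.basicOpen_res]
  rw [basicOpen_eq_of_affine']
  simp only [Iso.inv_hom_id_apply]
  have hq : X.fromSpecStalk z q ⤳ z := X.range_fromSpecStalk.le ⟨q, rfl⟩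
  exact ⟨fun h ↦ h.2, fun h ↦ ⟨hq.mem_open V.2 hz, h⟩⟩

/-- If there were a chain `z₀ ⤳ z₁ ⤳ z` of three distinct points, `z` being the generic point of
`Z`, then `z₀` and `z₁` would lie in `U`. Let `R` be the quotient of the local ring at `z` by the
prime ideal of `z₀`, and `V` an affine neighbourhood of `z`. A partition of unity on the affine open
subset `U ⊓ V`, evaluated in the residue field of `z₀`, provides the data of
`eq_maximalIdeal_of_sum_mul_eq_one` for `R`, and the prime ideal of `z₁` contradicts its conclusion.
-/
lemma coheight_le_one_of_isAffineOpen [IsLocallyNoetherian X] [X.IsSeparated]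
    (hU : IsAffineOpen U) (Z : IrreducibleCloseds X) (hZU : (Z : Set X) ⊆ (U : Set X)ᶜ)
    (hmax : ∀ Z' : IrreducibleCloseds X, Z ≤ Z' → (Z' : Set X) ⊆ (U : Set X)ᶜ → Z' ≤ Z) :
    Order.coheight Z ≤ 1 := by
  classical
  refine (Order.coheight_le_coe_iff (n := 1)).mpr fun Z₁ hZ₁ ↦ ?_
  suffices h : IsMax Z₁ by
    rw [Order.coheight_eq_zero.mpr h]; exact_mod_cast zero_lt_one
  intro Z₀ hZ₀
  by_contra hlt
  obtain ⟨z, hz⟩ := QuasiSober.sober Z.isIrreducible Z.isClosed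
  obtain ⟨z₁, hz₁⟩ := QuasiSober.sober Z₁.isIrreducible Z₁.isClosed
  obtain ⟨z₀, hz₀⟩ := QuasiSober.sober Z₀.isIrreducible Z₀.isClosed
  have h01 : z₀ ⤳ z₁ := hz₀.specializes (hZ₀ hz₁.mem)
  have h1z : z₁ ⤳ z := hz₁.specializes (hZ₁.le hz.mem)
  have hne1 : z₁ ≠ z := by
    rintro rfl
    exact hZ₁.ne (SetLike.coe_injective (hz.def.symm.trans hz₁.def))
  have hne0 : z₀ ≠ z₁ := by
    rintro rfl
    exact hlt (SetLike.coe_injective (hz₀.def.symm.trans hz₁.def)).le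
  have hz₁U : z₁ ∈ U := by
    by_contra h
    refine hZ₁.not_ge (hmax Z₁ hZ₁.le ?_)
    rw [← hz₁.def]
    exact closure_minimal (Set.singleton_subset_iff.mpr h) U.2.isClosed_compl
  have hz₀U : z₀ ∈ U := h01.mem_open U.2 hz₁U
  obtain ⟨_, ⟨V, hV, rfl⟩, hzV, -⟩ :=
    X.isBasis_affineOpens.exists_subset_of_mem_open (Set.mem_univ z) isOpen_univ
  have hz₀V : z₀ ∈ V := (h01.trans h1z).mem_open V.2 hzV
  have hz₀W : z₀ ∈ U ⊓ V := ⟨hz₀U, hz₀V⟩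
  have hW : IsAffineOpen (U ⊓ V) := hU.inf hV
  have hWV : U ⊓ V ≤ V := inf_le_right
  obtain ⟨F, hF, hFspan⟩ := exists_finset_span_map_eq_top hV hW hWV
  have h1 : (1 : Γ(X, U ⊓ V)) ∈
      Ideal.span ((X.presheaf.map (homOfLE hWV).op).hom '' (F : Set Γ(X, V))) := hFspan ▸ trivial
  rw [Ideal.span, Submodule.mem_span_image_finset_iff_exists_fun] at h1
  obtain ⟨t, ht⟩ := h1
  have hn : ∀ f : F, ∀ i : F, ∃ n : ℕ, ∀ N ≥ n, ∃ a : Γ(X, V), ∀ (x : X) (hx : x ∈ U ⊓ V),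
      X.evaluation V x (hWV hx) (f ^ N) * X.evaluation _ x hx (t i) =
        X.evaluation V x (hWV hx) a := fun f i ↦
    exists_pow_mul_eq hV hWV f.1 (hF f f.2) (t i)
  choose n hn using hn
  set N := ∑ f : F, ∑ i : F, n f i + 1
  have hnN : ∀ f i, n f i ≤ N := fun f i ↦
    ((Finset.single_le_sum (f := n f) (fun _ _ ↦ Nat.zero_le _) (Finset.mem_univ i)).trans
      (Finset.single_le_sum (f := fun f ↦ ∑ i : F, n f i) (fun _ _ ↦ Nat.zero_le _)
        (Finset.mem_univ f))).trans (Nat.le_succ _)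
  -- multiplication by the `f ^ N` clears the denominators of all `t i` simultaneously
  have hN : ∀ f i : F, ∃ a : Γ(X, V),
      X.evaluation V z₀ hz₀V (f.1 ^ N) * X.evaluation (U ⊓ V) z₀ hz₀W (t i) =
        X.evaluation V z₀ hz₀V a := fun f i ↦ by
    obtain ⟨a, ha⟩ := hn f i N (hnN f i)
    exact ⟨a, ha z₀ hz₀W⟩
  choose a ha using hN
  let O := X.presheaf.stalk z
  let γ : Γ(X, V) →+* O := (X.presheaf.germ V z hzV).hom
  let φ : O →+* X.residueField z₀ :=
    (X.residue z₀).hom.comp (X.presheaf.stalkSpecializes (h01.trans h1z)).hom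
  have hφγ : ∀ s, φ (γ s) = X.evaluation V z₀ hz₀V s := fun s ↦
    congrArg (X.residue z₀) (X.presheaf.germ_stalkSpecializes_apply hzV (h01.trans h1z) s)
  -- the primes of `O` that correspond to `z₁` and `z₀`
  let P₁ := Spec.map (X.presheaf.stalkSpecializes h1z)
    (IsLocalRing.closedPoint (X.presheaf.stalk z₁))
  let P₀ := Spec.map (X.presheaf.stalkSpecializes (h01.trans h1z))
    (IsLocalRing.closedPoint (X.presheaf.stalk z₀))
  have hP₁ : X.fromSpecStalk z P₁ = z₁ :=
    (congr($(Scheme.SpecMap_stalkSpecializes_fromSpecStalk h1z)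
      (IsLocalRing.closedPoint _))).trans Scheme.fromSpecStalk_closedPoint
  have hP₀ : X.fromSpecStalk z P₀ = z₀ :=
    (congr($(Scheme.SpecMap_stalkSpecializes_fromSpecStalk (h01.trans h1z))
      (IsLocalRing.closedPoint _))).trans Scheme.fromSpecStalk_closedPoint
  have hker : RingHom.ker φ = P₀.asIdeal := by
    ext x
    change X.residue z₀ _ = 0 ↔ _ ∈ IsLocalRing.maximalIdeal _
    exact Ideal.Quotient.eq_zero_iff_mem
  have hker₁ : RingHom.ker φ ≤ P₁.asIdeal := by
    intro x hx
    by_contra hx₁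
    have hu : IsUnit (X.presheaf.stalkSpecializes h1z x) := by
      by_contra hu
      exact hx₁ ((IsLocalRing.mem_maximalIdeal _).mpr hu)
    have hu' := hu.map (X.presheaf.stalkSpecializes h01).hom
    have : (X.presheaf.stalkSpecializes h01).hom (X.presheaf.stalkSpecializes h1z x) =
        X.presheaf.stalkSpecializes (h01.trans h1z) x :=
      X.presheaf.stalkSpecializes_comp_apply h01 h1z x
    rw [this] at hu'
    exact (hu'.map (X.residue z₀).hom).ne_zero hx
  -- the local ring at `z` of the closure of `z₀`, inside its fraction field
  let R := O ⧸ RingHom.ker φ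
  let π : O →+* R := Ideal.Quotient.mk _
  have hπ : Function.Surjective π := Ideal.Quotient.mk_surjective
  have hπker : RingHom.ker π = RingHom.ker φ := Ideal.mk_ker
  let : Algebra R (X.residueField z₀) := (RingHom.kerLift φ).toAlgebra
  have hRinj : Function.Injective (algebraMap R (X.residueField z₀)) := RingHom.kerLift_injective φ
  have hRπ : ∀ x, algebraMap R (X.residueField z₀) (π x) = φ x := fun x ↦ rfl
  have : FaithfulSMul R (X.residueField z₀) := (faithfulSMul_iff_algebraMap_injective _ _).mpr hRinj
  have : Nontrivial R := (algebraMap R (X.residueField z₀)).domain_nontrivial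
  have : IsLocalRing R := IsLocalRing.of_surjective' π hπ
  have : IsNoetherianRing R := inferInstanceAs (IsNoetherianRing (O ⧸ RingHom.ker φ))
  -- a power of the maximal ideal lies in the ideal of the powers `f ^ N`
  let J : Ideal O := Ideal.span (Set.range fun f : F ↦ γ f.1 ^ N)
  have hJ : IsLocalRing.maximalIdeal O ≤ J.radical := by
    -- A generization `y` of `z` at which all `f` vanish is not in `U`, so it is in `Z` by the
    -- maximality of `Z`, and thus equal to `z`.
    rw [Ideal.radical_eq_sInf]
    refine le_sInf fun q ⟨hJq, hq⟩ ↦ ?_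
    let Q : Spec O := ⟨q, hq⟩
    set y := X.fromSpecStalk z Q
    have hyz : y ⤳ z := X.range_fromSpecStalk.le ⟨Q, rfl⟩
    have hyV : y ∈ V := hyz.mem_open V.2 hzV
    have hyU : y ∉ U := by
      intro hyU
      have h2 : (1 : X.residueField y) = 0 := by
        have h3 := congrArg (X.evaluation (U ⊓ V) y ⟨hyU, hyV⟩) ht
        rw [map_one, map_sum] at h3
        rw [← h3]
        refine Finset.sum_eq_zero fun f _ ↦ ?_
        rw [smul_eq_mul, map_mul]
        refine mul_eq_zero_of_right _ ?_
        refine (evaluation_map hWV y ⟨hyU, hyV⟩ f.1).trans ?_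
        rw [Scheme.evaluation_eq_zero_iff_notMem_basicOpen, fromSpecStalk_mem_basicOpen hzV,
          not_not]
        exact hq.mem_of_pow_mem N (hJq (Ideal.subset_span ⟨f, rfl⟩))
      exact one_ne_zero h2
    have hyZ : y ∈ Z := by
      refine hmax ⟨closure {y}, isIrreducible_singleton.closure, isClosed_closure⟩ ?_ ?_
        (subset_closure rfl)
      · change (Z : Set X) ⊆ _
        rw [← hz.def]
        exact closure_minimal (Set.singleton_subset_iff.mpr hyz.mem_closure) isClosed_closure
      · exact closure_minimal (Set.singleton_subset_iff.mpr hyU) U.2.isClosed_compl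
    have hy : y = z := (hyz.antisymm (hz.specializes hyZ)).eq
    have : Q = IsLocalRing.closedPoint O := by
      apply (X.fromSpecStalk z).isEmbedding.injective
      rw [Scheme.fromSpecStalk_closedPoint]
      exact hy
    exact (congrArg PrimeSpectrum.asIdeal this).ge
  obtain ⟨e, he⟩ := Ideal.exists_pow_le_of_le_radical_of_fg hJ (IsNoetherian.noetherian _)
  have hmR : IsLocalRing.maximalIdeal R ≤ (IsLocalRing.maximalIdeal O).map π := by
    rw [← Ideal.map_comap_of_surjective π hπ (IsLocalRing.maximalIdeal R)]
    exact Ideal.map_mono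
      (IsLocalRing.le_maximalIdeal (Ideal.comap_ne_top π (Ideal.IsPrime.ne_top')))
  have hP₁p : P₁.asIdeal.IsPrime := P₁.isPrime
  have hprime : (P₁.asIdeal.map π).IsPrime :=
    Ideal.map_isPrime_of_surjective hπ (hπker.trans_le hker₁)
  have hcm : (P₁.asIdeal.map π).comap π = P₁.asIdeal := by
    rw [Ideal.comap_map_of_surjective' π hπ, hπker, sup_eq_left.mpr hker₁]
  refine hne1 ?_
  have key : P₁.asIdeal.map π = IsLocalRing.maximalIdeal R := by
    refine eq_maximalIdeal_of_sum_mul_eq_one (K := X.residueField z₀)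
      (fun i : F ↦ X.evaluation (U ⊓ V) z₀ hz₀W (t i)) e ?_ ?_ _ ?_
    · intro i x hx
      have hx' : x ∈ J.map π := by
        have := (Ideal.pow_right_mono hmR e).trans (Ideal.map_pow π _ e).ge |>.trans
          (Ideal.map_mono he)
        exact this hx
      clear hx
      rw [Ideal.map_span] at hx'
      induction hx' using Submodule.span_induction with
      | mem x hx =>
        obtain ⟨_, ⟨f, rfl⟩, rfl⟩ := hx
        refine ⟨π (γ (a f i)), ?_⟩
        have h5 : φ (γ f.1 ^ N) = X.evaluation V z₀ hz₀V (f.1 ^ N) := by rw [← map_pow, hφγ]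
        rw [Algebra.smul_def, hRπ, hRπ, hφγ, ← ha]
        exact congrArg (· * _) h5.symm
      | zero => exact ⟨0, by simp⟩
      | add x y _ _ hx hy =>
        obtain ⟨b, hb⟩ := hx
        obtain ⟨c, hc⟩ := hy
        exact ⟨b + c, by rw [map_add, hb, hc, add_smul]⟩
      | smul r x _ hx =>
        obtain ⟨b, hb⟩ := hx
        exact ⟨r * b, by rw [map_mul, hb, smul_assoc, Algebra.smul_def r]⟩
    · have h3 := congrArg (X.evaluation (U ⊓ V) z₀ hz₀W) ht
      rw [map_one, map_sum] at h3
      rw [← h3]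
      refine sum_mem fun f _ ↦ ?_
      rw [smul_eq_mul, map_mul, mul_comm]
      have h4 : X.evaluation (U ⊓ V) z₀ hz₀W
          ((X.presheaf.map (homOfLE hWV).op).hom f.1) = algebraMap R _ (π (γ f.1)) := by
        rw [hRπ, hφγ]
        exact evaluation_map hWV z₀ hz₀W f.1
      rw [h4, ← Algebra.smul_def]
      refine Submodule.smul_mem_smul ?_ (Submodule.subset_span ⟨f, rfl⟩)
      have hzf : z ∉ X.basicOpen f.1 := fun h ↦ hZU hz.mem (hF f f.2 h).1
      have h5 : (IsLocalRing.maximalIdeal R).comap π = IsLocalRing.maximalIdeal O :=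
        IsLocalRing.eq_maximalIdeal (Ideal.comap_isMaximal_of_surjective π hπ)
      refine h5.ge ?_
      refine not_not.mp fun h ↦ hzf ?_
      have h6 := (fromSpecStalk_mem_basicOpen hzV f.1 (IsLocalRing.closedPoint O)).mpr h
      exact (X.fromSpecStalk_closedPoint (x := z)) ▸ h6
    · intro h0
      refine hne0 ?_
      rw [← hP₁, ← hP₀]
      refine congrArg (X.fromSpecStalk z) (PrimeSpectrum.ext ?_)
      rw [← hker]
      exact le_antisymm hker₁ ((hcm.symm.trans (congrArg (Ideal.comap π) h0)).trans hπker).le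
  refine hP₁.symm.trans ((congrArg (X.fromSpecStalk z) (PrimeSpectrum.ext ?_)).trans
    X.fromSpecStalk_closedPoint)
  exact (hcm.symm.trans (congrArg (Ideal.comap π) key)).trans
    (IsLocalRing.eq_maximalIdeal (Ideal.comap_isMaximal_of_surjective π hπ))

/-- Purity: the components of the complement of a dense affine open subset of a Noetherian separated
scheme have codimension one. -/
theorem coheight_eq_one_of_isAffineOpen [IsNoetherian X] [X.IsSeparated]
    (hU : IsAffineOpen U) (hd : Dense (U : Set X)) (Z : IrreducibleCloseds X)
    (hZU : (Z : Set X) ⊆ (U : Set X)ᶜ)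
    (hmax : ∀ Z' : IrreducibleCloseds X, Z ≤ Z' → (Z' : Set X) ⊆ (U : Set X)ᶜ → Z' ≤ Z) :
    Order.coheight Z = 1 := by
  refine le_antisymm (coheight_le_one_of_isAffineOpen hU Z hZU hmax)
    (Order.one_le_iff_ne_zero.mpr fun h0 ↦ ?_)
  rw [Order.coheight_eq_zero] at h0
  have hcomp : (Z : Set X) ∈ irreducibleComponents X := by
    refine ⟨Z.isIrreducible, fun S hS hZS ↦ ?_⟩
    exact subset_closure.trans (h0 (b := ⟨closure S, hS.closure, isClosed_closure⟩)
      (hZS.trans subset_closure))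
  obtain ⟨O, hO, hOne, hOZ⟩ :=
    NoetherianSpace.exists_isOpen_nonempty_subset_irreducibleComponent (Z : Set X) hcomp
  obtain ⟨x, hxO, hxU⟩ := hd.inter_open_nonempty O hO hOne
  exact hZU (hOZ hxO) hxU

end Purity

/-! ### Regular maps on linear algebraic groups -/

section RegularMaps

variable {n : ℕ} {G : Subgroup (GL (Fin n) ℂ)}

/-- Precomposition with a map of index types, as a homomorphism of algebras of functions. -/
def compAlgHom {I K : Type*} (φ : K → I) : (I → ℂ) →ₐ[ℂ] (K → ℂ) where
  toFun c k := c (φ k)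
  map_one' := rfl
  map_mul' _ _ := rfl
  map_zero' := rfl
  map_add' _ _ := rfl
  commutes' _ := rfl

@[simp]
lemma compAlgHom_apply {I K : Type*} (φ : K → I) (c : I → ℂ) (k : K) :
    compAlgHom φ c k = c (φ k) := rfl

lemma comp_mul_right_mem_regularFunctions (h : G) {c : G → ℂ} (hc : c ∈ regularFunctions G) :
    (fun g ↦ c (g * h)) ∈ regularFunctions G := by
  let Φ : (G → ℂ) →ₐ[ℂ] (G → ℂ) := compAlgHom (· * h)
  suffices H : regularFunctions G ≤ (regularFunctions G).comap Φ from H hc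
  have hentry : ∀ i j, (fun g : G ↦ g.1.val i j) ∈ regularFunctions G := fun i j ↦
    Algebra.subset_adjoin (Or.inl ⟨i, j, rfl⟩)
  refine Algebra.adjoin_le ?_
  rintro _ (⟨i, j, rfl⟩ | rfl)
  · have : Φ (fun g : G ↦ g.1.val i j) =
        ∑ k, h.1.val k j • (fun g : G ↦ g.1.val i k) := by
      ext g
      simp [Φ, Matrix.mul_apply, mul_comm]
    rw [SetLike.mem_coe, Subalgebra.mem_comap, this]
    exact sum_mem fun k _ ↦ Subalgebra.smul_mem _ (hentry i k) _
  · have : Φ (fun g : G ↦ (g.1.val.det)⁻¹) = (h.1.val.det)⁻¹ • fun g : G ↦ (g.1.val.det)⁻¹ := by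
      ext g
      simp [Φ, Matrix.det_mul, mul_comm]
    rw [SetLike.mem_coe, Subalgebra.mem_comap, this]
    exact Subalgebra.smul_mem (regularFunctions G) (Algebra.subset_adjoin (Or.inr rfl)) _

lemma comp_inv_mem_regularFunctions {c : G → ℂ} (hc : c ∈ regularFunctions G) :
    (fun g ↦ c g⁻¹) ∈ regularFunctions G := by
  let Φ : (G → ℂ) →ₐ[ℂ] (G → ℂ) := compAlgHom (·⁻¹)
  suffices H : regularFunctions G ≤ (regularFunctions G).comap Φ from H hc
  have hentry : ∀ i j, (fun g : G ↦ g.1.val i j) ∈ regularFunctions G := fun i j ↦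
    Algebra.subset_adjoin (Or.inl ⟨i, j, rfl⟩)
  have hdet : (fun g : G ↦ (g.1.val.det)⁻¹) ∈ regularFunctions G :=
    Algebra.subset_adjoin (Or.inr rfl)
  have hpoly : ∀ M : G → Matrix (Fin n) (Fin n) ℂ, (∀ i j, (fun g ↦ M g i j) ∈ regularFunctions G) →
      (fun g ↦ (M g).det) ∈ regularFunctions G := by
    intro M hM
    have : (fun g ↦ (M g).det) =
        ∑ σ : Equiv.Perm (Fin n), (σ.sign : ℤ) • ∏ i, fun g ↦ M g (σ i) i := by
      ext g
      simp [Matrix.det_apply, Units.smul_def]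
    rw [this]
    exact sum_mem fun σ _ ↦ zsmul_mem (prod_mem fun i _ ↦ hM _ _) _
  refine Algebra.adjoin_le ?_
  rintro _ (⟨i, j, rfl⟩ | rfl)
  · have : Φ (fun g : G ↦ g.1.val i j) =
        (fun g : G ↦ (g.1.val.det)⁻¹) * fun g : G ↦ (g.1.val.updateRow j (Pi.single i 1)).det := by
      ext g
      simp [Φ, Matrix.inv_def, Matrix.adjugate_apply]
    rw [SetLike.mem_coe, Subalgebra.mem_comap, this]
    refine mul_mem hdet (hpoly _ fun k l ↦ ?_)
    by_cases hk : k = j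
    · subst hk
      simp only [Matrix.updateRow_self]
      exact Subalgebra.algebraMap_mem (regularFunctions G) (Pi.single (M := fun _ ↦ ℂ) i 1 l)
    · simpa [Matrix.updateRow_ne hk] using hentry k l
  · have : Φ (fun g : G ↦ (g.1.val.det)⁻¹) = fun g : G ↦ g.1.val.det := by
      ext g
      simp [Φ, Matrix.det_nonsing_inv]
    rw [SetLike.mem_coe, Subalgebra.mem_comap, this]
    exact hpoly _ hentry

variable {M N P : Type*} [AddCommGroup M] [Module ℂ M] [AddCommGroup N] [Module ℂ N]
  [AddCommGroup P] [Module ℂ P]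

variable (G M) in
/-- The maps `g ↦ ∑ c i (g) • m i` from `G` to a vector space `M`, given by finitely many regular
functions `c i` and vectors `m i`. No topology or dimension bound is imposed on `M`. -/
def regularMaps : Submodule ℂ (G → M) :=
  Submodule.span ℂ {F | ∃ c ∈ regularFunctions G, ∃ m : M, F = fun g ↦ c g • m}

lemma smul_const_mem_regularMaps {c : G → ℂ} (hc : c ∈ regularFunctions G) (m : M) :
    (fun g ↦ c g • m) ∈ regularMaps G M :=
  Submodule.subset_span ⟨c, hc, m, rfl⟩

@[elab_as_elim]
lemma regularMaps_induction {p : ∀ F : G → M, F ∈ regularMaps G M → Prop}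
    (smul : ∀ c (hc : c ∈ regularFunctions G) (m : M), p _ (smul_const_mem_regularMaps hc m))
    (add : ∀ F F' hF hF', p F hF → p F' hF' → p (F + F') (add_mem hF hF')) {F : G → M}
    (hF : F ∈ regularMaps G M) : p F hF := by
  induction hF using Submodule.closure_induction with
  | zero => simpa using! smul 0 (zero_mem _) 0
  | add F F' hF hF' h h' => exact add F F' hF hF' h h'
  | smul_mem a F hF =>
    obtain ⟨c, hc, m, rfl⟩ := hF
    simpa [Pi.smul_def, mul_smul] using! smul (a • c) (Subalgebra.smul_mem _ hc a) m

lemma comp_mem_regularMaps (l : M →ₗ[ℂ] N) {F : G → M} (hF : F ∈ regularMaps G M) :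
    (fun g ↦ l (F g)) ∈ regularMaps G N := by
  induction hF using regularMaps_induction with
  | smul c hc m => simpa using smul_const_mem_regularMaps hc (l m)
  | add F F' _ _ h h' => simpa using! add_mem h h'

lemma bilin_mem_regularMaps (l : M →ₗ[ℂ] N →ₗ[ℂ] P) {F : G → M} (hF : F ∈ regularMaps G M)
    {F' : G → N} (hF' : F' ∈ regularMaps G N) : (fun g ↦ l (F g) (F' g)) ∈ regularMaps G P := by
  induction hF using regularMaps_induction with
  | smul c hc m =>
    induction hF' using regularMaps_induction with
    | smul c' hc' m' =>
      simpa [smul_smul, mul_comm] using! smul_const_mem_regularMaps (mul_mem hc hc') (l m m')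
    | add F F' _ _ h h' => simpa using! add_mem h h'
  | add F F' _ _ h h' => simpa using! add_mem h h'

lemma mem_regularFunctions_of_mem_regularMaps {c : G → ℂ} (hc : c ∈ regularMaps G ℂ) :
    c ∈ regularFunctions G := by
  induction hc using regularMaps_induction with
  | smul c hc m => simpa [mul_comm] using! Subalgebra.smul_mem _ hc m
  | add F F' _ _ h h' => exact add_mem h h'

lemma comp_mul_right_mem_regularMaps (h : G) {F : G → M} (hF : F ∈ regularMaps G M) :
    (fun g ↦ F (g * h)) ∈ regularMaps G M := by
  induction hF using regularMaps_induction with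
  | smul c hc m => exact smul_const_mem_regularMaps (comp_mul_right_mem_regularFunctions h hc) m
  | add F F' _ _ h h' => exact add_mem h h'

lemma mem_regularMaps_of_comp_injective (l : M →ₗ[ℂ] N) (hl : Function.Injective l) {F : G → M}
    (hF : (fun g ↦ l (F g)) ∈ regularMaps G N) : F ∈ regularMaps G M := by
  obtain ⟨r, hr⟩ := l.exists_leftInverse_of_injective (LinearMap.ker_eq_bot.mpr hl)
  have := comp_mem_regularMaps r hF
  convert this using 2 with g
  exact (LinearMap.congr_fun hr (F g)).symm

lemma pi_mem_regularMaps {ι : Type*} [Finite ι] {N : ι → Type*} [∀ i, AddCommGroup (N i)]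
    [∀ i, Module ℂ (N i)] {F : G → ∀ i, N i} (hF : ∀ i, (fun g ↦ F g i) ∈ regularMaps G (N i)) :
    F ∈ regularMaps G (∀ i, N i) := by
  classical
  have := Fintype.ofFinite ι
  have h : F = ∑ i, fun g ↦ LinearMap.single ℂ N i (F g i) := by
    ext g i
    rw [Finset.sum_apply, Finset.sum_apply]
    simp
  rw [h]
  exact sum_mem fun i _ ↦ comp_mem_regularMaps _ (hF i)

lemma exists_fg_of_mem_regularMaps {F : G → M} (hF : F ∈ regularMaps G M) :
    ∃ Q : Submodule ℂ M, Q.FG ∧ ∀ g, F g ∈ Q := by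
  induction hF using regularMaps_induction with
  | smul c hc m => exact ⟨_, Submodule.fg_span_singleton m, fun g ↦
      Submodule.smul_mem _ _ (Submodule.mem_span_singleton_self m)⟩
  | add F F' _ _ h h' =>
    obtain ⟨Q, hQ, h⟩ := h
    obtain ⟨Q', hQ', h'⟩ := h'
    exact ⟨Q ⊔ Q', hQ.sup hQ', fun g ↦ add_mem (Submodule.mem_sup_left (h g))
      (Submodule.mem_sup_right (h' g))⟩

end RegularMaps

/-! ### Lifting of invariants for reductive groups -/

section Reynolds

variable {n : ℕ} {G : Subgroup (GL (Fin n) ℂ)} {M N : Type*} [AddCommGroup M] [Module ℂ M]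
  [AddCommGroup N] [Module ℂ N]

/-- A vector `v` is rational if its orbit map `g ↦ g • v` is regular. A possibly
infinite-dimensional representation is locally finite and rational if all its vectors are rational.
-/
def IsRationalVector (ρ : Representation ℂ G M) (v : M) : Prop :=
  (fun g ↦ ρ g v) ∈ regularMaps G M

/-- The lifting property that replaces the Reynolds operator. On the finite-dimensional span `E` of
the orbit of `v`, the kernel of `π` has a stable complement, and the component of `v` there is
invariant, because `π` is injective on the complement and `π v` is invariant. -/
lemma exists_invariant_of_isReductive (hG : IsReductive G) (ρ : Representation ℂ G M) {v : M}
    (hv : IsRationalVector ρ v) (π : M →ₗ[ℂ] N) (hπ : ∀ g m, π m = π v → π (ρ g m) = π v)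
    (hπ' : ∀ g m, π m = 0 → π (ρ g m) = 0) :
    ∃ w ∈ Submodule.span ℂ (Set.range fun g ↦ ρ g v), (∀ g, ρ g w = w) ∧ π w = π v := by
  let E : Submodule ℂ M := Submodule.span ℂ (Set.range fun g ↦ ρ g v)
  have hvE : v ∈ E := Submodule.subset_span ⟨1, by simp⟩
  obtain ⟨Q, hQ, hQv⟩ := exists_fg_of_mem_regularMaps hv
  have hEQ : E ≤ Q := Submodule.span_le.mpr (by rintro _ ⟨g, rfl⟩; exact hQv g)
  have : Module.Finite ℂ Q := Module.Finite.iff_fg.mpr hQ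
  have : Module.Finite ℂ E := Submodule.finiteDimensional_of_le hEQ
  have hE : ∀ g, ∀ m ∈ E, ρ g m ∈ E := fun g m hm ↦ by
    induction hm using Submodule.span_induction with
    | mem m hm =>
      obtain ⟨h, rfl⟩ := hm
      exact Submodule.subset_span ⟨g * h, by simp⟩
    | zero => simp
    | add x y _ _ hx hy => rw [map_add]; exact add_mem hx hy
    | smul a x _ hx => rw [map_smul]; exact Submodule.smul_mem _ _ hx
  have hreg : ∀ m ∈ E, (fun g ↦ ρ g m) ∈ regularMaps G M := fun m hm ↦ by
    induction hm using Submodule.span_induction with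
    | mem m hm =>
      obtain ⟨h, rfl⟩ := hm
      simpa using comp_mul_right_mem_regularMaps h hv
    | zero => simp only [map_zero]; exact zero_mem _
    | add x y _ _ hx hy => simpa using! add_mem hx hy
    | smul a x _ hx => simpa using! Submodule.smul_mem _ a hx
  let e : E ≃ₗ[ℂ] (Fin (Module.finrank ℂ E) → ℂ) :=
    (Module.finBasis ℂ E).equivFun
  let ρE : Representation ℂ G E :=
    (⟨E, fun g m hm ↦ hE g m hm⟩ : Subrepresentation ρ).toRepresentation
  -- reductivity is stated for representations on the spaces `Fin m → ℂ`
  let σ : Representation ℂ G (Fin (Module.finrank ℂ E) → ℂ) :=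
    { toFun g := e.conj (ρE g)
      map_one' := by ext; simp [LinearEquiv.conj_apply]
      map_mul' g h := by ext; simp [LinearEquiv.conj_apply] }
  have hσ : ∀ g x, σ g x = e (ρE g (e.symm x)) := fun g x ↦ rfl
  have hσr : IsRational σ := by
    intro x l
    refine mem_regularFunctions_of_mem_regularMaps
      (comp_mem_regularMaps (F := fun g ↦ ρE g (e.symm x)) (l ∘ₗ e.toLinearMap) ?_)
    exact mem_regularMaps_of_comp_injective E.subtype E.injective_subtype
      (hreg _ (e.symm x).2)
  have hss := hG.semisimple _ σ hσr
  let π' : (Fin (Module.finrank ℂ E) → ℂ) →ₗ[ℂ] N := π ∘ₗ E.subtype ∘ₗ e.symm.toLinearMap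
  let K : Subrepresentation σ := ⟨LinearMap.ker π', fun g x hx ↦ by
    change π (e.symm (e _)) = 0
    rw [e.symm_apply_apply]
    exact hπ' g _ hx⟩
  obtain ⟨C, hC⟩ := hss.exists_isCompl K
  have htop : e ⟨v, hvE⟩ ∈ K.toSubmodule ⊔ C.toSubmodule := by
    have : (K ⊔ C).toSubmodule = (⊤ : Subrepresentation σ).toSubmodule :=
      congrArg _ hC.sup_eq_top
    rw [← Subrepresentation.toSubmodule_sup, this]
    exact Submodule.mem_top
  obtain ⟨q, hq, c, hc, hqc⟩ := Submodule.mem_sup.mp htop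
  have hπc : π' c = π v := by
    have h1 : π' (e ⟨v, hvE⟩) = π v := by simp [π']
    rw [← h1, ← hqc, map_add, show π' q = 0 from hq, zero_add]
  refine ⟨e.symm c, (e.symm c).2, fun g ↦ ?_, hπc⟩
  -- `g • c - c` lies in `K`, as `π (g • c) = π c`, and in the stable complement `C`
  have h0 : σ g c - c ∈ (K ⊓ C).toSubmodule := by
    refine ⟨?_, sub_mem (C.apply_mem_toSubmodule g hc) hc⟩
    change π' (σ g c - c) = 0
    rw [map_sub, hπc, sub_eq_zero]
    change π (e.symm (e _)) = _
    rw [e.symm_apply_apply]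
    exact hπ g _ hπc
  rw [hC.inf_eq_bot] at h0
  have h1 : σ g c = c := sub_eq_zero.mp ((Submodule.mem_bot ℂ).mp h0)
  have h2 := congrArg e.symm h1
  rw [hσ, e.symm_apply_apply] at h2
  exact congrArg Subtype.val h2

/-- A solution `a` of the congruence `φ a ≡ t` modulo `K` with entries in the stable subspaces
`Q i`, for an equivariant `φ` and an invariant `t`, can be replaced by an invariant solution. -/
lemma exists_invariant_family {ι : Type*} [Finite ι] (hG : IsReductive G) (ρ : Representation ℂ G M)
    (φ : (ι → M) →ₗ[ℂ] M) (hφ : ∀ g a, φ (fun i ↦ ρ g (a i)) = ρ g (φ a))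
    (Q : ι → Submodule ℂ M) (hQ : ∀ i g, ∀ m ∈ Q i, ρ g m ∈ Q i)
    (K : Submodule ℂ M) (hK : ∀ g, ∀ m ∈ K, ρ g m ∈ K)
    {a : ι → M} (ha : ∀ i, IsRationalVector ρ (a i)) (haQ : ∀ i, a i ∈ Q i)
    {t : M} (ht : ∀ g, ρ g t = t) (hat : φ a - t ∈ K) :
    ∃ w : ι → M, (∀ i, w i ∈ Q i) ∧ (∀ i g, ρ g (w i) = w i) ∧ φ w - t ∈ K := by
  let σ : Representation ℂ G (ι → M) :=
    { toFun g := LinearMap.pi fun i ↦ ρ g ∘ₗ LinearMap.proj i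
      map_one' := by ext; simp
      map_mul' g h := by ext; simp }
  have hσ : ∀ g b, σ g b = fun i ↦ ρ g (b i) := fun g b ↦ rfl
  have h1 : ∀ b, (K.mkQ ∘ₗ φ) b = (K.mkQ ∘ₗ φ) a ↔ φ b - t ∈ K := fun b ↦ by
    simp only [LinearMap.comp_apply, Submodule.mkQ_apply]
    rw [Submodule.Quotient.eq, ← sub_add_sub_cancel (φ b) t (φ a),
      K.add_mem_iff_left (by rw [← neg_sub]; exact neg_mem hat)]
  obtain ⟨w, hw, hwi, hwt⟩ := exists_invariant_of_isReductive hG σ (v := a)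
    (pi_mem_regularMaps ha) (K.mkQ ∘ₗ φ)
    (fun g m hm ↦ by
      rw [h1] at hm ⊢
      have := hK g _ hm
      rwa [map_sub, ht, ← hφ] at this)
    (fun g m hm ↦ by
      simp only [LinearMap.comp_apply, Submodule.mkQ_apply, Submodule.Quotient.mk_eq_zero] at hm ⊢
      rw [hσ, hφ]
      exact hK g _ hm)
  refine ⟨w, fun i ↦ ?_, fun i g ↦ congrFun (hwi g) i, (h1 w).mp hwt⟩
  have : Submodule.span ℂ (Set.range fun g ↦ σ g a) ≤ Submodule.pi Set.univ Q := by
    rw [Submodule.span_le]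
    rintro _ ⟨g, rfl⟩ i _
    exact hQ i g _ (haQ i)
  exact this hw i trivial

end Reynolds

/-! ### Noetherian graded rings and rings of invariants -/

section GradedNoetherian

lemma finiteType_gradeZero_of_isNoetherianRing {R σ : Type*} [CommRing R] [SetLike σ R]
    [AddSubgroupClass σ R] (ℛ : ℕ → σ) [GradedRing ℛ] [IsNoetherianRing R] :
    Algebra.FiniteType (ℛ 0) R := by
  have hfg : (Ideal.span (⋃ i > 0, (ℛ i : Set R))).FG := IsNoetherian.noetherian _
  obtain ⟨s, hs, hspan⟩ := Submodule.fg_span_iff_fg_span_finset_subset _ |>.mp hfg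
  refine ⟨s, ?_⟩
  have key : ∀ d, ∀ a ∈ ℛ d, a ∈ Algebra.adjoin (ℛ 0) (s : Set R) := by
    intro d
    induction d using Nat.strong_induction_on with
    | _ d ih =>
      intro a ha
      obtain rfl | hd := Nat.eq_zero_or_pos d
      · exact Subalgebra.algebraMap_mem (Algebra.adjoin (ℛ 0) (s : Set R)) (⟨a, ha⟩ : ℛ 0)
      have ha' : a ∈ Submodule.span R (s : Set R) := by
        rw [← hspan]
        exact Submodule.subset_span (Set.mem_biUnion hd ha)
      obtain ⟨c, -, hc⟩ := Submodule.mem_span_finset.mp ha'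
      -- pass to the degree `d` part: the coefficients of the generators then have degree `< d`
      rw [← DirectSum.decompose_of_mem_same ℛ ha, ← hc, DirectSum.decompose_sum,
        DFinsupp.finsetSum_apply, AddSubmonoidClass.coe_finsetSum]
      refine sum_mem fun x hx ↦ ?_
      have hx' := hs hx
      simp only [Set.mem_iUnion] at hx'
      obtain ⟨i, hi, hxi⟩ := hx'
      rw [smul_eq_mul, DirectSum.coe_decompose_mul_of_right_mem ℛ d hxi]
      split_ifs with h
      · exact mul_mem (ih _ (by omega) _ (SetLike.coe_mem _)) (Algebra.subset_adjoin hx)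
      · exact zero_mem _
  rw [eq_top_iff]
  intro a _
  classical
  rw [← DirectSum.sum_support_decompose ℛ a]
  exact sum_mem fun i _ ↦ key i _ (SetLike.coe_mem _)

lemma isNoetherian_proj {R σ : Type u} [CommRing R] [SetLike σ R]
    [AddSubgroupClass σ R] (ℛ : ℕ → σ) [GradedRing ℛ] [IsNoetherianRing R] :
    IsNoetherian (Proj ℛ) := by
  have := finiteType_gradeZero_of_isNoetherianRing ℛ
  have : IsLocallyNoetherian (Proj ℛ) :=
    LocallyOfFiniteType.isLocallyNoetherian (Proj.toSpecZero ℛ)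
  have : CompactSpace (Proj ℛ) := QuasiCompact.compactSpace_of_compactSpace (Proj.toSpecZero ℛ)
  exact {}

end GradedNoetherian

namespace GradedAction

variable {n : ℕ} {G : Subgroup (GL (Fin n) ℂ)} {A : Type u} [CommRing A] [Algebra ℂ A]
  {𝒜 : ℕ → Submodule ℂ A} (α : GradedAction G 𝒜)

/-- The representation of `G` on the whole algebra `A`. -/
def fullRep : Representation ℂ G A where
  toFun g := (α.hom g).toLinearMap
  map_one' := by ext; simp
  map_mul' g h := by ext; simp

@[simp]
lemma fullRep_apply (g : G) (a : A) : α.fullRep g a = α.hom g a := rfl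

variable [GradedAlgebra 𝒜]

lemma isRationalVector_fullRep (hW : IsLinearizedVariety α) (a : A) :
    IsRationalVector α.fullRep a := by
  have ha : a ∈ Algebra.adjoin ℂ (𝒜 1 : Set A) := hW.generated ▸ Algebra.mem_top
  induction ha using Algebra.adjoin_induction with
  | mem a ha =>
    have := hW.finiteDimensional
    let b := Module.finBasis ℂ (𝒜 1)
    have : (fun g ↦ α.fullRep g a) = ∑ i, fun g ↦ b.repr (α.rep 1 g ⟨a, ha⟩) i • (b i : A) := by
      ext g
      rw [Finset.sum_apply]
      simp only [← Submodule.coe_smul_of_tower]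
      rw [← AddSubmonoidClass.coe_finsetSum, b.sum_repr]
      rfl
    rw [IsRationalVector, this]
    exact sum_mem fun i _ ↦ smul_const_mem_regularMaps (hW.rational ⟨a, ha⟩ (b.coord i)) _
  | algebraMap r =>
    simpa [IsRationalVector] using! smul_const_mem_regularMaps (one_mem (regularFunctions G))
      (algebraMap ℂ A r)
  | add x y _ _ hx hy => simpa [IsRationalVector] using! add_mem hx hy
  | mul x y _ _ hx hy =>
    simpa [IsRationalVector] using! bilin_mem_regularMaps (LinearMap.mul ℂ A) hx hy

lemma isNoetherianRing (hW : IsLinearizedVariety α) : IsNoetherianRing A := by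
  have := hW.finiteDimensional
  have : Algebra.FiniteType ℂ A := by
    obtain ⟨s, hs⟩ := Module.Finite.iff_fg.mp this
    exact ⟨s, by rw [← Algebra.adjoin_span, hs, hW.generated]⟩
  exact Algebra.FiniteType.isNoetherianRing ℂ A

/-- A relation `∑ a i * s i ≡ t` modulo a stable ideal, between invariants `s i` and `t`, has a
solution with invariant coefficients. -/
lemma exists_invariant_sum_mul {ι : Type*} [Fintype ι] (hG : IsReductive G)
    (hW : IsLinearizedVariety α) (K : Ideal A) (hK : ∀ g, ∀ a ∈ K, α.hom g a ∈ K)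
    {s : ι → A} (hs : ∀ i, s i ∈ α.invariants) (a : ι → A) {t : A} (ht : t ∈ α.invariants)
    (hat : ∑ i, a i * s i - t ∈ K) :
    ∃ w : ι → α.invariants, ∑ i, (w i : A) * s i - t ∈ K := by
  obtain ⟨w, -, hw, hwt⟩ := exists_invariant_family hG α.fullRep
    (∑ i, LinearMap.mulRight ℂ (s i) ∘ₗ LinearMap.proj i)
    (fun g a ↦ by simp [fun i ↦ hs i g]) (fun _ ↦ ⊤) (fun _ _ _ _ ↦ trivial)
    (K.restrictScalars ℂ) hK (a := a) (fun i ↦ α.isRationalVector_fullRep hW _) (fun _ ↦ trivial)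
    (t := t) ht (by simpa using hat)
  exact ⟨fun i ↦ ⟨w i, hw i⟩, by simpa using hwt⟩

lemma exists_invariant_sub_mem (hG : IsReductive G) (hW : IsLinearizedVariety α) (K : Ideal A)
    (hK : ∀ g, ∀ a ∈ K, α.hom g a ∈ K) {a : A} (ha : ∀ g, α.hom g a - a ∈ K) :
    ∃ w ∈ α.invariants, w - a ∈ K := by
  obtain ⟨w, -, hw, hwt⟩ := exists_invariant_of_isReductive hG α.fullRep
    (α.isRationalVector_fullRep hW a) (K.restrictScalars ℂ).mkQ
    (fun g m hm ↦ by
      simp only [Submodule.mkQ_apply, Submodule.Quotient.eq, Submodule.restrictScalars_mem] at hm ⊢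
      have := add_mem (hK g _ hm) (ha g)
      rwa [map_sub, sub_add_sub_cancel] at this)
    (fun g m hm ↦ by
      simp only [Submodule.mkQ_apply, Submodule.Quotient.mk_eq_zero,
        Submodule.restrictScalars_mem] at hm ⊢
      exact hK g _ hm)
  exact ⟨w, hw, by simpa [Submodule.Quotient.eq] using hwt⟩

/-- Extension to `A` followed by contraction does not enlarge an ideal of `A^G` that contains all
the invariants in `K`, even after adding the stable ideal `K`. -/
lemma mem_ideal_of_mem_map (hG : IsReductive G) (hW : IsLinearizedVariety α)
    (I : Ideal α.invariants) (K : Ideal A) (hK : ∀ g, ∀ a ∈ K, α.hom g a ∈ K)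
    (hKI : K.comap (α.invariants.val : α.invariants →+* A) ≤ I) {t : α.invariants}
    (ht : (t : A) ∈ I.map (α.invariants.val : α.invariants →+* A) ⊔ K) : t ∈ I := by
  obtain ⟨x, hx, k, hk, hxk⟩ := Submodule.mem_sup.mp ht
  obtain ⟨m, s, hs, a, rfl⟩ : ∃ (m : ℕ) (s : Fin m → α.invariants), (∀ i, s i ∈ I) ∧
      ∃ a : Fin m → A, x = ∑ i, a i * (s i : A) := by
    obtain ⟨m, a, y, rfl⟩ := Submodule.mem_span_set'.mp hx
    choose s hs hsy using fun i ↦ (y i).2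
    exact ⟨m, s, hs, a, Finset.sum_congr rfl fun i _ ↦ by rw [← hsy]; rfl⟩
  obtain ⟨w, hw⟩ := α.exists_invariant_sum_mul hG hW K hK (fun i ↦ (s i).2) a t.2
    (by rw [← hxk, sub_add_cancel_left]; exact neg_mem hk)
  have h1 : ∑ i, w i * s i ∈ I := sum_mem fun i _ ↦ I.mul_mem_left _ (hs i)
  have h2 : ∑ i, w i * s i - t ∈ I := hKI (by simpa [Ideal.mem_comap] using! hw)
  simpa using sub_mem h1 h2

/-- Hilbert's argument: extension of ideals from `A^G` to the Noetherian ring `A` is injective. -/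
lemma isNoetherianRing_invariants (hG : IsReductive G) (hW : IsLinearizedVariety α) :
    IsNoetherianRing α.invariants := by
  have := α.isNoetherianRing hW
  rw [isNoetherianRing_iff, isNoetherian_iff']
  refine StrictMono.wellFoundedGT (f := fun I : Ideal α.invariants ↦
    I.map (α.invariants.val : α.invariants →+* A)) (Monotone.strictMono_of_injective
      (fun _ _ h ↦ Ideal.map_mono h) fun I I' h ↦ ?_)
  have key : ∀ I : Ideal α.invariants, (I.map (α.invariants.val : α.invariants →+* A)).comap
      (α.invariants.val : α.invariants →+* A) ≤ I := fun I t ht ↦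
    α.mem_ideal_of_mem_map hG hW I ⊥ (by simp) (fun x hx ↦ by
      have : x = 0 := Subtype.ext hx
      simp [this]) (by simpa using ht)
  exact le_antisymm (Ideal.map_le_iff_le_comap.mp (le_of_eq h) |>.trans (key I'))
    (Ideal.map_le_iff_le_comap.mp (ge_of_eq h) |>.trans (key I))

end GradedAction

/-! ### Points of `Proj` and the maps induced by graded homomorphisms -/

section ProjMorphisms

variable {A B : Type u} [CommRing A] [CommRing B] {σ τ : Type u} [SetLike σ A]
  [AddSubgroupClass σ A] [SetLike τ B] [AddSubgroupClass τ B] {𝒜 : ℕ → σ} {ℬ : ℕ → τ}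
  [GradedRing 𝒜] [GradedRing ℬ]

lemma exists_notMem_of_pos (x : Proj 𝒜) :
    ∃ (i : ℕ) (s : A), 0 < i ∧ s ∈ 𝒜 i ∧ x ∈ Proj.basicOpen 𝒜 s := by
  by_contra! h
  refine x.not_irrelevant_le ((HomogeneousIdeal.irrelevant_le _).mpr fun i hi a ha ↦ ?_)
  by_contra hx
  exact h i a hi ha hx

/-- Containment in the prime ideal of a point of `Proj` can be tested on elements of positive
degree. -/
lemma homogeneousIdeal_le_of_pos {I : HomogeneousIdeal 𝒜} {y : Proj 𝒜}
    (h : ∀ (i : ℕ) (s : A), 0 < i → s ∈ 𝒜 i → s ∈ I → y ∉ Proj.basicOpen 𝒜 s) :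
    I ≤ y.asHomogeneousIdeal := by
  obtain ⟨j, t, hj, ht, hty⟩ := exists_notMem_of_pos y
  suffices H : ∀ (i : ℕ) (s : A), s ∈ 𝒜 i → s ∈ I → s ∈ y.asHomogeneousIdeal by
    intro a ha
    classical
    rw [← DirectSum.sum_support_decompose 𝒜 a]
    exact sum_mem fun i _ ↦ H i _ (SetLike.coe_mem _) (I.isHomogeneous i ha)
  intro i s hs hsI
  have h1 := h (i + j) (s * t) (by omega) (SetLike.mul_mem_graded hs ht)
    (I.toIdeal.mul_mem_right t hsI)
  rw [Proj.basicOpen_mul, TopologicalSpace.Opens.mem_inf] at h1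
  by_contra hsy
  exact h1 ⟨hsy, hty⟩

lemma proj_ext_of_pos {x y : Proj 𝒜} (h : ∀ (i : ℕ) (s : A), 0 < i → s ∈ 𝒜 i →
    (x ∈ Proj.basicOpen 𝒜 s ↔ y ∈ Proj.basicOpen 𝒜 s)) : x = y := by
  refine ProjectiveSpectrum.ext (le_antisymm ?_ ?_)
  · exact homogeneousIdeal_le_of_pos fun i s hi hs hsx hsy ↦ (h i s hi hs).mpr hsy hsx
  · exact homogeneousIdeal_le_of_pos fun i s hi hs hsx hsy ↦ (h i s hi hs).mp hsy hsx

variable (f : 𝒜 →+*ᵍ ℬ)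

lemma projMap_preimage_basicOpen {d : ℕ} {t : A} (hd : 0 < d) (ht : t ∈ 𝒜 d) :
    projMap f ⁻¹ᵁ Proj.basicOpen 𝒜 t = (projMapDomain f).ι ⁻¹ᵁ Proj.basicOpen ℬ (f t) := by
  ext ⟨x, hx⟩
  obtain ⟨s, hxs⟩ := TopologicalSpace.Opens.mem_iSup.mp hx
  let x' : (Proj.basicOpen ℬ (f s.2.1)).toScheme := ⟨x, hxs⟩
  have hx' : (⟨x, hx⟩ : projMapDomain f) =
    (Proj ℬ).homOfLE (basicOpen_le_projMapDomain f s) x' :=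
    Subtype.ext (Scheme.homOfLE_apply _ x').symm
  let e := Proj.basicOpenIsoSpec ℬ (f s.2.1) (map_mem f s.2.2.2) s.2.2.1
  let y := e.hom x'
  have hy : Proj.awayι ℬ (f s.2.1) (map_mem f s.2.2.2) s.2.2.1 y = x := by
    rw [Proj.awayι, Scheme.Hom.comp_apply]
    change (Proj.basicOpen ℬ (f s.2.1)).ι (e.inv (e.hom x')) = x
    rw [← Scheme.Hom.comp_apply e.hom, e.hom_inv_id]
    rfl
  have h1 : projMap f ⟨x, hx⟩ = Proj.awayι 𝒜 s.2.1 s.2.2.2 s.2.2.1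
      (Spec.map (CommRingCat.ofHom (Away.map f s.2.1)) y) := by
    rw [hx', ← Scheme.Hom.comp_apply, homOfLE_projMap, projMapPiece]
    rfl
  change projMap f ⟨x, hx⟩ ∈ Proj.basicOpen 𝒜 t ↔ x ∈ Proj.basicOpen ℬ (f t)
  have h2 := Proj.awayι_preimage_basicOpen 𝒜 s.2.2.2 s.2.2.1 ht hd
  have h3 := Proj.awayι_preimage_basicOpen ℬ (map_mem f s.2.2.2) s.2.2.1 (map_mem f ht) hd
  have h4 : Away.map f s.2.1 (Away.isLocalizationElem s.2.2.2 ht) =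
      Away.isLocalizationElem (map_mem f s.2.2.2) (map_mem f ht) := by
    simp [Away.isLocalizationElem, Away.map_mk]
  rw [h1, ← hy]
  change _ ∈ (Proj.awayι 𝒜 s.2.1 s.2.2.2 s.2.2.1) ⁻¹ᵁ Proj.basicOpen 𝒜 t ↔
    y ∈ (Proj.awayι ℬ (f s.2.1) (map_mem f s.2.2.2) s.2.2.1) ⁻¹ᵁ Proj.basicOpen ℬ (f t)
  rw [h2, h3, ← h4]
  rfl

lemma projMap_mem_basicOpen_iff {d : ℕ} {t : A} (hd : 0 < d) (ht : t ∈ 𝒜 d)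
    (x : projMapDomain f) :
    projMap f x ∈ Proj.basicOpen 𝒜 t ↔ x.1 ∈ Proj.basicOpen ℬ (f t) := by
  have := congrArg (x ∈ ·) (projMap_preimage_basicOpen f hd ht)
  exact iff_of_eq this

open HomogeneousIdeal in
lemma irrelevant_le_map_of_surjective (hf : Function.Surjective f) :
    irrelevant ℬ ≤ (irrelevant 𝒜).map f := by
  rw [irrelevant_le]
  intro i hi b hb
  obtain ⟨a, rfl⟩ := hf b
  have h : f (DirectSum.decompose 𝒜 a i) = f a := by
    rw [f.map_directSumDecompose, DirectSum.decompose_of_mem_same ℬ hb]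
  rw [← h]
  exact Ideal.mem_map_of_mem _ (mem_irrelevant_of_mem _ hi (SetLike.coe_mem _))

lemma isClosedImmersion_proj_map (hf : Function.Surjective f)
    (h : HomogeneousIdeal.irrelevant ℬ ≤ (HomogeneousIdeal.irrelevant 𝒜).map f) :
    IsClosedImmersion (Proj.map f h) := by
  refine IsZariskiLocalAtTarget.of_iSup_eq_top (P := @IsClosedImmersion)
    (fun s : PosHomog 𝒜 ↦ Proj.basicOpen 𝒜 s.2.1) ?_ fun s ↦ ?_
  · refine top_le_iff.mp fun x _ ↦ ?_
    obtain ⟨i, s, hi, hs, hx⟩ := exists_notMem_of_pos x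
    exact TopologicalSpace.Opens.mem_iSup.mpr ⟨⟨i, s, hi, hs⟩, hx⟩
  obtain ⟨i, s, hi, hs⟩ := s
  dsimp only
  have hsurj : Function.Surjective (Away.map f s : Away 𝒜 s → Away ℬ (f s)) := by
    intro b
    obtain ⟨k, b, hb, rfl⟩ := b.mk_surjective _ (map_mem f hs)
    obtain ⟨a, rfl⟩ := hf b
    have h : f (DirectSum.decompose 𝒜 a (k • i)) = f a := by
      rw [f.map_directSumDecompose, DirectSum.decompose_of_mem_same ℬ hb]
    refine ⟨Away.mk 𝒜 hs k (DirectSum.decompose 𝒜 a (k • i)) (SetLike.coe_mem _), ?_⟩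
    rw [Away.map_mk]
    congr 1
  have key : ∀ φ : (Proj.basicOpen ℬ (f s)).toScheme ⟶ (Proj.basicOpen 𝒜 s).toScheme,
      φ ≫ (Proj.basicOpen 𝒜 s).ι = (Proj.basicOpen ℬ (f s)).ι ≫ Proj.map f h →
      IsClosedImmersion φ := by
    intro φ hφ
    have : φ = (Proj.basicOpenIsoSpec ℬ (f s) (map_mem f hs) hi).hom ≫
        Spec.map (CommRingCat.ofHom (Away.map f s)) ≫ (Proj.basicOpenIsoSpec 𝒜 s hs hi).inv := by
      rw [← cancel_mono (Proj.basicOpen 𝒜 s).ι, hφ]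
      simp only [Category.assoc, Proj.basicOpenIsoSpec_inv_ι]
      rw [← Proj.awayι_comp_map f h hi s hs, Proj.awayι, Category.assoc, Iso.hom_inv_id_assoc]
    rw [this]
    have := IsClosedImmersion.spec_of_surjective (CommRingCat.ofHom (Away.map f s)) hsurj
    infer_instance
  exact key _ (morphismRestrict_ι _ _)

lemma range_proj_map_of_surjective (hf : Function.Surjective f)
    (h : HomogeneousIdeal.irrelevant ℬ ≤ (HomogeneousIdeal.irrelevant 𝒜).map f) :
    Set.range (Proj.map f h) = {y : Proj 𝒜 | ∀ a, f a = 0 → a ∈ y.asHomogeneousIdeal} := by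
  ext y
  constructor
  · rintro ⟨z, rfl⟩ a ha
    change f a ∈ z.asHomogeneousIdeal
    rw [ha]
    exact zero_mem _
  · intro hy
    have hker : RingHom.ker (f : A →+* B) ≤ y.asHomogeneousIdeal.toIdeal := fun a ha ↦ hy a ha
    have hcomap : (y.asHomogeneousIdeal.toIdeal.map (f : A →+* B)).comap (f : A →+* B) =
        y.asHomogeneousIdeal.toIdeal := by
      rw [Ideal.comap_map_of_surjective' (f : A →+* B) hf, sup_eq_left]
      exact hker
    have hprime := y.isPrime
    have hmap : (y.asHomogeneousIdeal.toIdeal.map (f : A →+* B)).IsPrime :=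
      Ideal.map_isPrime_of_surjective hf hker
    let z : Proj ℬ := ⟨y.asHomogeneousIdeal.map f, hmap, fun hle ↦ by
      obtain ⟨i, s, hi, hs, hsy⟩ := exists_notMem_of_pos y
      have h1 : f s ∈ y.asHomogeneousIdeal.map f :=
        hle (HomogeneousIdeal.mem_irrelevant_of_mem _ hi (map_mem f hs))
      have h2 : s ∈ (y.asHomogeneousIdeal.toIdeal.map (f : A →+* B)).comap (f : A →+* B) := h1
      rw [hcomap] at h2
      exact hsy h2⟩
    exact ⟨z, ProjectiveSpectrum.ext (HomogeneousIdeal.ext hcomap)⟩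

end ProjMorphisms

/-! ### Points of the GIT quotient and the quotient of the boundary -/

namespace GradedAction

variable {n : ℕ} {G : Subgroup (GL (Fin n) ℂ)} {A : Type u} [CommRing A] [Algebra ℂ A]
  {𝒜 : ℕ → Submodule ℂ A} [GradedAlgebra 𝒜] (α : GradedAction G 𝒜)

/-- Every point of the quotient at which the invariants in a stable homogeneous ideal `J` vanish is
the image of a semistable point on the zero locus of `J`. The point is the homogeneous core of a
prime ideal of `A` that contains `J` and contracts to the given prime of `A^G`. -/
lemma exists_proj_lift (hG : IsReductive G) (hW : IsLinearizedVariety α)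
    (J : HomogeneousIdeal 𝒜) (hJ : ∀ g, ∀ a ∈ J, α.hom g a ∈ J) (y : Proj α.invGrading)
    (hy : ∀ a : α.invariants, (a : A) ∈ J → a ∈ y.asHomogeneousIdeal) :
    ∃ x : α.semistableLocus, J ≤ x.1.asHomogeneousIdeal ∧ α.quotientMap x = y := by
  let ι : α.invariants →+* A := α.invariants.val
  let I := y.asHomogeneousIdeal.toIdeal
  have hI : I.IsPrime := y.isPrime
  obtain ⟨P, hP, hIP, hdis⟩ := Ideal.exists_le_prime_disjoint (I.map ι ⊔ J.toIdeal)
    (I.primeCompl.map ι) (by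
      rw [Set.disjoint_left]
      rintro _ h1 ⟨t, ht, rfl⟩
      exact ht (α.mem_ideal_of_mem_map hG hW I J.toIdeal hJ (fun a ha ↦ hy a ha) h1))
  have hPI : ∀ t : α.invariants, (t : A) ∈ P ↔ t ∈ I := fun t ↦ by
    refine ⟨fun ht ↦ ?_, fun ht ↦ hIP (Ideal.mem_sup_left (Ideal.mem_map_of_mem ι ht))⟩
    by_contra h
    exact Set.disjoint_left.mp hdis ht ⟨t, h, rfl⟩
  -- for homogeneous elements, membership in the homogeneous core is membership in `P`
  have hcore : ∀ {i : ℕ} {a : A}, a ∈ 𝒜 i → (a ∈ P.homogeneousCore 𝒜 ↔ a ∈ P) := fun {i a} ha ↦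
    ⟨fun h ↦ Ideal.toIdeal_homogeneousCore_le 𝒜 P h, fun h ↦
      Ideal.mem_homogeneousCore_of_homogeneous_of_mem ⟨i, ha⟩ h⟩
  obtain ⟨j, s, hj, hs, hsy⟩ := exists_notMem_of_pos y
  have hsP : (s : A) ∉ P.homogeneousCore 𝒜 := by
    exact fun h ↦ hsy ((hPI s).mp ((hcore (a := (s : A)) hs).mp h))
  let x : Proj 𝒜 := ⟨P.homogeneousCore 𝒜, hP.homogeneousCore, fun hle ↦
    hsP (hle (HomogeneousIdeal.mem_irrelevant_of_mem _ hj hs))⟩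
  have hx : x ∈ α.semistableLocus :=
    TopologicalSpace.Opens.mem_iSup.mpr ⟨⟨j, s, hj, hs⟩, hsP⟩
  refine ⟨⟨x, hx⟩, (Ideal.homogeneousCore.gc 𝒜 _ _).mp (le_sup_right.trans hIP), ?_⟩
  refine proj_ext_of_pos fun i t hi ht ↦ ?_
  refine (projMap_mem_basicOpen_iff α.invIncl hi ht ⟨x, hx⟩).trans (not_congr ?_)
  exact (hcore ht).trans (hPI t)

lemma quotientMap_surjective (hG : IsReductive G) (hW : IsLinearizedVariety α) :
    Function.Surjective α.quotientMap := fun y ↦ by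
  obtain ⟨x, -, hx⟩ := α.exists_proj_lift hG hW ⊥ (fun g a ha ↦ by
    have : a = 0 := ha
    rw [this, map_zero]; exact zero_mem _) y
    (fun a ha ↦ by
      have : a = 0 := Subtype.ext ha
      rw [this]; exact zero_mem _)
  exact ⟨x, hx⟩

variable {V : (Proj 𝒜).Opens} (hV : α.IsStable V)

lemma boundaryRestrict_surjective (hG : IsReductive G) (hW : IsLinearizedVariety α) :
    Function.Surjective (α.boundaryRestrict hV) := by
  rintro ⟨b, hb⟩
  obtain ⟨a, rfl⟩ := Ideal.Quotient.mk_surjective b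
  obtain ⟨w, hw, hwa⟩ := α.exists_invariant_sub_mem hG hW (boundaryIdeal V).toIdeal
    (α.boundaryIdeal_stable hV) (a := a) fun g ↦ by
      have := hb g
      exact (Ideal.Quotient.mk_eq_mk_iff_sub_mem _ _).mp this
  exact ⟨⟨w, hw⟩, Subtype.ext ((Ideal.Quotient.mk_eq_mk_iff_sub_mem _ _).mpr hwa)⟩

lemma boundaryRestrict_eq_zero_iff (a : α.invariants) :
    α.boundaryRestrict hV a = 0 ↔ (a : A) ∈ boundaryIdeal V := by
  rw [← Subtype.coe_inj]
  exact Ideal.Quotient.eq_zero_iff_mem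

lemma mem_compl_iff_boundaryIdeal_le (V : (Proj 𝒜).Opens) (x : Proj 𝒜) :
    x ∉ V ↔ boundaryIdeal V ≤ x.asHomogeneousIdeal := by
  have h1 := (ProjectiveSpectrum.zeroLocus_vanishingIdeal_eq_closure 𝒜 ((V : Set (Proj 𝒜))ᶜ)).trans
    V.isOpen.isClosed_compl.closure_eq
  exact iff_of_eq (congrArg (x ∈ ·) h1.symm)

lemma boundaryInclusionDefined (hG : IsReductive G) (hW : IsLinearizedVariety α) :
    α.BoundaryInclusionDefined hV :=
  irrelevant_le_map_of_surjective _ (α.boundaryRestrict_surjective hV hG hW)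

lemma isClosedImmersion_boundaryInclusion (hG : IsReductive G) (hW : IsLinearizedVariety α)
    (h : α.BoundaryInclusionDefined hV) : IsClosedImmersion (α.boundaryInclusion hV h) :=
  isClosedImmersion_proj_map _ (α.boundaryRestrict_surjective hV hG hW) h

lemma mem_range_boundaryInclusion_iff (hG : IsReductive G) (hW : IsLinearizedVariety α)
    (h : α.BoundaryInclusionDefined hV) (y : Proj α.invGrading) :
    y ∈ Set.range (α.boundaryInclusion hV h) ↔
      ∀ a : α.invariants, (a : A) ∈ boundaryIdeal V → a ∈ y.asHomogeneousIdeal := by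
  have := range_proj_map_of_surjective _ (α.boundaryRestrict_surjective hV hG hW) h
  refine (iff_of_eq (congrArg (y ∈ ·) this)).trans ?_
  simp only [Set.mem_ofPred_eq, boundaryRestrict_eq_zero_iff]

lemma range_boundaryInclusion (hG : IsReductive G) (hW : IsLinearizedVariety α)
    (h : α.BoundaryInclusionDefined hV) :
    Set.range (α.boundaryInclusion hV h) =
        α.quotientMap '' (α.semistableLocus.ι ⁻¹' (V : Set (Proj 𝒜))ᶜ) := by
  ext y
  refine (α.mem_range_boundaryInclusion_iff hV hG hW h y).trans ?_
  constructor
  · intro hy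
    obtain ⟨x, hx, rfl⟩ := α.exists_proj_lift hG hW _ (α.boundaryIdeal_stable hV) y hy
    exact ⟨x, (mem_compl_iff_boundaryIdeal_le V x.1).mpr hx, rfl⟩
  · rintro ⟨x, hx, rfl⟩
    have hx' := (mem_compl_iff_boundaryIdeal_le V x.1).mp hx
    exact fun a ha ↦ homogeneousIdeal_le_of_pos (I := (boundaryIdeal V).comap α.invIncl)
      (fun i t hi ht htJ hty ↦
        (projMap_mem_basicOpen_iff α.invIncl hi ht x).mp hty (hx' htJ)) ha

end GradedAction

/-! ### Boundary divisors as irreducible components -/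

section IrreducibleComponents

open TopologicalSpace

lemma isIrreducible_preimage_of_subset_range {X Y : Type*} [TopologicalSpace X]
    [TopologicalSpace Y] {i : Y → X} (hi : Topology.IsInducing i) {Z : Set X} (hZ : IsIrreducible Z)
    (hZi : Z ⊆ Set.range i) : IsIrreducible (i ⁻¹' Z) := by
  refine ⟨hZ.nonempty.preimage' hZi, fun u v hu hv ↦ ?_⟩
  obtain ⟨u, hu', rfl⟩ := hi.isOpen_iff.mp hu
  obtain ⟨v, hv', rfl⟩ := hi.isOpen_iff.mp hv
  rintro ⟨y, hyZ, hyu⟩ ⟨y', hyZ', hyv⟩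
  obtain ⟨z, hzZ, hz⟩ := hZ.2 u v hu' hv' ⟨_, hyZ, hyu⟩ ⟨_, hyZ', hyv⟩
  obtain ⟨w, rfl⟩ := hZi hzZ
  exact ⟨w, hzZ, hz⟩

lemma exists_mem_irreducibleComponents {Y : Type*} [TopologicalSpace Y] {S : Set Y}
    (hS : IsIrreducible S) : ∃ C ∈ irreducibleComponents Y, S ⊆ C := by
  obtain ⟨C, hC, hSC, hmax⟩ := exists_preirreducible S hS.2
  exact ⟨C, ⟨⟨hS.nonempty.mono hSC, hC⟩, fun T hT hCT ↦ (hmax T hT.2 hCT).le⟩, hSC⟩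

variable {X : Scheme.{u}} [IsNoetherian X] [X.IsSeparated] {U : X.Opens}

/-- By purity, the boundary divisors are the maximal irreducible subsets of the complement. -/
lemma mem_boundaryDivisors_iff (hU : IsAffineOpen U) (hd : Dense (U : Set X)) (D : Set X) :
    D ∈ boundaryDivisors (U : Set X) ↔ Maximal (fun S ↦ IsIrreducible S ∧ S ⊆ (U : Set X)ᶜ) D := by
  constructor
  · rintro ⟨Z, rfl, hZ, hZU⟩
    refine ⟨⟨Z.isIrreducible, hZU⟩, fun S ⟨hS, hSU⟩ hZS ↦ ?_⟩
    let T : IrreducibleCloseds X := ⟨closure S, hS.closure, isClosed_closure⟩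
    have hTU : (T : Set X) ⊆ (U : Set X)ᶜ := closure_minimal hSU U.isOpen.isClosed_compl
    have hZT : Z ≤ T := hZS.trans subset_closure
    obtain hlt | heq := hZT.lt_or_eq
    · exfalso
      -- otherwise `T` would be a component of `X` in the complement of `U`, against purity for `T`
      have h0 : Order.coheight T = 0 := by
        have := Order.coheight_add_one_le hlt
        rw [hZ] at this
        exact Order.lt_one_iff.mp (Order.add_one_le_iff_of_not_isMax (by
          rw [isMax_iff_eq_top]; rintro h; rw [h] at this; simp at this) |>.mp this)
      rw [Order.coheight_eq_zero] at h0
      have h1 := coheight_eq_one_of_isAffineOpen hU hd T hTU fun Z' h _ ↦ h0 h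
      rw [Order.coheight_eq_zero.mpr h0] at h1
      exact zero_ne_one h1
    · rw [heq]
      exact subset_closure
  · rintro ⟨⟨hD, hDU⟩, hmax⟩
    have hcl : IsClosed D := by
      have := hmax (y := closure D) ⟨hD.closure, closure_minimal hDU U.isOpen.isClosed_compl⟩
        subset_closure
      exact isClosed_of_closure_subset this
    exact ⟨⟨D, hD, hcl⟩, rfl, coheight_eq_one_of_isAffineOpen hU hd _ hDU
      fun Z' h h' ↦ hmax ⟨Z'.isIrreducible, h'⟩ h, hDU⟩

/-- If `Y` is the complement of `U`, then the boundary divisors with respect to `U` are the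
irreducible components of `Y`. -/
lemma boundaryDivisors_eq_image (hU : IsAffineOpen U) (hd : Dense (U : Set X)) {Y : Type*}
    [TopologicalSpace Y] {i : Y → X} (hi : Topology.IsInducing i)
    (hr : Set.range i = (U : Set X)ᶜ) :
    boundaryDivisors (U : Set X) = (fun C ↦ i '' C) '' irreducibleComponents Y := by
  ext D
  rw [mem_boundaryDivisors_iff hU hd, ← hr]
  constructor
  · rintro ⟨⟨hD, hDr⟩, hmax⟩
    refine ⟨i ⁻¹' D, ⟨isIrreducible_preimage_of_subset_range hi hD hDr, fun S hS hDS ↦ ?_⟩,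
      Set.image_preimage_eq_of_subset hDr⟩
    rw [← Set.image_subset_iff]
    refine hmax ⟨hS.image i hi.continuous.continuousOn, Set.image_subset_range i S⟩ ?_
    rw [← Set.image_preimage_eq_of_subset hDr]
    exact Set.image_mono hDS
  · rintro ⟨C, ⟨hC, hmax⟩, rfl⟩
    refine ⟨⟨hC.image i hi.continuous.continuousOn, Set.image_subset_range i C⟩,
      fun S ⟨hS, hSr⟩ hCS ↦ ?_⟩
    dsimp only at hCS ⊢
    rw [← Set.image_preimage_eq_of_subset hSr]
    exact Set.image_mono (hmax (isIrreducible_preimage_of_subset_range hi hS hSr)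
      (Set.image_subset_iff.mp hCS))

lemma exists_boundaryDivisor (hU : IsAffineOpen U) (hd : Dense (U : Set X)) {x : X} (hx : x ∉ U) :
    ∃ D ∈ boundaryDivisors (U : Set X), x ∈ D := by
  rw [boundaryDivisors_eq_image hU hd (i := ((↑) : ((U : Set X)ᶜ : Set X) → X))
    Topology.IsInducing.subtypeVal Subtype.range_coe]
  obtain ⟨C, hC, hxC⟩ := exists_mem_irreducibleComponents
    (isIrreducible_singleton (x := (⟨x, hx⟩ : ((U : Set X)ᶜ : Set X))))
  exact ⟨_, ⟨C, hC, rfl⟩, _, hxC rfl, rfl⟩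

end IrreducibleComponents

/-! ### The consequence of saturation -/

namespace GradedAction

variable {n : ℕ} {G : Subgroup (GL (Fin n) ℂ)} {A : Type u} [CommRing A] [Algebra ℂ A]
  {𝒜 : ℕ → Submodule ℂ A} [GradedAlgebra 𝒜] (α : GradedAction G 𝒜) {V : (Proj 𝒜).Opens}

/-- The only use of the saturation hypothesis: each point of `V` has an invariant form that is
nonzero there and vanishes on the boundary. Otherwise the point has the same image as a semistable
point of the boundary; that point lies on a boundary divisor, which is saturated. -/
lemma exists_invariant_of_saturated (hG : IsReductive G) (hW : IsLinearizedVariety α)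
    (hVaff : IsAffineOpen V) (hVdense : Dense (V : Set (Proj 𝒜)))
    (hV : α.IsStable V) (hVss : V ≤ α.semistableLocus)
    (hsat : ∀ D ∈ GIT.boundaryDivisors (V : Set (Proj 𝒜)),
      GIT.IsSaturated α.quotientMap (α.semistableLocus.ι ⁻¹' D)) {x : Proj 𝒜} (hx : x ∈ V) :
    ∃ (d : ℕ) (h : α.invariants), 0 < d ∧ h ∈ α.invGrading d ∧ (h : A) ∈ boundaryIdeal V ∧
      x ∈ Proj.basicOpen 𝒜 (h : A) := by
  have := α.isNoetherianRing hW
  have := isNoetherian_proj 𝒜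
  by_contra! H
  let x' : α.semistableLocus := ⟨x, hVss hx⟩
  have hy : (boundaryIdeal V).comap α.invIncl ≤
      ProjectiveSpectrum.asHomogeneousIdeal (𝒜 := α.invGrading) (α.quotientMap x') :=
    homogeneousIdeal_le_of_pos fun i s hi hs hsJ hsx ↦ H i s hi hs hsJ
      ((projMap_mem_basicOpen_iff α.invIncl hi hs x').mp hsx)
  obtain ⟨w, hw, hwx⟩ := α.exists_proj_lift hG hW _ (α.boundaryIdeal_stable hV)
    (α.quotientMap x') fun a ha ↦ hy ha
  obtain ⟨D, hD, hwD⟩ := exists_boundaryDivisor hVaff hVdense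
    ((mem_compl_iff_boundaryIdeal_le V w.1).mpr hw)
  have h1 : x' ∈ α.quotientMap ⁻¹' (α.quotientMap '' (α.semistableLocus.ι ⁻¹' D)) :=
    ⟨w, hwD, hwx⟩
  rw [← hsat D hD] at h1
  obtain ⟨Z, -, -, hDV⟩ := hD
  exact hDV h1 hx

end GradedAction

/-! ### Sections over open subsets of `Proj` -/

section Sections

variable {A : Type u} [CommRing A] {σ : Type u} [SetLike σ A] [AddSubgroupClass σ A]
  {𝒜 : ℕ → σ} [GradedRing 𝒜] {V : (Proj 𝒜).Opens} {d e : ℕ} {z w : A}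

/-- The restriction of sections from `V` to `D₊(z) ⊆ V`, with values in the homogeneous
localization. -/
def toAway (hd : 0 < d) (hz : z ∈ 𝒜 d) (hle : Proj.basicOpen 𝒜 z ≤ V) :
    Γ(Proj 𝒜, V) →+* Away 𝒜 z :=
  ((Proj 𝒜).presheaf.map (homOfLE hle).op ≫ (Proj.basicOpenIsoAway 𝒜 z hz hd).inv).hom

lemma awayToSection_toAway (hd : 0 < d) (hz : z ∈ 𝒜 d) (hle : Proj.basicOpen 𝒜 z ≤ V)
    (b : Γ(Proj 𝒜, V)) : Proj.awayToSection 𝒜 z (toAway hd hz hle b) =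
      (Proj 𝒜).presheaf.map (homOfLE hle).op b := by
  rw [toAway, ← Proj.basicOpenIsoAway_hom 𝒜 z hz hd]
  change ((Proj 𝒜).presheaf.map (homOfLE hle).op ≫ (Proj.basicOpenIsoAway 𝒜 z hz hd).inv ≫
    (Proj.basicOpenIsoAway 𝒜 z hz hd).hom) b = _
  rw [Iso.inv_hom_id, Category.comp_id]

lemma eq_toAway_of_awayToSection_eq (hd : 0 < d) (hz : z ∈ 𝒜 d) (hle : Proj.basicOpen 𝒜 z ≤ V)
    (b : Γ(Proj 𝒜, V)) (a : Away 𝒜 z)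
    (h : Proj.awayToSection 𝒜 z a = (Proj 𝒜).presheaf.map (homOfLE hle).op b) :
    a = toAway hd hz hle b := by
  rw [← awayToSection_toAway hd hz hle b, ← Proj.basicOpenIsoAway_hom 𝒜 z hz hd] at h
  exact (Proj.basicOpenIsoAway 𝒜 z hz hd).commRingCatIsoToRingEquiv.injective h

lemma awayMap_toAway (hd : 0 < d) (hz : z ∈ 𝒜 d) (hle : Proj.basicOpen 𝒜 z ≤ V) (hw : w ∈ 𝒜 e)
    {x : A} (hx : x = z * w) {k : ℕ} (hk : 0 < k) (hxk : x ∈ 𝒜 k)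
    (hle' : Proj.basicOpen 𝒜 x ≤ V) (b : Γ(Proj 𝒜, V)) :
    awayMap 𝒜 hw hx (toAway hd hz hle b) = toAway hk hxk hle' b := by
  refine eq_toAway_of_awayToSection_eq hk hxk hle' b _ ?_
  have h := ConcreteCategory.congr_hom (Proj.awayMap_awayToSection 𝒜 (f := z) hw hx)
    (toAway hd hz hle b)
  refine h.trans ?_
  change (Proj 𝒜).presheaf.map (homOfLE _).op (Proj.awayToSection 𝒜 z (toAway hd hz hle b)) = _
  rw [awayToSection_toAway, ← CommRingCat.comp_apply, ← Functor.map_comp]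
  rfl

lemma toAway_appLE (f : 𝒜 →+*ᵍ 𝒜) (hf : HomogeneousIdeal.irrelevant 𝒜 ≤
      (HomogeneousIdeal.irrelevant 𝒜).map f) (hV : V ≤ Proj.map f hf ⁻¹ᵁ V)
    (hd : 0 < d) (hz : z ∈ 𝒜 d) (hle : Proj.basicOpen 𝒜 z ≤ V)
    (hle' : Proj.basicOpen 𝒜 (f z) ≤ V) (b : Γ(Proj 𝒜, V)) :
    toAway hd (map_mem f hz) hle' ((Proj.map f hf).appLE V V hV b) =
      Away.map f z (toAway hd hz hle b) := by
  symm
  refine eq_toAway_of_awayToSection_eq _ _ _ _ _ ?_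
  have h := ConcreteCategory.congr_hom (Proj.awayToSection_comp_appLE f hf hz)
    (toAway hd hz hle b)
  refine h.symm.trans ?_
  change (Proj.map f hf).appLE _ _ _ (Proj.awayToSection 𝒜 z (toAway hd hz hle b)) = _
  rw [awayToSection_toAway, ← CommRingCat.comp_apply, ← CommRingCat.comp_apply,
    Scheme.Hom.map_appLE, Scheme.Hom.appLE_map]

lemma section_ext_of_toAway {ι : Type*} (d : ι → ℕ) (z : ι → A) (hd : ∀ i, 0 < d i)
    (hz : ∀ i, z i ∈ 𝒜 (d i)) (hle : ∀ i, Proj.basicOpen 𝒜 (z i) ≤ V)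
    (hcov : V ≤ ⨆ i, Proj.basicOpen 𝒜 (z i)) {b b' : Γ(Proj 𝒜, V)}
    (h : ∀ i, toAway (hd i) (hz i) (hle i) b = toAway (hd i) (hz i) (hle i) b') : b = b' := by
  refine (Proj 𝒜).sheaf.eq_of_locally_eq' (fun i ↦ Proj.basicOpen 𝒜 (z i)) V
    (fun i ↦ homOfLE (hle i)) hcov b b' fun i ↦ ?_
  have := congrArg (Proj.awayToSection 𝒜 (z i)) (h i)
  rwa [awayToSection_toAway, awayToSection_toAway] at this

/-- Elements of degree zero as regular functions on `V`. -/
def zeroToSection (V : (Proj 𝒜).Opens) : 𝒜 0 →+* Γ(Proj 𝒜, V) :=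
  (CommRingCat.ofHom (fromZeroRingHom 𝒜 (.powers (1 : A))) ≫ Proj.awayToSection 𝒜 1 ≫
    (Proj 𝒜).presheaf.map (homOfLE (le_top.trans_eq (Proj.basicOpen_one 𝒜).symm)).op).hom

lemma toAway_zeroToSection (hd : 0 < d) (hz : z ∈ 𝒜 d) (hle : Proj.basicOpen 𝒜 z ≤ V)
    (c : 𝒜 0) : toAway hd hz hle (zeroToSection V c) = fromZeroRingHom 𝒜 _ c := by
  symm
  refine eq_toAway_of_awayToSection_eq _ _ _ _ _ ?_
  have h := ConcreteCategory.congr_hom (Proj.awayMap_awayToSection 𝒜 (f := 1) hz (one_mul z).symm)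
    (fromZeroRingHom 𝒜 _ c)
  rw [← awayMap_fromZeroRingHom 𝒜 hz (one_mul z).symm]
  refine h.trans ?_
  rw [zeroToSection]
  change _ = (Proj 𝒜).presheaf.map (homOfLE hle).op ((Proj 𝒜).presheaf.map
    (homOfLE (le_top.trans_eq (Proj.basicOpen_one 𝒜).symm)).op (Proj.awayToSection 𝒜 1 _))
  rw [← CommRingCat.comp_apply, ← Functor.map_comp]
  rfl

end Sections

section

variable {A : Type u} [CommRing A] [Algebra ℂ A] {𝒜 : ℕ → Submodule ℂ A} [GradedAlgebra 𝒜]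

/-- The `ℂ`-algebra structure on `Γ(V)` given by the constants `ℂ → 𝒜 0`. -/
instance sectionAlgebra (V : (Proj 𝒜).Opens) : Algebra ℂ Γ(Proj 𝒜, V) :=
  ((zeroToSection V).comp (algebraMap ℂ (𝒜 0))).toAlgebra

/-- The restriction of sections from `V` to `D₊(z) ⊆ V`, with values in the whole localization
`A_z`. -/
def toLocalization {V : (Proj 𝒜).Opens} {d : ℕ} {z : A} (hd : 0 < d) (hz : z ∈ 𝒜 d)
    (hle : Proj.basicOpen 𝒜 z ≤ V) : Γ(Proj 𝒜, V) →ₐ[ℂ] Localization.Away z where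
  __ := (algebraMap (Away 𝒜 z) (Localization.Away z)).comp (toAway hd hz hle)
  commutes' c := by
    change (toAway hd hz hle (zeroToSection V _)).val = _
    rw [toAway_zeroToSection, IsScalarTower.algebraMap_apply ℂ A (Localization.Away z)]
    rfl

open GradedAction

/-! ### Boundary forms and denominators -/

/-- Homogeneous elements of positive degree that vanish on the complement of `V`. Their `D₊`s
cover `V`. -/
abbrev BoundaryForm (V : (Proj 𝒜).Opens) : Type u :=
  {z : PosHomog 𝒜 // z.2.1 ∈ boundaryIdeal V}

section BoundaryForm

variable {V : (Proj 𝒜).Opens}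

lemma mem_iff_exists_boundaryForm (x : Proj 𝒜) :
    x ∈ V ↔ ∃ z : BoundaryForm V, x ∈ Proj.basicOpen 𝒜 z.1.2.1 := by
  rw [← not_iff_not, mem_compl_iff_boundaryIdeal_le]
  constructor
  · rintro h ⟨z, hz⟩
    exact hz (h z.2)
  · intro h
    exact homogeneousIdeal_le_of_pos fun i s hi hs hsV hsx ↦ h ⟨⟨⟨i, s, hi, hs⟩, hsV⟩, hsx⟩

namespace BoundaryForm

variable (z : BoundaryForm V)

lemma basicOpen_le : Proj.basicOpen 𝒜 z.1.2.1 ≤ V := fun _ hx ↦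
  (mem_iff_exists_boundaryForm _).mpr ⟨z, hx⟩

/-- The restriction of sections from `V` to `D₊(z)`, with values in the homogeneous localization. -/
def away : Γ(Proj 𝒜, V) →+* Away 𝒜 z.1.2.1 := toAway z.1.2.2.1 z.1.2.2.2 z.basicOpen_le

/-- The restriction of sections from `V` to `D₊(z)`, with values in the whole localization `A_z`. -/
def loc : Γ(Proj 𝒜, V) →ₐ[ℂ] Localization.Away z.1.2.1 :=
  toLocalization z.1.2.2.1 z.1.2.2.2 z.basicOpen_le

lemma loc_apply (b : Γ(Proj 𝒜, V)) : z.loc b = (z.away b).val := rfl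

lemma exists_away_eq_mk (b : Γ(Proj 𝒜, V)) : ∃ (k : ℕ) (c : A) (hc : c ∈ 𝒜 (k • z.1.1)),
    z.away b = Away.mk 𝒜 z.1.2.2.2 k c hc := by
  obtain ⟨k, c, hc, h⟩ := (z.away b).mk_surjective _ z.1.2.2.2
  exact ⟨k, c, hc, h.symm⟩

lemma away_algebraMap (c : ℂ) : z.away (algebraMap ℂ Γ(Proj 𝒜, V) c) =
    Away.mk 𝒜 z.1.2.2.2 0 (algebraMap ℂ A c)
      (by rw [zero_smul]; exact SetLike.algebraMap_mem_graded 𝒜 c) := by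
  ext
  rw [← loc_apply, AlgHom.commutes, Away.val_mk,
    IsScalarTower.algebraMap_apply ℂ A (Localization.Away z.1.2.1),
    ← Localization.mk_one_eq_algebraMap, Localization.mk_eq_mk_iff, Localization.r_iff_exists]
  exact ⟨1, by simp⟩

lemma mul_algebraMap_eq_iff {z c y a : A} {k : ℕ} :
    (Localization.mk c ⟨z ^ k, k, rfl⟩ : Localization.Away z) * algebraMap A _ y =
      algebraMap A _ a ↔ ∃ p, z ^ p * (c * y) = z ^ p * (a * z ^ k) := by
  rw [← Localization.mk_one_eq_algebraMap, ← Localization.mk_one_eq_algebraMap,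
    Localization.mk_mul, Localization.mk_eq_mk_iff, Localization.r_iff_exists]
  constructor
  · rintro ⟨⟨_, p, rfl⟩, h⟩
    exact ⟨p, by simpa [mul_comm] using h⟩
  · rintro ⟨p, h⟩
    exact ⟨⟨_, p, rfl⟩, by simpa [mul_comm] using h⟩

lemma loc_mul_eq_iff {b : Γ(Proj 𝒜, V)} {k : ℕ} {c : A} {hc : c ∈ 𝒜 (k • z.1.1)}
    (h : z.away b = Away.mk 𝒜 z.1.2.2.2 k c hc) (y a : A) :
    z.loc b * algebraMap A _ y = algebraMap A _ a ↔
      ∃ p, z.1.2.1 ^ p * (c * y) = z.1.2.1 ^ p * (a * z.1.2.1 ^ k) := by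
  rw [loc_apply, h, Away.val_mk, mul_algebraMap_eq_iff]

lemma ext_of_away {b b' : Γ(Proj 𝒜, V)} (h : ∀ z : BoundaryForm V, z.away b = z.away b') :
    b = b' :=
  section_ext_of_toAway (fun z : BoundaryForm V ↦ z.1.1) (fun z ↦ z.1.2.1) (fun z ↦ z.1.2.2.1)
    (fun z ↦ z.1.2.2.2) basicOpen_le (fun x hx ↦ by
      obtain ⟨z, hz⟩ := (mem_iff_exists_boundaryForm x).mp hx
      exact TopologicalSpace.Opens.mem_iSup.mpr ⟨z, hz⟩) h

end BoundaryForm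

/-- The section `b` is the fraction `a / y`, in the sense that `b * y = a` in `A_z` for all boundary
forms `z`. Neither `y` nor `a` need be homogeneous. -/
def IsFraction (b : Γ(Proj 𝒜, V)) (y a : A) : Prop :=
  ∀ z : BoundaryForm V, z.loc b * algebraMap A _ y = algebraMap A _ a

/-- The ideal of all `y` such that `b * y` comes from `A`. -/
def denominators (b : Γ(Proj 𝒜, V)) : Ideal A where
  carrier := {y | ∃ a, IsFraction b y a}
  zero_mem' := ⟨0, fun z ↦ by simp⟩
  add_mem' := by
    rintro y y' ⟨a, ha⟩ ⟨a', ha'⟩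
    exact ⟨a + a', fun z ↦ by rw [map_add, map_add, mul_add, ha z, ha' z]⟩
  smul_mem' := by
    rintro r y ⟨a, ha⟩
    exact ⟨r * a, fun z ↦ by rw [smul_eq_mul, map_mul, map_mul, mul_left_comm, ha z]⟩

/-- On `D₊(z)` the section `b` is `a / z ^ k`. Then `z ^ (k + 1) * b = z * a` holds everywhere: in a
reduced ring, an element killed by a power of `w * z` is killed by `w * z`. -/
lemma exists_pow_mem_denominators [IsReduced A] (b : Γ(Proj 𝒜, V)) (z : BoundaryForm V) :
    ∃ m, z.1.2.1 ^ m ∈ denominators b := by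
  obtain ⟨k, a, ha, hb⟩ := z.exists_away_eq_mk b
  refine ⟨k + 1, z.1.2.1 * a, fun w ↦ ?_⟩
  obtain ⟨l, c, hc, hb'⟩ := w.exists_away_eq_mk b
  rw [w.loc_mul_eq_iff hb']
  have hzw : w.1.2.1 * z.1.2.1 ∈ boundaryIdeal V := (boundaryIdeal V).toIdeal.mul_mem_left _ z.2
  let zw : BoundaryForm V := ⟨⟨w.1.1 + z.1.1, w.1.2.1 * z.1.2.1,
    Nat.add_pos_left w.1.2.2.1 _, SetLike.mul_mem_graded w.1.2.2.2 z.1.2.2.2⟩, hzw⟩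
  have h1 := awayMap_toAway z.1.2.2.1 z.1.2.2.2 z.basicOpen_le w.1.2.2.2
    (mul_comm w.1.2.1 z.1.2.1) zw.1.2.2.1 zw.1.2.2.2 zw.basicOpen_le b
  have h2 := awayMap_toAway w.1.2.2.1 w.1.2.2.2 w.basicOpen_le z.1.2.2.2
    rfl zw.1.2.2.1 zw.1.2.2.2 zw.basicOpen_le b
  have h3 := h2.trans h1.symm
  change awayMap 𝒜 _ _ (w.away b) = awayMap 𝒜 _ _ (z.away b) at h3
  rw [hb, hb', awayMap_mk, awayMap_mk] at h3
  replace h3 := congrArg HomogeneousLocalization.val h3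
  rw [Away.val_mk, Away.val_mk, Localization.mk_eq_mk_iff, Localization.r_iff_exists] at h3
  obtain ⟨⟨_, p, rfl⟩, h3⟩ := h3
  dsimp only at h3
  generalize w.1.2.1 = w at h3 ⊢
  generalize z.1.2.1 = z at h3 ⊢
  refine ⟨1, ?_⟩
  -- the fractions `c / w ^ l` and `a / z ^ k` agree on `D₊(w * z)`, so this element is nilpotent
  have hnil : (w * z * (z ^ k * c - w ^ l * a)) ^ (p + k + l + 1) = 0 := by
    obtain ⟨e, he⟩ : ∃ e, e = z ^ k * c - w ^ l * a := ⟨_, rfl⟩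
    have h4 : (w * z) ^ p * w ^ k * z ^ l * e = 0 := by
      rw [he]
      linear_combination h3
    rw [← he]
    linear_combination (z ^ k * w ^ l * (w * z) * e ^ (p + k + l)) * h4
  have := pow_eq_zero_iff (by omega) |>.mp hnil
  linear_combination this

end BoundaryForm

/-! ### The representation on regular functions -/

namespace GradedAction

variable {G : Type*} [Group G] (α : GradedAction G 𝒜) {V : (Proj 𝒜).Opens} (hV : α.IsStable V)

lemma act_one : α.act 1 = 𝟙 _ := by
  rw [← Proj.map_id]
  have : α.gradedHom 1 = .id 𝒜 := by
    ext a
    change α.hom 1 a = a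
    simp
  simp only [act, this]

lemma act_mul (g h : G) : α.act (g * h) = α.act g ≫ α.act h := by
  rw [act, act, act, ← Proj.map_comp]
  have : α.gradedHom (g * h) = (α.gradedHom g).comp (α.gradedHom h) := by
    ext a
    change α.hom (g * h) a = α.hom g (α.hom h a)
    simp
  simp only [this]

/-- The action of `G` on the boundary forms of a stable open subset. -/
def actForm (g : G) (z : BoundaryForm V) : BoundaryForm V :=
  ⟨⟨z.1.1, α.hom g z.1.2.1, z.1.2.2.1, α.mem g z.1.2.2.2⟩, α.boundaryIdeal_stable hV g _ z.2⟩

lemma actForm_surjective (g : G) : Function.Surjective (α.actForm hV g) := fun z ↦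
  ⟨α.actForm hV g⁻¹ z, by
    obtain ⟨⟨i, s, hi, hs⟩, hz⟩ := z
    simp only [actForm, α.hom_hom_inv]⟩

lemma actForm_away (g : G) (z : BoundaryForm V) (b : Γ(Proj 𝒜, V)) :
    (α.actForm hV g z).away ((α.act g).appLE V V (hV g) b) =
      Away.map (α.gradedHom g) z.1.2.1 (z.away b) :=
  toAway_appLE (α.gradedHom g) (α.irrelevant_le_map g) (hV g) z.1.2.2.1 z.1.2.2.2 z.basicOpen_le
    (α.actForm hV g z).basicOpen_le b

/-- The representation of `G` on the regular functions on a stable open subset. -/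
def sectionRep : Representation ℂ G Γ(Proj 𝒜, V) where
  toFun g :=
    { toFun := (α.act g).appLE V V (hV g)
      map_add' := map_add _
      map_smul' c b := by
        rw [Algebra.smul_def, map_mul, RingHom.id_apply, Algebra.smul_def]
        congr 1
        refine BoundaryForm.ext_of_away fun w ↦ ?_
        obtain ⟨z, rfl⟩ := α.actForm_surjective hV g w
        rw [actForm_away, BoundaryForm.away_algebraMap, BoundaryForm.away_algebraMap, Away.map_mk]
        congr 1
        exact (α.hom g).commutes c }
  map_one' := by
    ext b
    have : ∀ (φ : Proj 𝒜 ⟶ Proj 𝒜) (_ : φ = 𝟙 _) (h : V ≤ φ ⁻¹ᵁ V), φ.appLE V V h b = b := by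
      rintro _ rfl h
      rw [Scheme.Hom.appLE, Scheme.Hom.id_app]
      exact ConcreteCategory.congr_hom ((Proj 𝒜).presheaf.map_id _) b
    exact this _ α.act_one _
  map_mul' g h := by
    ext b
    change (α.act (g * h)).appLE V V (hV _) b = (α.act g).appLE V V (hV g)
      ((α.act h).appLE V V (hV h) b)
    rw [← CommRingCat.comp_apply, Scheme.Hom.appLE_comp_appLE]
    have : ∀ (φ ψ : Proj 𝒜 ⟶ Proj 𝒜) (_ : φ = ψ) (h : V ≤ φ ⁻¹ᵁ V) (h' : V ≤ ψ ⁻¹ᵁ V),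
        φ.appLE V V h b = ψ.appLE V V h' b := by
      rintro _ _ rfl h h'
      rfl
    exact this _ _ (α.act_mul g h) _ _

lemma sectionRep_apply (g : G) (b : Γ(Proj 𝒜, V)) :
    α.sectionRep hV g b = (α.act g).appLE V V (hV g) b := rfl

lemma isFraction_sectionRep {b : Γ(Proj 𝒜, V)} {y a : A} (h : IsFraction b y a) (g : G) :
    IsFraction (α.sectionRep hV g b) (α.hom g y) (α.hom g a) := by
  intro w
  obtain ⟨z, rfl⟩ := α.actForm_surjective hV g w
  obtain ⟨k, c, hc, hb⟩ := z.exists_away_eq_mk b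
  have h1 : (α.actForm hV g z).away (α.sectionRep hV g b) =
      Away.mk 𝒜 (α.actForm hV g z).1.2.2.2 k (α.hom g c) (α.mem g hc) := by
    rw [sectionRep_apply, actForm_away, hb]
    exact Away.map_mk ..
  obtain ⟨p, hp⟩ := (z.loc_mul_eq_iff hb y a).mp (h z)
  refine (BoundaryForm.loc_mul_eq_iff _ h1 _ _).mpr ⟨p, ?_⟩
  simpa using! congrArg (α.hom g) hp

end GradedAction

end

/-! ### Rationality of the action on regular functions -/

namespace GradedAction

variable {n : ℕ} {G : Subgroup (GL (Fin n) ℂ)} {A : Type u} [CommRing A] [Algebra ℂ A]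
  {𝒜 : ℕ → Submodule ℂ A} [GradedAlgebra 𝒜] (α : GradedAction G 𝒜) {V : (Proj 𝒜).Opens}
  (hV : α.IsStable V)

/-- The ideal generated by the boundary forms of `V`. -/
def boundaryFormIdeal (V : (Proj 𝒜).Opens) : Ideal A :=
  Ideal.span (Set.range fun z : BoundaryForm V ↦ z.1.2.1)

lemma hom_mem_boundaryFormIdeal_pow (hV : α.IsStable V) (N : ℕ) (g : G) {a : A}
    (ha : a ∈ boundaryFormIdeal V ^ N) :
    α.hom g a ∈ boundaryFormIdeal V ^ N := by
  have h1 : (boundaryFormIdeal V).map (α.hom g : A →+* A) ≤ boundaryFormIdeal V := by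
    rw [boundaryFormIdeal, Ideal.map_span, Ideal.span_le]
    rintro _ ⟨_, ⟨z, rfl⟩, rfl⟩
    exact Ideal.subset_span ⟨α.actForm hV g z, rfl⟩
  have h2 := Ideal.pow_right_mono h1 N
  rw [← Ideal.map_pow] at h2
  exact h2 (Ideal.mem_map_of_mem (α.hom g : A →+* A) ha)

lemma exists_boundaryFormIdeal_pow_le (hW : IsLinearizedVariety α) (b : Γ(Proj 𝒜, V)) :
    ∃ N, boundaryFormIdeal V ^ N ≤ denominators b := by
  have := α.isNoetherianRing hW
  have := hW.reduced
  refine Ideal.exists_pow_le_of_le_radical_of_fg ?_ (IsNoetherian.noetherian _)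
  rw [boundaryFormIdeal, Ideal.span_le]
  rintro _ ⟨z, rfl⟩
  exact exists_pow_mem_denominators b z

/-- Let `b * y = a`, with `y` and `a` in `A`. Then `(g • b) * (g • y) = g • a` depends regularly on
`g`, as `A` is a rational representation. Expanding `F` in such denominators `y` with regular
coefficients gives the claim. -/
lemma loc_sectionRep_mul_mem_regularMaps (hW : IsLinearizedVariety α) {b : Γ(Proj 𝒜, V)}
    {Q : Submodule ℂ A} (hQ : Q ≤ (denominators b).restrictScalars ℂ) (z : BoundaryForm V)
    {F : G → Q} (hF : F ∈ regularMaps G Q) :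
    (fun g ↦ z.loc (α.sectionRep hV g b) * algebraMap A _ (α.hom g (F g⁻¹))) ∈
      regularMaps G (Localization.Away z.1.2.1) := by
  induction hF using regularMaps_induction with
  | smul c hc y =>
    obtain ⟨a, ha⟩ := hQ y.2
    have h1 : (fun g ↦ z.loc (α.sectionRep hV g b) *
        algebraMap A (Localization.Away z.1.2.1) (α.hom g ((c g⁻¹ • y : Q) : A))) =
        fun g ↦ c g⁻¹ • Algebra.linearMap A (Localization.Away z.1.2.1) (α.hom g a) := by
      ext g
      have := α.isFraction_sectionRep hV ha g z
      simp only [Submodule.coe_smul, map_smul, Algebra.linearMap_apply]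
      rw [← this]
      simp [Algebra.smul_def, IsScalarTower.algebraMap_apply ℂ A (Localization.Away z.1.2.1)]
      ring
    rw [h1]
    refine bilin_mem_regularMaps (LinearMap.lsmul ℂ (Localization.Away z.1.2.1))
      (F := fun g ↦ c g⁻¹) (F' := fun g ↦ Algebra.linearMap A _ (α.hom g a)) ?_ ?_
    · simpa using smul_const_mem_regularMaps (comp_inv_mem_regularFunctions hc) (1 : ℂ)
    · exact comp_mem_regularMaps
        ((Algebra.linearMap A (Localization.Away z.1.2.1)).restrictScalars ℂ)
        (α.isRationalVector_fullRep hW a)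
  | add F F' _ _ h h' =>
    convert add_mem h h' using 1
    ext g
    simp [mul_add]

/-- The action on the regular functions on an affine stable open subset is rational. In
`loc_sectionRep_mul_mem_regularMaps` take `F g = g • z ^ N` for a boundary form `z`: then the second
factor is the unit `z ^ N` for all `g`, and finitely many `z` suffice to detect sections. -/
lemma isRationalVector_sectionRep (hW : IsLinearizedVariety α) (hVaff : IsAffineOpen V)
    (b : Γ(Proj 𝒜, V)) : IsRationalVector (α.sectionRep hV) b := by
  obtain ⟨N, hN⟩ := α.exists_boundaryFormIdeal_pow_le hW b
  have key : ∀ z : BoundaryForm V, (fun g ↦ z.loc (α.sectionRep hV g b)) ∈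
      regularMaps G (Localization.Away z.1.2.1) := fun z ↦ by
    have hzN : z.1.2.1 ^ N ∈ boundaryFormIdeal V ^ N :=
      Ideal.pow_mem_pow (Ideal.subset_span (Set.mem_range_self z)) N
    let F : G → ((boundaryFormIdeal V ^ N).restrictScalars ℂ : Submodule ℂ A) := fun g ↦
      ⟨α.hom g (z.1.2.1 ^ N), α.hom_mem_boundaryFormIdeal_pow hV N g hzN⟩
    have hF : F ∈ regularMaps G _ := mem_regularMaps_of_comp_injective (Submodule.subtype _)
      (Submodule.injective_subtype _) (α.isRationalVector_fullRep hW _)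
    have h1 := α.loc_sectionRep_mul_mem_regularMaps hV hW (b := b) hN z hF
    have hu : IsUnit (algebraMap A (Localization.Away z.1.2.1) (z.1.2.1 ^ N)) := by
      rw [map_pow]
      exact (IsLocalization.Away.algebraMap_isUnit z.1.2.1).pow N
    obtain ⟨v, hv⟩ := hu.exists_left_inv
    have h2 := comp_mem_regularMaps (LinearMap.mulLeft ℂ v) h1
    convert h2 using 2 with g
    simp only [F, α.hom_hom_inv, LinearMap.mulLeft_apply]
    rw [mul_left_comm, hv, mul_one]
  obtain ⟨t, ht⟩ := hVaff.isCompact.elim_finite_subcover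
    (fun z : BoundaryForm V ↦ (Proj.basicOpen 𝒜 z.1.2.1 : Set (Proj 𝒜)))
    (fun z ↦ (Proj.basicOpen 𝒜 z.1.2.1).isOpen) fun x hx ↦ by
      obtain ⟨z, hz⟩ := (mem_iff_exists_boundaryForm x).mp hx
      exact Set.mem_iUnion.mpr ⟨z, hz⟩
  refine mem_regularMaps_of_comp_injective (N := ∀ z : t, Localization.Away z.1.1.2.1)
    (LinearMap.pi fun z ↦ z.1.loc.toLinearMap) ?_ (pi_mem_regularMaps fun z ↦ key z.1)
  intro b b' h
  refine section_ext_of_toAway (fun z : t ↦ z.1.1.1) (fun z ↦ z.1.1.2.1) (fun z ↦ z.1.1.2.2.1)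
    (fun z ↦ z.1.1.2.2.2) (fun z ↦ z.1.basicOpen_le) (fun x hx ↦ ?_) fun z ↦ ?_
  · obtain ⟨z, hz, hxz⟩ := Set.mem_iUnion₂.mp (ht hx)
    exact TopologicalSpace.Opens.mem_iSup.mpr ⟨⟨z, hz⟩, hxz⟩
  · exact HomogeneousLocalization.val_injective _ (congrFun h z)

end GradedAction

/-! ### Pull-back of sections along maps of `Proj`s -/

section ProjMapSections

lemma appLE_eq_of_eq {X Y : Scheme.{u}} {f g : X ⟶ Y} (hfg : f = g) {U : Y.Opens} {V : X.Opens}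
    (hf : V ≤ f ⁻¹ᵁ U) (hg : V ≤ g ⁻¹ᵁ U) : f.appLE U V hf = g.appLE U V hg := by
  subst hfg
  rfl

lemma top_le_preimage_top {X Y : Scheme.{u}} (f : X ⟶ Y) : ⊤ ≤ f ⁻¹ᵁ ⊤ := le_top

lemma ι_appLE_top {X : Scheme.{u}} (D : X.Opens) (h : ⊤ ≤ D.ι ⁻¹ᵁ D) :
    D.ι.appLE D ⊤ h = D.topIso.inv := by
  simp only [Scheme.Opens.ι_appLE, Scheme.Opens.topIso_inv]
  rfl

lemma topIso_hom_map {X : Scheme.{u}} {D V : X.Opens} (h : D ≤ V) :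
    V.topIso.hom ≫ X.presheaf.map (homOfLE h).op =
      (X.homOfLE h).appLE ⊤ ⊤ (top_le_preimage_top _) ≫ D.topIso.hom := by
  rw [← Iso.comp_inv_eq, Category.assoc, ← Iso.eq_inv_comp, ← ι_appLE_top D (by simp),
    ← ι_appLE_top V (by simp), Scheme.Hom.map_appLE, Scheme.Hom.appLE_comp_appLE]
  exact appLE_eq_of_eq (Scheme.homOfLE_ι X h).symm _ _

variable {A B : Type u} [CommRing A] [CommRing B] {σ τ : Type u} [SetLike σ A]
  [AddSubgroupClass σ A] [SetLike τ B] [AddSubgroupClass τ B] {𝒜 : ℕ → σ} {ℬ : ℕ → τ}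
  [GradedRing 𝒜] [GradedRing ℬ]

lemma basicOpenToSpec_awayι {d : ℕ} {s : A} (hd : 0 < d) (hs : s ∈ 𝒜 d) :
    Proj.basicOpenToSpec 𝒜 s ≫ Proj.awayι 𝒜 s hs hd = (Proj.basicOpen 𝒜 s).ι := by
  rw [Proj.awayι, ← Proj.basicOpenIsoSpec_hom 𝒜 s hs hd, Iso.hom_inv_id_assoc]

lemma basicOpenToSpec_appLE_top {d : ℕ} {s : A} (hd : 0 < d) (hs : s ∈ 𝒜 d) :
    (Proj.basicOpenToSpec 𝒜 s).appLE ⊤ ⊤ (top_le_preimage_top _) =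
      (Scheme.ΓSpecIso (.of (Away 𝒜 s))).hom ≫
      (Proj.basicOpenIsoAway 𝒜 s hs hd).hom ≫ (Proj.basicOpen 𝒜 s).topIso.inv := by
  rw [Proj.basicOpenIsoAway_hom 𝒜 s hs hd]
  exact (Scheme.Hom.app_eq_appLE _).symm.trans (Proj.basicOpenToSpec_app_top 𝒜 s)

lemma specMap_appLE_top {R S : CommRingCat.{u}} (φ : R ⟶ S) :
    (Spec.map φ).appLE ⊤ ⊤ (top_le_preimage_top _) =
      (Scheme.ΓSpecIso R).hom ≫ φ ≫ (Scheme.ΓSpecIso S).inv := by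
  rw [← Category.assoc, Iso.eq_comp_inv, ← Scheme.ΓSpecIso_naturality]
  congr 1

lemma awayι_appLE {d : ℕ} {s : A} (hd : 0 < d) (hs : s ∈ 𝒜 d)
    (h : ⊤ ≤ Proj.awayι 𝒜 s hs hd ⁻¹ᵁ Proj.basicOpen 𝒜 s) :
    (Proj.awayι 𝒜 s hs hd).appLE _ ⊤ h =
      (Proj.basicOpenIsoAway 𝒜 s hs hd).inv ≫ (Scheme.ΓSpecIso (.of (Away 𝒜 s))).inv := by
  have h1 : (Proj.awayι 𝒜 s hs hd).appLE _ ⊤ h ≫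
      (Proj.basicOpenToSpec 𝒜 s).appLE ⊤ ⊤ (top_le_preimage_top _) =
      (Proj.basicOpen 𝒜 s).topIso.inv := by
    rw [Scheme.Hom.appLE_comp_appLE, ← ι_appLE_top _ (by simp)]
    exact appLE_eq_of_eq (basicOpenToSpec_awayι hd hs) _ _
  rw [basicOpenToSpec_appLE_top hd hs] at h1
  rw [Iso.eq_comp_inv, ← Iso.comp_hom_eq_id, ← cancel_mono (Proj.basicOpen 𝒜 s).topIso.inv]
  rw [Category.id_comp, Category.assoc, Category.assoc]
  exact h1

variable (f : 𝒜 →+*ᵍ ℬ) {V : (Proj ℬ).Opens} {Y : (Proj 𝒜).Opens}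

/-- The pull-back of sections along the morphism from `V` to `Y` induced by `f : 𝒜 → ℬ`. -/
def projMapSections (hV : V ≤ projMapDomain f)
    (hVY : ⊤ ≤ ((Proj ℬ).homOfLE hV ≫ projMap f) ⁻¹ᵁ Y) : Γ(Proj 𝒜, Y) ⟶ Γ(Proj ℬ, V) :=
  ((Proj ℬ).homOfLE hV ≫ projMap f).appLE Y ⊤ hVY ≫ V.topIso.hom

/-- On `D₊(s)` the pull-back of sections is the map of homogeneous localizations. -/
lemma toAway_projMapSections (hV : V ≤ projMapDomain f)
    (hVY : ⊤ ≤ ((Proj ℬ).homOfLE hV ≫ projMap f) ⁻¹ᵁ Y) {d : ℕ} {s : A} (hd : 0 < d)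
    (hs : s ∈ 𝒜 d) (hY : Proj.basicOpen 𝒜 s ≤ Y) (hsV : Proj.basicOpen ℬ (f s) ≤ V)
    (b : Γ(Proj 𝒜, Y)) :
    toAway hd (map_mem f hs) hsV (projMapSections f hV hVY b) =
      Away.map f s (toAway hd hs hY b) := by
  symm
  refine eq_toAway_of_awayToSection_eq _ _ _ _ _ ?_
  let s' : PosHomog 𝒜 := ⟨d, s, hd, hs⟩
  have hD : ⊤ ≤ Proj.awayι 𝒜 s hs hd ⁻¹ᵁ Proj.basicOpen 𝒜 s := by
    rw [← Proj.opensRange_awayι 𝒜 s hs hd]; simp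
  have h1 : (Proj ℬ).homOfLE hsV ≫ (Proj ℬ).homOfLE hV ≫ projMap f = projMapPiece f s' := by
    rw [← homOfLE_projMap f s', Scheme.homOfLE_homOfLE_assoc]
  have hY' : ⊤ ≤ projMapPiece f s' ⁻¹ᵁ Y := fun x _ ↦ by
    have : projMapPiece f s' x ∈ Y := by
      rw [← h1]
      exact hVY (x := (Proj ℬ).homOfLE hsV x) trivial
    exact this
  have h2 : projMapSections f hV hVY ≫ (Proj ℬ).presheaf.map (homOfLE hsV).op =
      (Proj 𝒜).presheaf.map (homOfLE hY).op ≫ (Proj.basicOpenIsoAway 𝒜 s hs hd).inv ≫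
        CommRingCat.ofHom (Away.map f s) ≫ Proj.awayToSection ℬ (f s) := by
    rw [projMapSections, Category.assoc, topIso_hom_map, Scheme.Hom.appLE_comp_appLE_assoc,
      ← Iso.eq_comp_inv]
    have h3 : (projMapPiece f s').appLE Y ⊤ hY' =
        (Proj 𝒜).presheaf.map (homOfLE hY).op ≫ (Proj.awayι 𝒜 s hs hd).appLE _ ⊤ hD ≫
        (Spec.map (CommRingCat.ofHom (Away.map f s))).appLE ⊤ ⊤ (top_le_preimage_top _) ≫
        (Proj.basicOpenToSpec ℬ (f s)).appLE ⊤ ⊤ (top_le_preimage_top _) := by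
      rw [Scheme.Hom.map_appLE_assoc, Scheme.Hom.appLE_comp_appLE, Scheme.Hom.appLE_comp_appLE]
      exact appLE_eq_of_eq (Category.assoc _ _ _).symm _ _
    refine (appLE_eq_of_eq h1 _ hY').trans (h3.trans ?_)
    rw [awayι_appLE, basicOpenToSpec_appLE_top hd (map_mem f hs), specMap_appLE_top,
      ← Proj.basicOpenIsoAway_hom ℬ (f s) (map_mem f hs) hd]
    simp only [Category.assoc, Iso.inv_hom_id_assoc]
  exact (ConcreteCategory.congr_hom h2 b).symm

end ProjMapSections

/-! ### Invariant functions as functions on the quotient -/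

lemma basicOpen_appLE {X Y : Scheme.{u}} (f : X ⟶ Y) {U : Y.Opens} {V : X.Opens}
    (h : V ≤ f ⁻¹ᵁ U) (s : Γ(Y, U)) :
    X.basicOpen (f.appLE U V h s) = V ⊓ f ⁻¹ᵁ Y.basicOpen s := by
  rw [Scheme.preimage_basicOpen, Scheme.Hom.appLE]
  exact Scheme.basicOpen_res _ _ _

lemma map_eq_map_of_eq {X : Scheme.{u}} {U U' D O : X.Opens} (e : D = O) (hD : D ≤ U)
    (hD' : D ≤ U') (hO : O ≤ U) (hO' : O ≤ U') {s : Γ(X, U)} {s' : Γ(X, U')}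
    (h : X.presheaf.map (homOfLE hD).op s = X.presheaf.map (homOfLE hD').op s') :
    X.presheaf.map (homOfLE hO).op s = X.presheaf.map (homOfLE hO').op s' := by
  subst e
  exact h

lemma away_mk_succ {A σ : Type*} [CommRing A] [SetLike σ A] [AddSubgroupClass σ A] {𝒜 : ℕ → σ}
    [GradedRing 𝒜] {d k : ℕ} {z c : A} (hz : z ∈ 𝒜 d) (hc : c ∈ 𝒜 (k • d))
    (hzc : z * c ∈ 𝒜 ((k + 1) • d)) : Away.mk 𝒜 hz (k + 1) (z * c) hzc = Away.mk 𝒜 hz k c hc := by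
  ext
  rw [Away.val_mk, Away.val_mk, Localization.mk_eq_mk_iff, Localization.r_iff_exists]
  refine ⟨1, ?_⟩
  dsimp only
  ring

namespace GradedAction

variable {G : Type*} [Group G] {A : Type u} [CommRing A] [Algebra ℂ A]
  {𝒜 : ℕ → Submodule ℂ A} [GradedAlgebra 𝒜] (α : GradedAction G 𝒜) {V : (Proj 𝒜).Opens}

/-- Homogeneous invariants of positive degree that vanish on the complement of `V`. -/
abbrev InvForm (V : (Proj 𝒜).Opens) : Type u :=
  {h : PosHomog α.invGrading // (h.2.1 : A) ∈ boundaryIdeal V}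

variable {α} in
/-- An invariant form as a boundary form. -/
def InvForm.toBoundaryForm (h : α.InvForm V) : BoundaryForm V :=
  ⟨⟨h.1.1, h.1.2.1, h.1.2.2.1, h.1.2.2.2⟩, h.2⟩

/-- The open subset of the GIT quotient at whose points some invariant form vanishing on the
boundary is nonzero. -/
def quotientOpen (V : (Proj 𝒜).Opens) : (Proj α.invGrading).Opens :=
  ⨆ h : α.InvForm V, Proj.basicOpen α.invGrading h.1.2.1

variable {α} in
lemma InvForm.basicOpen_le (h : α.InvForm V) :
    Proj.basicOpen α.invGrading h.1.2.1 ≤ α.quotientOpen V :=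
  le_iSup (fun h : α.InvForm V ↦ Proj.basicOpen α.invGrading h.1.2.1) h

lemma mem_quotientOpen {y : Proj α.invGrading} :
    y ∈ α.quotientOpen V ↔ ∃ h : α.InvForm V, y ∈ Proj.basicOpen α.invGrading h.1.2.1 :=
  TopologicalSpace.Opens.mem_iSup

lemma mem_basicOpen_invForm (h : α.InvForm V) (x : α.semistableLocus) :
    α.quotientMap x ∈ Proj.basicOpen α.invGrading h.1.2.1 ↔
      x.1 ∈ Proj.basicOpen 𝒜 (h.1.2.1 : A) :=
  projMap_mem_basicOpen_iff α.invIncl h.1.2.2.1 h.1.2.2.2 x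

lemma notMem_quotientOpen_iff {y : Proj α.invGrading} : y ∉ α.quotientOpen V ↔
    ∀ a : α.invariants, (a : A) ∈ boundaryIdeal V → a ∈ y.asHomogeneousIdeal := by
  rw [mem_quotientOpen]
  constructor
  · intro H a ha
    exact homogeneousIdeal_le_of_pos (I := (boundaryIdeal V).comap α.invIncl)
      (fun i t hi ht htJ hty ↦ H ⟨⟨⟨i, t, hi, ht⟩, htJ⟩, hty⟩) ha
  · rintro H ⟨h, hy⟩
    exact hy (H _ h.2)

/-- The invariant forms that vanish on the boundary have no common zero in `V`. Then `V` is the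
preimage of `quotientOpen V`, see `mem_quotientOpen_iff`. -/
def IsCoveredByInvForms (V : (Proj 𝒜).Opens) : Prop :=
  ∀ x ∈ V, ∃ h : α.InvForm V, x ∈ Proj.basicOpen 𝒜 (h.1.2.1 : A)

variable {α}

namespace IsCoveredByInvForms

lemma mem_quotientOpen_iff (hc : α.IsCoveredByInvForms V) (x : α.semistableLocus) :
    α.quotientMap x ∈ α.quotientOpen V ↔ x.1 ∈ V := by
  refine α.mem_quotientOpen.trans ⟨?_, fun hx ↦ ?_⟩
  · rintro ⟨h, hx⟩
    exact h.toBoundaryForm.basicOpen_le ((α.mem_basicOpen_invForm h x).mp hx)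
  · obtain ⟨h, hxh⟩ := hc x.1 hx
    exact ⟨h, (α.mem_basicOpen_invForm h x).mpr hxh⟩

variable (hc : α.IsCoveredByInvForms V) (hVss : V ≤ α.semistableLocus)

lemma le_preimage (hc : α.IsCoveredByInvForms V) (hVss : V ≤ α.semistableLocus) :
    ⊤ ≤ ((Proj 𝒜).homOfLE hVss ≫ projMap α.invIncl) ⁻¹ᵁ α.quotientOpen V := fun x _ ↦ by
  have := (hc.mem_quotientOpen_iff ((Proj 𝒜).homOfLE hVss x)).mpr
    ((Scheme.homOfLE_apply hVss x).symm ▸ x.2)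
  exact this

/-- The pull-back of functions from `quotientOpen V` to `V`. -/
def sectionsMap : Γ(Proj α.invGrading, α.quotientOpen V) ⟶ Γ(Proj 𝒜, V) :=
  projMapSections α.invIncl hVss (hc.le_preimage hVss)

/-- The restriction of functions from `quotientOpen V` to `D₊(h)`. -/
def _root_.GIT.GradedAction.InvForm.away (h : α.InvForm V) :
    Γ(Proj α.invGrading, α.quotientOpen V) →+* Away α.invGrading h.1.2.1 :=
  toAway h.1.2.2.1 h.1.2.2.2 h.basicOpen_le

lemma away_sectionsMap (h : α.InvForm V) (s : Γ(Proj α.invGrading, α.quotientOpen V)) :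
    h.toBoundaryForm.away (hc.sectionsMap hVss s) = Away.map α.invIncl h.1.2.1 (h.away s) :=
  toAway_projMapSections α.invIncl hVss (hc.le_preimage hVss) h.1.2.2.1 h.1.2.2.2 h.basicOpen_le
    h.toBoundaryForm.basicOpen_le s

lemma _root_.GIT.GradedAction.away_map_invIncl_injective {d : ℕ} {h : α.invariants}
    (hd : h ∈ α.invGrading d) : Function.Injective (Away.map α.invIncl h) := by
  intro t t' htt
  obtain ⟨k, a, ha, rfl⟩ := t.mk_surjective _ hd
  obtain ⟨l, a', ha', rfl⟩ := t'.mk_surjective _ hd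
  rw [Away.map_mk, Away.map_mk] at htt
  replace htt := congrArg HomogeneousLocalization.val htt
  rw [Away.val_mk, Away.val_mk, Localization.mk_eq_mk_iff, Localization.r_iff_exists] at htt
  obtain ⟨⟨_, p, rfl⟩, htt⟩ := htt
  ext
  rw [Away.val_mk, Away.val_mk, Localization.mk_eq_mk_iff, Localization.r_iff_exists]
  exact ⟨⟨_, p, rfl⟩, Subtype.ext htt⟩

lemma ext_of_away (hc : α.IsCoveredByInvForms V) {b b' : Γ(Proj 𝒜, V)}
    (h : ∀ h : α.InvForm V, h.toBoundaryForm.away b = h.toBoundaryForm.away b') : b = b' :=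
  section_ext_of_toAway (fun h : α.InvForm V ↦ h.1.1) (fun h ↦ (h.1.2.1 : A)) (fun h ↦ h.1.2.2.1)
    (fun h ↦ h.1.2.2.2) (fun h ↦ h.toBoundaryForm.basicOpen_le) (fun x hx ↦ by
      obtain ⟨h, hx⟩ := hc x hx
      exact TopologicalSpace.Opens.mem_iSup.mpr ⟨h, hx⟩) h

lemma sectionsMap_injective : Function.Injective (hc.sectionsMap hVss) := by
  intro s s' hs
  refine section_ext_of_toAway (fun h : α.InvForm V ↦ h.1.1) (fun h ↦ h.1.2.1)
    (fun h ↦ h.1.2.2.1) (fun h ↦ h.1.2.2.2) (fun h ↦ h.basicOpen_le) le_rfl fun h ↦ ?_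
  refine away_map_invIncl_injective h.1.2.2.2 ?_
  have h1 := hc.away_sectionsMap hVss h s
  rw [hs] at h1
  exact h1.symm.trans (hc.away_sectionsMap hVss h s')

variable (hV : α.IsStable V)

lemma actForm_toBoundaryForm (g : G) (h : α.InvForm V) :
    α.actForm hV g h.toBoundaryForm = h.toBoundaryForm := by
  obtain ⟨⟨i, s, hi, hs⟩, hz⟩ := h
  simp only [actForm, InvForm.toBoundaryForm, s.2 g]

/-- The action on fractions with an invariant denominator is that on the numerators. -/
lemma actForm_away_mk (g : G) (z : BoundaryForm V) (hz : α.actForm hV g z = z)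
    {b : Γ(Proj 𝒜, V)} {k : ℕ} {c : A}
    {hc : c ∈ 𝒜 (k • z.1.1)} (hb : z.away b = Away.mk 𝒜 z.1.2.2.2 k c hc) :
    z.away ((α.act g).appLE V V (hV g) b) = Away.mk 𝒜 z.1.2.2.2 k (α.hom g c) (α.mem g hc) := by
  have h1 := α.actForm_away hV g z b
  rw [hb, Away.map_mk] at h1
  have h2 : ∀ w : BoundaryForm V, w = α.actForm hV g z → ∀ hw : (α.hom g c) ∈ 𝒜 (k • w.1.1),
      w.away ((α.act g).appLE V V (hV g) b) = Away.mk 𝒜 w.1.2.2.2 k (α.hom g c) hw := by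
    rintro _ rfl _
    exact h1
  exact h2 z hz.symm _

lemma sectionsMap_mem_invariantSections (s : Γ(Proj α.invGrading, α.quotientOpen V)) :
    hc.sectionsMap hVss s ∈ invariantSections α.act hV := by
  intro g
  refine hc.ext_of_away fun h ↦ ?_
  obtain ⟨k, a, ha, hs⟩ := (h.away s).mk_surjective _ h.1.2.2.2
  have h1 := hc.away_sectionsMap hVss h s
  rw [← hs, Away.map_mk] at h1
  refine (actForm_away_mk hV g h.toBoundaryForm (actForm_toBoundaryForm hV g h) h1).trans ?_
  refine Eq.trans ?_ h1.symm
  congr 1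
  exact a.2 g

/-- Functions `t h` on the open subsets `D₊(h)` of the quotient that pull back to restrictions of
one section `b` are compatible with restriction from `D₊(h)` to `D₊(h * r)`. -/
lemma map_awayToSection {b : Γ(Proj 𝒜, V)} {t : ∀ h : α.InvForm V, Away α.invGrading h.1.2.1}
    (ht : ∀ h : α.InvForm V, Away.map α.invIncl h.1.2.1 (t h) = h.toBoundaryForm.away b)
    (h h' : α.InvForm V) {e : ℕ} {r : α.invariants} (hr : r ∈ α.invGrading e)
    (hh' : h'.1.2.1 = h.1.2.1 * r)
    (hle : Proj.basicOpen α.invGrading h'.1.2.1 ≤ Proj.basicOpen α.invGrading h.1.2.1) :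
    (Proj α.invGrading).presheaf.map (homOfLE hle).op
      (Proj.awayToSection α.invGrading h.1.2.1 (t h)) =
        Proj.awayToSection α.invGrading h'.1.2.1 (t h') := by
  refine (ConcreteCategory.congr_hom (Proj.awayMap_awayToSection α.invGrading hr hh')
    (t h)).symm.trans ?_
  change Proj.awayToSection α.invGrading h'.1.2.1 (awayMap α.invGrading hr hh' (t h)) = _
  congr 1
  refine away_map_invIncl_injective h'.1.2.2.2 ?_
  rw [ht]
  have h1 := awayMap_toAway h.1.2.2.1 (z := (h.1.2.1 : A)) h.1.2.2.2
    h.toBoundaryForm.basicOpen_le (w := (r : A)) hr (congrArg Subtype.val hh') h'.1.2.2.1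
    h'.1.2.2.2 h'.toBoundaryForm.basicOpen_le b
  refine Eq.trans ?_ h1
  have h2 := ht h
  refine Eq.trans ?_ (congrArg (awayMap 𝒜 (g := (r : A)) hr (congrArg Subtype.val hh')) h2)
  obtain ⟨k, a, ha, hta⟩ := (t h).mk_surjective _ h.1.2.2.2
  rw [← hta, awayMap_mk, Away.map_mk, Away.map_mk]
  refine Eq.trans ?_ (awayMap_mk ..).symm
  rfl

/-- An invariant function on `V` is `c / h ^ k` on `D₊(h)`. As `A` is reduced, `h * c` is invariant,
so the function descends to `D₊(h)` in the quotient as `h * c / h ^ (k + 1)`; the descended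
functions glue. -/
lemma exists_sectionsMap_eq [IsReduced A] {b : Γ(Proj 𝒜, V)} (hb : b ∈ invariantSections α.act hV) :
    ∃ s, hc.sectionsMap hVss s = b := by
  have hex : ∀ h : α.InvForm V, ∃ t : Away α.invGrading h.1.2.1,
      Away.map α.invIncl h.1.2.1 t = h.toBoundaryForm.away b := by
    intro h
    obtain ⟨k, c, hck, hbc⟩ := h.toBoundaryForm.exists_away_eq_mk b
    have hinv : (h.1.2.1 : A) * c ∈ α.invariants := by
      intro g
      have h1 := actForm_away_mk hV g h.toBoundaryForm (actForm_toBoundaryForm hV g h) hbc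
      rw [hb g, hbc] at h1
      replace h1 := congrArg HomogeneousLocalization.val h1
      rw [Away.val_mk, Away.val_mk, Localization.mk_eq_mk_iff, Localization.r_iff_exists] at h1
      obtain ⟨⟨_, p, rfl⟩, h1⟩ := h1
      dsimp only [InvForm.toBoundaryForm] at h1
      rw [map_mul, h.1.2.1.2 g]
      -- `c` and `g • c` agree up to multiplication by a power of the form `h`
      have hnil : ((h.1.2.1 : A) * (α.hom g c - c)) ^ (p + k + 1) = 0 := by
        generalize (h.1.2.1 : A) = z at h1 ⊢
        obtain ⟨e, he⟩ : ∃ e, e = α.hom g c - c := ⟨_, rfl⟩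
        have h4 : z ^ p * z ^ k * e = 0 := by
          rw [he]
          linear_combination -h1
        rw [← he]
        linear_combination (z * e ^ (p + k)) * h4
      have := pow_eq_zero_iff (by omega) |>.mp hnil
      linear_combination this
    refine ⟨Away.mk α.invGrading h.1.2.2.2 (k + 1) ⟨_, hinv⟩ ?_, ?_⟩
    · change (h.1.2.1 : A) * c ∈ 𝒜 _
      have := SetLike.mul_mem_graded (A := 𝒜) h.1.2.2.2 hck
      rwa [show (k + 1) • h.1.1 = h.1.1 + k • h.1.1 by rw [add_smul, one_smul, add_comm]]
    · rw [hbc, Away.map_mk]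
      exact away_mk_succ ..
  choose t ht using hex
  obtain ⟨s, hs, -⟩ := (Proj α.invGrading).sheaf.existsUnique_gluing'
    (fun h : α.InvForm V ↦ Proj.basicOpen α.invGrading h.1.2.1) (α.quotientOpen V)
    (fun h ↦ homOfLE h.basicOpen_le) le_rfl
    (fun h ↦ Proj.awayToSection α.invGrading h.1.2.1 (t h)) (fun h h' ↦ by
      let hh' : α.InvForm V := ⟨⟨h.1.1 + h'.1.1, h.1.2.1 * h'.1.2.1,
        Nat.add_pos_left h.1.2.2.1 _, SetLike.mul_mem_graded h.1.2.2.2 h'.1.2.2.2⟩,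
        (boundaryIdeal V).toIdeal.mul_mem_left _ h'.2⟩
      have hD : Proj.basicOpen α.invGrading hh'.1.2.1 = _ := Proj.basicOpen_mul ..
      have h1 := map_awayToSection ht h hh' h'.1.2.2.2 rfl (hD.trans_le inf_le_left)
      have h2 := map_awayToSection ht h' hh' h.1.2.2.2 (mul_comm _ _) (hD.trans_le inf_le_right)
      exact map_eq_map_of_eq hD _ _ inf_le_left inf_le_right (h1.trans h2.symm))
  refine ⟨s, hc.ext_of_away fun h ↦ (hc.away_sectionsMap hVss h s).trans ?_⟩
  rw [← ht]
  congr 1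
  exact (eq_toAway_of_awayToSection_eq _ _ _ _ _ (hs h).symm).symm

end IsCoveredByInvForms
end GradedAction

/-! ### Affineness of the image of `V` in the quotient -/

/-- The ideal of the sections over `V` whose nonvanishing locus is contained in `D`. -/
def idealOfBasicOpenLE {X : Scheme.{u}} (V D : X.Opens) : Ideal Γ(X, V) where
  carrier := {b | X.basicOpen b ≤ D}
  zero_mem' := by
    rw [Set.mem_ofPred_eq, Scheme.basicOpen_zero]
    exact bot_le
  add_mem' ha hb x hx := (X.basicOpen_add_le _ _ hx).elim (fun h ↦ ha h) fun h ↦ hb h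
  smul_mem' c b hb := by
    rw [Set.mem_ofPred_eq, smul_eq_mul, Scheme.basicOpen_mul]
    exact inf_le_right.trans hb

lemma isAffineOpen_basicOpen_of_le {X : Scheme.{u}} {U D : X.Opens} (hD : IsAffineOpen D)
    (hDU : D ≤ U) (s : Γ(X, U)) (hs : X.basicOpen s ≤ D) : IsAffineOpen (X.basicOpen s) := by
  have h := hD.basicOpen (X.presheaf.map (homOfLE hDU).op s)
  have h' : X.basicOpen (X.presheaf.map (homOfLE hDU).op s) = X.basicOpen s :=
    (Scheme.basicOpen_res _ _ _).trans (inf_eq_right.mpr hs)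
  rwa [h'] at h

lemma toSpecΓ_appLE_fromSpec {X Y : Scheme.{u}} (f : X ⟶ Y) {U : Y.Opens} (hU : IsAffineOpen U)
    (h : ⊤ ≤ f ⁻¹ᵁ U) : X.toSpecΓ ≫ Spec.map (f.appLE U ⊤ h) ≫ hU.fromSpec = f := by
  rw [← cancel_epi X.topIso.hom, Scheme.topIso_hom, ← Category.assoc,
    ← Scheme.Opens.toSpecΓ_top, Scheme.Opens.toSpecΓ_SpecMap_appLE_assoc, hU.toSpecΓ_fromSpec,
    Scheme.Hom.resLE_comp_ι]

namespace GradedAction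

variable {n : ℕ} {G : Subgroup (GL (Fin n) ℂ)} {A : Type u} [CommRing A] [Algebra ℂ A]
  {𝒜 : ℕ → Submodule ℂ A} [GradedAlgebra 𝒜] {α : GradedAction G 𝒜} {V : (Proj 𝒜).Opens}

namespace IsCoveredByInvForms

variable (hc : α.IsCoveredByInvForms V) (hVss : V ≤ α.semistableLocus) (hV : α.IsStable V)

lemma mem_basicOpen_sectionsMap (s : Γ(Proj α.invGrading, α.quotientOpen V))
    (x : α.semistableLocus) (hx : x.1 ∈ V) :
    x.1 ∈ (Proj 𝒜).basicOpen (hc.sectionsMap hVss s) ↔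
      α.quotientMap x ∈ (Proj α.invGrading).basicOpen s := by
  let x' : V.toScheme := ⟨x.1, hx⟩
  have hx' : (Proj 𝒜).homOfLE hVss x' = x := Subtype.ext (Scheme.homOfLE_apply hVss x')
  have h1 := basicOpen_appLE ((Proj 𝒜).homOfLE hVss ≫ projMap α.invIncl) (hc.le_preimage hVss) s
  rw [top_inf_eq] at h1
  have h2 : x' ∈ V.toScheme.basicOpen (((Proj 𝒜).homOfLE hVss ≫ projMap α.invIncl).appLE
      (α.quotientOpen V) ⊤ (hc.le_preimage hVss) s) ↔
      α.quotientMap x ∈ (Proj α.invGrading).basicOpen s := by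
    rw [h1, ← hx']
    rfl
  refine Iff.trans ?_ (Scheme.Opens.mem_basicOpen_toScheme.symm.trans h2)
  change x.1 ∈ (Proj 𝒜).basicOpen (V.topIso.hom _) ↔ _
  rw [Scheme.Opens.topIso_hom]
  exact iff_of_eq (congrArg (x.1 ∈ ·) (Scheme.basicOpen_res_eq (X := Proj 𝒜) _ _))

/-- The constant function `1` is a finite sum of invariant functions, each of them vanishing outside
the nonvanishing locus of an invariant form. Without invariance, such a sum exists because `V` is
affine; the lifting of invariants then replaces all the summands by invariant ones. -/
lemma exists_invariant_sum (hc : α.IsCoveredByInvForms V) (hV : α.IsStable V)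
    (hG : IsReductive G) (hW : IsLinearizedVariety α) (hVaff : IsAffineOpen V) :
    ∃ (ι : Type u) (_ : Fintype ι) (h : ι → α.InvForm V)
      (w : ι → Γ(Proj 𝒜, V)), (∀ i, w i ∈ invariantSections α.act hV) ∧
      (∀ i, (Proj 𝒜).basicOpen (w i) ≤ Proj.basicOpen 𝒜 ((h i).1.2.1 : A)) ∧ ∑ i, w i = 1 := by
  let T : α.InvForm V → Ideal Γ(Proj 𝒜, V) :=
    fun h ↦ idealOfBasicOpenLE V (Proj.basicOpen 𝒜 (h.1.2.1 : A))
  have hT : ⨆ h, T h = ⊤ := by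
    have hspan : Ideal.span (⋃ h, (T h : Set Γ(Proj 𝒜, V))) = ⊤ := by
      refine hVaff.self_le_iSup_basicOpen_iff.mp fun x hx ↦ ?_
      obtain ⟨h, hxh⟩ := hc x hx
      obtain ⟨b, hb, hxb⟩ := hVaff.exists_basicOpen_le ⟨x, hxh⟩ hx
      exact TopologicalSpace.Opens.mem_iSup.mpr ⟨⟨b, Set.mem_iUnion.mpr ⟨h, hb⟩⟩, hxb⟩
    rw [← top_le_iff, ← hspan, Ideal.span_le]
    exact Set.iUnion_subset fun h ↦ le_iSup T h
  have h1 : (1 : Γ(Proj 𝒜, V)) ∈ ⨆ h, T h := hT ▸ Submodule.mem_top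
  obtain ⟨a, ha, hsum⟩ := (Submodule.mem_iSup_iff_exists_finsupp T 1).mp h1
  let φ : (a.support → Γ(Proj 𝒜, V)) →ₗ[ℂ] Γ(Proj 𝒜, V) := ∑ i, LinearMap.proj i
  have hφ : ∀ b, φ b = ∑ i, b i := fun b ↦ by simp [φ]
  obtain ⟨w, hwQ, hw, hw1⟩ := exists_invariant_family hG (α.sectionRep hV) φ
    (fun g b ↦ by rw [hφ, hφ, map_sum])
    (fun i ↦ (T i.1).restrictScalars ℂ)
    (fun i g b hb ↦ by
      change (Proj 𝒜).basicOpen ((α.act g).appLE V V (hV g) b) ≤ _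
      rw [basicOpen_appLE]
      refine inf_le_right.trans (((α.act g).preimage_mono hb).trans (le_of_eq ?_))
      have h2 : α.act g ⁻¹ᵁ Proj.basicOpen 𝒜 (i.1.1.2.1 : A) =
        Proj.basicOpen 𝒜 (α.hom g (i.1.1.2.1 : A)) := Proj.map_preimage_basicOpen ..
      rw [h2, i.1.1.2.1.2 g])
    ⊥ (fun g m hm ↦ by rw [Submodule.mem_bot] at hm ⊢; rw [hm, map_zero])
    (a := fun i ↦ a i) (fun i ↦ α.isRationalVector_sectionRep hV hW hVaff _)
    (fun i ↦ ha i.1) (t := 1) (fun g ↦ map_one ((α.act g).appLE V V (hV g)).hom) (by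
      rw [Submodule.mem_bot, hφ, sub_eq_zero, ← hsum, Finsupp.sum]
      exact Finset.sum_coe_sort a.support a)
  refine ⟨a.support, inferInstance, fun i ↦ i.1, w, fun i g ↦ hw i g, hwQ, ?_⟩
  rwa [Submodule.mem_bot, hφ, sub_eq_zero] at hw1

lemma isAffineOpen_quotientOpen (hc : α.IsCoveredByInvForms V) (hVss : V ≤ α.semistableLocus)
    (hV : α.IsStable V) (hG : IsReductive G) (hW : IsLinearizedVariety α)
    (hVaff : IsAffineOpen V) : IsAffineOpen (α.quotientOpen V) := by
  have := hW.reduced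
  obtain ⟨ι, _, h, w, hw, hwh, hw1⟩ := hc.exists_invariant_sum hV hG hW hVaff
  choose s hs using fun i ↦ hc.exists_sectionsMap_eq hVss hV (hw i)
  have hs1 : ∑ i, s i = 1 := hc.sectionsMap_injective hVss (by
    rw [map_sum, map_one, ← hw1]
    exact Finset.sum_congr rfl fun i _ ↦ hs i)
  refine isAffineOpen_of_isAffineOpen_basicOpen _ (Set.range s) ?_ ?_
  · rw [Ideal.eq_top_iff_one, ← hs1]
    exact sum_mem fun i _ ↦ Ideal.subset_span ⟨i, rfl⟩
  · rintro _ ⟨i, rfl⟩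
    refine isAffineOpen_basicOpen_of_le
      (Proj.isAffineOpen_basicOpen _ _ (h i).1.2.2.2 (h i).1.2.2.1) (h i).basicOpen_le _ ?_
    intro y hy
    obtain ⟨x, rfl⟩ := α.quotientMap_surjective hG hW y
    have hxV := (hc.mem_quotientOpen_iff x).mp ((Proj α.invGrading).basicOpen_le _ hy)
    refine (α.mem_basicOpen_invForm (h i) x).mpr (hwh i ?_)
    rw [← hs]
    exact (hc.mem_basicOpen_sectionsMap hVss (s i) x hxV).mpr hy

lemma dense_quotientOpen (hc : α.IsCoveredByInvForms V) (hG : IsReductive G)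
    (hW : IsLinearizedVariety α) (hVdense : Dense (V : Set (Proj 𝒜))) :
    Dense (α.quotientOpen V : Set (Proj α.invGrading)) := by
  have h1 : Dense (α.semistableLocus.ι ⁻¹' (V : Set (Proj 𝒜))) :=
    hVdense.preimage α.semistableLocus.ι.isOpenEmbedding.isOpenMap
  refine ((α.quotientMap_surjective hG hW).denseRange.dense_image
    α.quotientMap.continuous h1).mono ?_
  rintro _ ⟨x, hx, rfl⟩
  exact (hc.mem_quotientOpen_iff x).mpr hx

/-- The pull-back of functions from `quotientOpen V` to the invariant functions on `V`. -/
def sectionsHom : Γ(Proj α.invGrading, α.quotientOpen V) →+* invariantSections α.act hV :=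
  (hc.sectionsMap hVss).hom.codRestrict _ (hc.sectionsMap_mem_invariantSections hVss hV)

lemma sectionsHom_bijective [IsReduced A] : Function.Bijective (hc.sectionsHom hVss hV) :=
  ⟨fun _ _ h ↦ hc.sectionsMap_injective hVss (congrArg Subtype.val h), fun b ↦ by
    obtain ⟨s, hs⟩ := hc.exists_sectionsMap_eq hVss hV b.2
    exact ⟨s, Subtype.ext hs⟩⟩

variable (hY : IsAffineOpen (α.quotientOpen V))

/-- The open immersion `V // G ⟶ (Proj A) // G`, with image `quotientOpen V`. -/
def affineQuotientIncl : α.affineQuotient hV ⟶ α.gitQuotient :=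
  Spec.map (CommRingCat.ofHom (hc.sectionsHom hVss hV)) ≫ hY.fromSpec

lemma isIso_sectionsHom [IsReduced A] :
    IsIso (CommRingCat.ofHom (hc.sectionsHom hVss hV)) :=
  (RingEquiv.ofBijective _ (hc.sectionsHom_bijective hVss hV)).toCommRingCatIso.isIso_hom

lemma isOpenImmersion_affineQuotientIncl [IsReduced A] :
    IsOpenImmersion (hc.affineQuotientIncl hVss hV hY) := by
  have := hc.isIso_sectionsHom hVss hV
  have : IsIso (Spec.map (CommRingCat.ofHom (hc.sectionsHom hVss hV))) := inferInstance
  exact IsOpenImmersion.comp (Spec.map (CommRingCat.ofHom (hc.sectionsHom hVss hV))) hY.fromSpec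

lemma range_affineQuotientIncl [IsReduced A] :
    Set.range (hc.affineQuotientIncl hVss hV hY) =
      (α.quotientOpen V : Set (Proj α.invGrading)) := by
  have := hc.isIso_sectionsHom hVss hV
  rw [← hY.range_fromSpec]
  refine Eq.trans ?_ ((Spec.map (CommRingCat.ofHom (hc.sectionsHom hVss hV))).surjective.range_comp
    hY.fromSpec)
  rfl

lemma affineQuotientMap_incl : α.affineQuotientMap hV ≫ hc.affineQuotientIncl hVss hV hY =
    (Proj 𝒜).homOfLE hVss ≫ α.quotientMap := by
  have h1 : CommRingCat.ofHom (hc.sectionsHom hVss hV) ≫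
      CommRingCat.ofHom (invariantSections α.act hV).subtype = hc.sectionsMap hVss := rfl
  have h2 := toSpecΓ_appLE_fromSpec ((Proj 𝒜).homOfLE hVss ≫ projMap α.invIncl) hY
    (hc.le_preimage hVss)
  refine Eq.trans ?_ h2
  change (V.toSpecΓ ≫ Spec.map _) ≫ Spec.map _ ≫ hY.fromSpec = _
  have h3 : hc.sectionsMap hVss = ((Proj 𝒜).homOfLE hVss ≫ projMap α.invIncl).appLE
    (α.quotientOpen V) ⊤ (hc.le_preimage hVss) ≫ V.topIso.hom := rfl
  rw [Category.assoc, ← Spec.map_comp_assoc, h1, h3, Spec.map_comp_assoc,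
    Scheme.Opens.toSpecΓ, Category.assoc, ← Spec.map_comp_assoc, Iso.hom_inv_id, Spec.map_id,
    Category.id_comp]

end IsCoveredByInvForms
end GradedAction

end GIT

end

theorem mainTheorem10 {n : ℕ} {G : Subgroup (GL (Fin n) ℂ)} (hG : GIT.IsReductive G)
    {A : Type u} [CommRing A] [Algebra ℂ A] {𝒜 : ℕ → Submodule ℂ A} [GradedAlgebra 𝒜]
    (α : GIT.GradedAction G 𝒜) (hW : GIT.IsLinearizedVariety α)
    (V : (Proj 𝒜).Opens) (hVaff : IsAffineOpen V) (hVdense : Dense (V : Set (Proj 𝒜)))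
    (hV : α.IsStable V) (hVss : V ≤ α.semistableLocus)
    (hsat : ∀ D ∈ GIT.boundaryDivisors (V : Set (Proj 𝒜)),
      GIT.IsSaturated α.quotientMap (α.semistableLocus.ι ⁻¹' D)) :
    ∃ (j : α.affineQuotient hV ⟶ α.gitQuotient) (h : α.BoundaryInclusionDefined hV),
      IsOpenImmersion j ∧ Dense (Set.range j) ∧
      α.affineQuotientMap hV ≫ j = (Proj 𝒜).homOfLE hVss ≫ α.quotientMap ∧
      IsClosedImmersion (α.boundaryInclusion hV h) ∧
      Set.range (α.boundaryInclusion hV h) =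
        α.quotientMap '' (α.semistableLocus.ι ⁻¹' (V : Set (Proj 𝒜))ᶜ) ∧
      GIT.boundaryDivisors (Set.range j) =
        (fun C ↦ α.boundaryInclusion hV h '' C) ''
          irreducibleComponents (α.boundary hV).gitQuotient := by
  have hc : α.IsCoveredByInvForms V := fun x hx ↦ by
    obtain ⟨d, h, hd, hh, hhV, hxh⟩ :=
      α.exists_invariant_of_saturated hG hW hVaff hVdense hV hVss hsat hx
    exact ⟨⟨⟨d, h, hd, hh⟩, hhV⟩, hxh⟩
  have := hW.reduced
  have := α.isNoetherianRing_invariants hG hW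
  have := GIT.isNoetherian_proj α.invGrading
  have hY := hc.isAffineOpen_quotientOpen hVss hV hG hW hVaff
  have hYdense := hc.dense_quotientOpen hG hW hVdense
  have h := α.boundaryInclusionDefined hV hG hW
  have hi := α.isClosedImmersion_boundaryInclusion hV hG hW h
  have hr : Set.range (α.boundaryInclusion hV h) =
      (α.quotientOpen V : Set (Proj α.invGrading))ᶜ := Set.ext fun y ↦
    (α.mem_range_boundaryInclusion_iff hV hG hW h y).trans (α.notMem_quotientOpen_iff).symm
  have hj := hc.range_affineQuotientIncl hVss hV hY
  refine ⟨hc.affineQuotientIncl hVss hV hY, h, hc.isOpenImmersion_affineQuotientIncl hVss hV hY,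
    hj ▸ hYdense, hc.affineQuotientMap_incl hVss hV hY, hi,
    α.range_boundaryInclusion hV hG hW h, ?_⟩
  rw [hj]
  exact GIT.boundaryDivisors_eq_image hY hYdense
    (α.boundaryInclusion hV h).isClosedEmbedding.isInducing hr
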